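/- Let $N\ge 2$, let $G=(g_{ij})$ be a nonsingular complex $N\times N$ matrix with $G^t=\pm G$ (the sign $+$ corresponds to $\mathfrak g_N=\mathfrak o_N$, the sign $-$ to $\mathfrak g_N=\mathfrak{sp}_N$), and let $c\in\mathbb C$, $c\neq -N/2$. Let $P=\sum_{i,j} e_{ij}\otimes e_{ji}$, $R(u)=1-\frac hu P$, and $\overline R(u)=g(u/h)R(u)$, where $g(u)\in 1+u^{-1}\mathbb C[[u^{-1}]]$ is the unique series with $g(u+N)=g(u)(1-u^{-2})$; $\overline R^t(u)$ denotes $\overline R(u)$ transposed in one tensor factor. Expressions $(a_1z_1+\dots+a_nz_n)^{k}$ with $k<0$ are expanded in negative powers of the variable on the left. Let $\mathrm{DY}_c(\mathfrak{gl}_N)$ be the ($h$-torsion-free) $\mathbb C[[h]]$-algebra generated by $t_{ij}^{(\pm r)}$, $1\le i,j\le N$, $r\ge 1$, subject to $$R(u-v)T_1(u)T_2(v)=T_2(v)T_1(u)R(u-v),\qquad R(u-v)T^+_1(u)T^+_2(v)=T^+_2(v)T^+_1(u)R(u-v),$$ $$\overline R(u-v+hc/2)\,T_1(u)T^+_2(v)=T^+_2(v)T_1(u)\,\overline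 R(u-v-hc/2),$$ where $T(u)=(t_{ij}(u))$, $T^+(u)=(t^+_{ij}(u))$ with $t_{ij}(u)=\delta_{ij}+h\sum_{r\ge1}t_{ij}^{(r)}u^{-r}$ and $t^+_{ij}(u)=\delta_{ij}-h\sum_{r\ge1}t_{ij}^{(-r)}u^{r-1}$ (here the coefficients of the relations are understood divided by the common powers of $h$). Let $\mathcal V_c(\mathfrak{gl}_N)$ be the $h$-adic completion of the quotient of $\mathrm{DY}_c(\mathfrak{gl}_N)$ by the left ideal generated by all $t_{ij}^{(r)}$, $r\ge1$, with vacuum vector $1$. Put $$S(u)=T(u+hc)\,G\,T^t(-u)=G+h\sum_{r\ge1}S^{(r)}u^{-r},\qquad S^+(u)=T^+(u)\,G\,T^{+t}(-u)=G-h\sum_{r\ge1}S^{(-r)}u^{r-1},$$ let $\mathrm A_c(\mathfrak g_N)\subset \mathrm{DY}_c(\mathfrak{gl}_N)$ be the subalgebra generated by the entries $s_{ij}^{(\pm r)}$ of the matrices $S^{(\pm r)}$, $r\ge 1$, let $\mathcal M'_c=\mathrm A_c(\mathfrak g_N)1\subset\mathcal V_c(\mathfrak{gl}_N)$, and let $\mathcal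 M_c(\mathfrak g_N)\subset \mathcal V_c(\mathfrak{gl}_N)$ be the $h$-adic completion of $\{v\in\mathcal V_c(\mathfrak{gl}_N): h^nv\in\mathcal M'_c\text{ for some }n\ge0\}$. The invariants are $$\mathfrak z(\mathcal M_c(\mathfrak g_N))=\{w\in\mathcal M_c(\mathfrak g_N): S(u)w=G\otimes w\}.$$ For $u_i=u-(i-1)h$, $i=1,\dots,N$, put $$S^+_{[N]}(u_-)=\prod_{i=1}^{N}\Big(S_i^+(u_i)\prod_{j=i+1}^{N}\overline R^t_{ij}(-u_i-u_j)\Big),\qquad S_{[N]}(u_-+hc/2)=\prod_{i=1}^{N}\Big(S_i(u_i+hc/2)\prod_{j=i+1}^{N}\overline R^t_{ij}(-u_i-u_j-2hc)\Big),$$ where the factors are ordered from left to right, and, with $A^{(N)}$ the anti-symmetrizer $\frac1{N!}\sum_{\sigma\in\mathfrak S_N}\mathrm{sgn}(\sigma)\,\sigma$ acting on $(\mathbb C^N)^{\otimes N}$, $$\mathbb A(u)=\mathrm{tr}_{1,\dots,N}\,A^{(N)}\,S^+_{[N]}(u_-)\,S_{[N]}(u_-+hc/2)^{-1}.$$ Then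 $S_{[N]}(u_-+hc/2)$ is invertible, the series $\mathbb M(u)=\mathbb A(u)1$ is well defined (all sums defining its coefficients converge $h$-adically), and all coefficients of $\mathbb M(u)=\sum_{k\in\mathbb Z}\mathbb M_ku^k$ belong to $\mathfrak z(\mathcal M_c(\mathfrak g_N))$. -/

import Mathlib

noncomputable section

namespace TwistedYangian

/-! ### Base ring, expansions and the Yang `R`-matrix -/

/-- The ring `ℂ[[h]]`. -/
abbrev Rh : Type := PowerSeries ℂ

/-- The formal parameter `h`. -/
def h : Rh := PowerSeries.X

/-- If `f(y) = ∑ₚ fₚ y⁻ᵖ`, then `expandInv α β f m` is the coefficient of `u⁻ᵐ` in `f(α u + β)`,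
expanded in negative powers of `u`:
`(α u + β)⁻ᵖ = ∑ₗ (-p choose l) βˡ α^(-p-l) u^(-p-l)`. -/
def expandInv {S M : Type*} [CommRing S] [Algebra ℂ S] [AddCommGroup M] [Module S M]
    (α : ℂ) (β : S) (f : ℕ → M) (m : ℕ) : M :=
  ∑ p ∈ Finset.range (m + 1),
    (((Ring.choose (-(p : ℤ)) (m - p) : ℤ) : S) * algebraMap ℂ S ((α⁻¹) ^ m) * β ^ (m - p)) • f p

/-- The coefficients of the series `g(u) = ∑ₚ gₚ u⁻ᵖ` (see `gSeries_spec`). -/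
def gCoeff (N : ℕ) : ℕ → ℂ
  | 0 => 1
  | n + 1 => (((n : ℂ) + 1) * N)⁻¹ * (gCoeff N n + ∑ p : Fin (n + 1),
      ((Ring.choose (-((p : ℕ) : ℤ)) (n + 2 - p) : ℤ) : ℂ) * (N : ℂ) ^ (n + 2 - (p : ℕ))
        * gCoeff N p)

/-- `g(u)` is the unique series in `1 + u⁻¹ ℂ[[u⁻¹]]` such that `g(u + N) = g(u) (1 - u⁻²)`. -/
theorem gSeries_spec {N : ℕ} (hN : N ≠ 0) :
    PowerSeries.mk (expandInv 1 (N : ℂ) (gCoeff N)) =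
      PowerSeries.mk (gCoeff N) * (1 - (PowerSeries.X : PowerSeries ℂ) ^ 2) := by
  ext m
  rw [mul_sub, mul_one, map_sub, PowerSeries.coeff_mk, PowerSeries.coeff_mk,
    PowerSeries.coeff_mul_X_pow']
  match m with
  | 0 => simp [expandInv]
  | 1 => simp [expandInv, Finset.sum_range_succ]
  | n + 2 =>
    have hN' : (N : ℂ) ≠ 0 := by exact_mod_cast hN
    have hn : ((n : ℂ) + 1) ≠ 0 := by exact_mod_cast Nat.succ_ne_zero n
    have key : ((n : ℂ) + 1) * N * gCoeff N (n + 1) =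
        gCoeff N n + ∑ p ∈ Finset.range (n + 1),
          ((Ring.choose (-(p : ℤ)) (n + 2 - p) : ℤ) : ℂ) * (N : ℂ) ^ (n + 2 - p)
            * gCoeff N p := by
      conv_lhs => rw [gCoeff]
      rw [Finset.sum_range fun p => ((Ring.choose (-(p : ℤ)) (n + 2 - p) : ℤ) : ℂ)
        * (N : ℂ) ^ (n + 2 - p) * gCoeff N p]
      field_simp
    unfold expandInv
    rw [Finset.sum_range_succ, Finset.sum_range_succ]
    have h1 : n + 2 - (n + 1) = 1 := by omega
    simp only [inv_one, one_pow, map_one, mul_one, smul_eq_mul, PowerSeries.coeff_mk, h1,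
      Nat.sub_self, Ring.choose_zero_right, Ring.choose_one_right, pow_one, pow_zero, Int.cast_one,
      one_mul, Nat.le_add_left, if_true, Nat.add_sub_cancel]
    push_cast
    linear_combination -key

/-- The matrix index set of `End ℂᴺ ⊗ End ℂᴺ`. -/
abbrev Idx2 (N : ℕ) : Type := Fin N × Fin N

/-- The permutation operator `P = ∑ e_{ij} ⊗ e_{ji}`. -/
def perm {N : ℕ} (S : Type*) [Zero S] [One S] : Matrix (Idx2 N) (Idx2 N) S :=
  Matrix.of fun a b => if a.1 = b.2 ∧ a.2 = b.1 then 1 else 0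

/-- `Rbar N p` is the coefficient of `x⁻ᵖ` in the normalized `R`-matrix
`R̄(x) = g(x/h) (1 - (h/x) P)`. -/
def Rbar (N : ℕ) : ℕ → Matrix (Idx2 N) (Idx2 N) Rh
  | 0 => 1
  | p + 1 => h ^ (p + 1) • (PowerSeries.C (gCoeff N (p + 1)) • (1 : Matrix (Idx2 N) (Idx2 N) Rh)
      - PowerSeries.C (gCoeff N p) • perm Rh)

/-- The transposition applied on the first tensor factor. -/
def transp₁ {N : ℕ} {S : Type*} (A : Matrix (Idx2 N) (Idx2 N) S) : Matrix (Idx2 N) (Idx2 N) S :=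
  Matrix.of fun a b => A (b.1, a.2) (a.1, b.2)

/-! ### The double Yangian at the level `c` -/

/-- Generators: `pos i j r` is `t_{ij}^{(r+1)}` and `neg i j r` is `t_{ij}^{(-r-1)}`. -/
inductive Gen (N : ℕ) : Type
  | pos (i j : Fin N) (r : ℕ) : Gen N
  | neg (i j : Fin N) (r : ℕ) : Gen N

section Series

variable {N : ℕ} {D : Type*} [Ring D] [Algebra Rh D]

/-- `∑_{r ≥ 1} t^{(r)} u⁻ʳ`, a series in the variable `u⁻¹`. -/
def tau (t : Gen N → D) : PowerSeries (Matrix (Fin N) (Fin N) D) :=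
  PowerSeries.mk fun m => match m with
    | 0 => 0
    | r + 1 => Matrix.of fun i j => t (.pos i j r)

/-- `∑_{r ≥ 1} t^{(-r)} u^{r-1}`, a series in the variable `u`. -/
def tauPlus (t : Gen N → D) : PowerSeries (Matrix (Fin N) (Fin N) D) :=
  PowerSeries.mk fun r => Matrix.of fun i j => t (.neg i j r)

/-- `T(u) = 1 + h ∑_{r ≥ 1} t^{(r)} u⁻ʳ`, a series in the variable `u⁻¹`. -/
def T (t : Gen N → D) : PowerSeries (Matrix (Fin N) (Fin N) D) := 1 + h • tau t

/-- `T⁺(u) = 1 - h ∑_{r ≥ 1} t^{(-r)} u^{r-1}`, a series in the variable `u`. -/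
def TPlus (t : Gen N → D) : PowerSeries (Matrix (Fin N) (Fin N) D) := 1 - h • tauPlus t

/-- `X ↦ X ⊗ 1`. -/
def emb₁ (X : Matrix (Fin N) (Fin N) D) : Matrix (Idx2 N) (Idx2 N) D :=
  Matrix.of fun a b => if a.2 = b.2 then X a.1 b.1 else 0

/-- `X ↦ 1 ⊗ X`. -/
def emb₂ (X : Matrix (Fin N) (Fin N) D) : Matrix (Idx2 N) (Idx2 N) D :=
  Matrix.of fun a b => if a.1 = b.1 then X a.2 b.2 else 0

/-- Series in two variables `x` (outer) and `y` (inner), with coefficients in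
`End ℂᴺ ⊗ End ℂᴺ ⊗ D`. -/
abbrev Ser2 (N : ℕ) (D : Type*) [Ring D] : Type _ :=
  PowerSeries (PowerSeries (Matrix (Idx2 N) (Idx2 N) D))

/-- The first tensor copy, in the outer variable. -/
def first (F : PowerSeries (Matrix (Fin N) (Fin N) D)) : Ser2 N D :=
  PowerSeries.mk fun m => PowerSeries.C (emb₁ (PowerSeries.coeff m F))

/-- The second tensor copy, in the inner variable. -/
def second (F : PowerSeries (Matrix (Fin N) (Fin N) D)) : Ser2 N D :=
  PowerSeries.C (PowerSeries.mk fun m => emb₂ (PowerSeries.coeff m F))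

/-- The outer variable. -/
def xvar : Ser2 N D := PowerSeries.X

/-- The inner variable. -/
def yvar : Ser2 N D := PowerSeries.C PowerSeries.X

/-- The constant series `P`. -/
def permSer : Ser2 N D := PowerSeries.C (PowerSeries.C (perm D))

/-- `R̄(u - v + κ)`, in the outer variable `u⁻¹` and the inner variable `v`, expanded in negative
powers of `u`. -/
def RbarSer (κ : Rh) : Ser2 N D :=
  PowerSeries.mk fun m => PowerSeries.mk fun b =>
    (expandInv (S := PowerSeries Rh) 1 (PowerSeries.C κ - PowerSeries.X)
      (fun p => (Rbar N p).map PowerSeries.C) m).map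
      fun s => algebraMap Rh D (PowerSeries.coeff b s)

/-- The differences of both sides of the three defining relations, at the level `c`.

* `0`: `R(u-v) T₁(u) T₂(v) = T₂(v) T₁(u) R(u-v)`, with `x = u⁻¹`, `y = v⁻¹`,
  multiplied by `x y (u - v) = y - x`;
* `1`: `R(u-v) T⁺₁(u) T⁺₂(v) = T⁺₂(v) T⁺₁(u) R(u-v)`, with `x = u`, `y = v`,
  multiplied by `u - v`;
* `2`: `R̄(u-v+hc/2) T₁(u) T⁺₂(v) = T⁺₂(v) T₁(u) R̄(u-v-hc/2)`, with `x = u⁻¹`, `y = v`. -/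
def relationSeries (c : ℂ) (t : Gen N → D) : Fin 3 → Ser2 N D
  | 0 => (yvar - xvar - h • (xvar * yvar * permSer)) * first (T t) * second (T t)
      - second (T t) * first (T t) * (yvar - xvar - h • (xvar * yvar * permSer))
  | 1 => (xvar - yvar - h • permSer) * first (TPlus t) * second (TPlus t)
      - second (TPlus t) * first (TPlus t) * (xvar - yvar - h • permSer)
  | 2 => RbarSer (h * PowerSeries.C (c / 2)) * first (T t) * second (TPlus t)
      - second (TPlus t) * first (T t) * RbarSer (-(h * PowerSeries.C (c / 2)))

end Series

/-- The free algebra over `ℂ[[h]]` on the generators `t_{ij}^{(±r)}`. -/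
abbrev Free (N : ℕ) : Type := FreeAlgebra Rh (Gen N)

/-- The defining relations. The entries of `T(u) - 1` and `T⁺(u) - 1` carry the factor `h`, so all
coefficients of the matrix relations are multiples of powers of `h` (in fact of `h²`); as usual, an
identity `hᵏ x = 0` among them stands for the relation `x = 0`, so that the resulting
`ℂ[[h]]`-algebra is the one with the Poincaré–Birkhoff–Witt basis. -/
def Rel (N : ℕ) (c : ℂ) (x y : Free N) : Prop :=
  y = 0 ∧ ∃ (s : Fin 3) (k a b : ℕ) (I J : Idx2 N),
    h ^ k • x = PowerSeries.coeff b (PowerSeries.coeff a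
      (relationSeries c (FreeAlgebra.ι Rh : Gen N → Free N) s)) I J

/-- The double Yangian `DY_c(gl_N)` at the level `c`. -/
def DY (N : ℕ) (c : ℂ) : Type := RingQuot (Rel N c)

instance (N : ℕ) (c : ℂ) : Ring (DY N c) := inferInstanceAs (Ring (RingQuot (Rel N c)))

instance (N : ℕ) (c : ℂ) : Algebra Rh (DY N c) :=
  inferInstanceAs (Algebra Rh (RingQuot (Rel N c)))

/-- The generators of `DY_c(gl_N)`. -/
def gen (N : ℕ) (c : ℂ) (x : Gen N) : DY N c :=
  RingQuot.mkAlgHom Rh (Rel N c) (FreeAlgebra.ι Rh x)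

/-! ### The vacuum module `V_c(gl_N)` -/

/-- The left ideal of `DY_c(gl_N)` generated by all `t_{ij}^{(r)}`, `r ≥ 1`. -/
def vacIdeal (N : ℕ) (c : ℂ) : Ideal (DY N c) :=
  Ideal.span {x | ∃ i j r, x = gen N c (.pos i j r)}

/-- The ideal `(h)` of `ℂ[[h]]`. -/
def hIdeal : Ideal Rh := Ideal.span {h}

/-- The vacuum module `V_c(gl_N)`: the `h`-adic completion of `DY_c(gl_N) / vacIdeal`. -/
def Vac (N : ℕ) (c : ℂ) : Type := AdicCompletion hIdeal (DY N c ⧸ vacIdeal N c)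

instance (N : ℕ) (c : ℂ) : AddCommGroup (Vac N c) :=
  inferInstanceAs (AddCommGroup (AdicCompletion hIdeal (DY N c ⧸ vacIdeal N c)))

instance (N : ℕ) (c : ℂ) : Module Rh (Vac N c) :=
  inferInstanceAs (Module Rh (AdicCompletion hIdeal (DY N c ⧸ vacIdeal N c)))

/-- The `h`-adic topology on `V_c(gl_N)`. -/
instance (N : ℕ) (c : ℂ) : TopologicalSpace (Vac N c) := hIdeal.adicModuleTopology (Vac N c)

/-- The vacuum vector `1`. -/
def vac (N : ℕ) (c : ℂ) : Vac N c :=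
  AdicCompletion.of hIdeal (DY N c ⧸ vacIdeal N c) (Submodule.Quotient.mk 1)

/-- The action of `DY_c(gl_N)` on `V_c(gl_N)` induced by left multiplication. -/
def act {N : ℕ} {c : ℂ} (x : DY N c) : Vac N c →ₗ[Rh] Vac N c :=
  (AdicCompletion.map hIdeal (Algebra.lsmul Rh Rh (DY N c ⧸ vacIdeal N c) x)).restrictScalars Rh

/-! ### The series `S(u)`, `S⁺(u)`, the algebra `A_c(g_N)` and the module `M_c(g_N)` -/

section

variable {N : ℕ} {D : Type*} [Ring D] [Algebra Rh D]

/-- Entrywise transposition of a matrix-valued series. -/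
def transpSer (F : PowerSeries (Matrix (Fin N) (Fin N) D)) :
    PowerSeries (Matrix (Fin N) (Fin N) D) :=
  PowerSeries.mk fun m => (PowerSeries.coeff m F).transpose

/-- `f(α u + β)` for a series `f` in the inverse variable, expanded in negative powers of `u`. -/
def substInv (α : ℂ) (β : Rh) (F : PowerSeries (Matrix (Fin N) (Fin N) D)) :
    PowerSeries (Matrix (Fin N) (Fin N) D) :=
  PowerSeries.mk (expandInv α β fun p => PowerSeries.coeff p F)

/-- `f(-u)` for a series `f` in the variable `u`. -/
def negArg (F : PowerSeries (Matrix (Fin N) (Fin N) D)) :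
    PowerSeries (Matrix (Fin N) (Fin N) D) :=
  PowerSeries.mk fun m => (-1 : ℤ) ^ m • PowerSeries.coeff m F

/-- The matrix `G` as a constant series. -/
def constSer (G : Matrix (Fin N) (Fin N) ℂ) : PowerSeries (Matrix (Fin N) (Fin N) D) :=
  PowerSeries.C (G.map fun z => algebraMap Rh D (PowerSeries.C z))

end

section

variable {N : ℕ} {D : Type*} [Ring D] [Algebra Rh D]

theorem substInv_one_add (α : ℂ) (β : Rh) (F : PowerSeries (Matrix (Fin N) (Fin N) D)) :
    substInv α β (1 + h • F) = 1 + h • substInv α β F := by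
  ext1 m
  simp only [substInv, PowerSeries.coeff_mk, map_add, PowerSeries.coeff_one, expandInv, smul_add,
    Finset.sum_add_distrib, PowerSeries.coeff_smul]
  congr 1
  · rw [Finset.sum_eq_single_of_mem 0 (by simp)]
    · rcases m with _ | m
      · simp
      · simp [Ring.choose_zero_succ]
    · intro p _ hp
      simp [hp]
  · rw [Finset.smul_sum]
    exact Finset.sum_congr rfl fun p _ => smul_comm _ _ _

theorem transpSer_one_add (F : PowerSeries (Matrix (Fin N) (Fin N) D)) :
    transpSer (1 + h • F) = 1 + h • transpSer F := by
  ext1 m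
  simp only [transpSer, PowerSeries.coeff_mk, map_add, PowerSeries.coeff_one,
    PowerSeries.coeff_smul, Matrix.transpose_add, Matrix.transpose_smul]
  split_ifs <;> simp

theorem transpSer_negArg_one_sub (F : PowerSeries (Matrix (Fin N) (Fin N) D)) :
    transpSer (negArg (1 - h • F)) = 1 - h • transpSer (negArg F) := by
  ext1 m
  simp only [transpSer, negArg, PowerSeries.coeff_mk, map_sub, PowerSeries.coeff_one,
    PowerSeries.coeff_smul, Matrix.transpose_sub, Matrix.transpose_smul, smul_sub]
  congr 1
  · split_ifs with hm <;> simp [hm]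
  · rw [smul_comm]

end

variable {N : ℕ}

/-- `S(u) = T(u + hc) G Tᵗ(-u)`, a series in `u⁻¹`. -/
def S (c : ℂ) (G : Matrix (Fin N) (Fin N) ℂ) : PowerSeries (Matrix (Fin N) (Fin N) (DY N c)) :=
  substInv 1 (h * PowerSeries.C c) (T (gen N c)) * constSer G
    * transpSer (substInv (-1) 0 (T (gen N c)))

/-- `S⁺(u) = T⁺(u) G T⁺ᵗ(-u)`, a series in `u`. -/
def SPlus (c : ℂ) (G : Matrix (Fin N) (Fin N) ℂ) :
    PowerSeries (Matrix (Fin N) (Fin N) (DY N c)) :=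
  TPlus (gen N c) * constSer G * transpSer (negArg (TPlus (gen N c)))

/-- The series `∑_{r ≥ 1} s^{(r)} u⁻ʳ`, where `S(u) = G + h ∑_{r ≥ 1} s^{(r)} u⁻ʳ`
(see `S_eq`). -/
def sigma (c : ℂ) (G : Matrix (Fin N) (Fin N) ℂ) :
    PowerSeries (Matrix (Fin N) (Fin N) (DY N c)) :=
  substInv 1 (h * PowerSeries.C c) (tau (gen N c)) * constSer G
    + constSer G * transpSer (substInv (-1) 0 (tau (gen N c)))
    + h • (substInv 1 (h * PowerSeries.C c) (tau (gen N c)) * constSer G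
      * transpSer (substInv (-1) 0 (tau (gen N c))))

/-- The series `∑_{r ≥ 1} s^{(-r)} u^{r-1}`, where `S⁺(u) = G - h ∑_{r ≥ 1} s^{(-r)} u^{r-1}`
(see `SPlus_eq`). -/
def sigmaPlus (c : ℂ) (G : Matrix (Fin N) (Fin N) ℂ) :
    PowerSeries (Matrix (Fin N) (Fin N) (DY N c)) :=
  tauPlus (gen N c) * constSer G + constSer G * transpSer (negArg (tauPlus (gen N c)))
    - h • (tauPlus (gen N c) * constSer G * transpSer (negArg (tauPlus (gen N c))))

theorem S_eq (c : ℂ) (G : Matrix (Fin N) (Fin N) ℂ) : S c G = constSer G + h • sigma c G := by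
  rw [S, sigma, T, substInv_one_add, substInv_one_add, transpSer_one_add]
  simp only [mul_add, add_mul, mul_one, one_mul, smul_add, smul_mul_assoc, mul_smul_comm]
  abel

theorem SPlus_eq (c : ℂ) (G : Matrix (Fin N) (Fin N) ℂ) :
    SPlus c G = constSer G - h • sigmaPlus c G := by
  rw [SPlus, sigmaPlus, TPlus, transpSer_negArg_one_sub]
  simp only [mul_sub, sub_mul, mul_one, one_mul, smul_add, smul_sub, smul_mul_assoc, mul_smul_comm]
  abel

/-- The subalgebra `A_c(g_N)` of `DY_c(gl_N)` generated by all `s_{ij}^{(±r)}`, `r ≥ 1`. -/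
def Ac (c : ℂ) (G : Matrix (Fin N) (Fin N) ℂ) : Subalgebra Rh (DY N c) :=
  Algebra.adjoin Rh {x | ∃ (i j : Fin N) (r : ℕ),
    x = PowerSeries.coeff (r + 1) (sigma c G) i j ∨ x = PowerSeries.coeff r (sigmaPlus c G) i j}

/-- The `A_c(g_N)`-submodule `M'_c(g_N)` of `V_c(gl_N)` generated by the vacuum vector. -/
def MPrime (c : ℂ) (G : Matrix (Fin N) (Fin N) ℂ) : Submodule Rh (Vac N c) :=
  Submodule.span Rh {v | ∃ x ∈ Ac c G, v = act x (vac N c)}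

/-- `{v ∈ V_c(gl_N) : hⁿ v ∈ M'_c(g_N) for some n ≥ 0}`. -/
def MSat (c : ℂ) (G : Matrix (Fin N) (Fin N) ℂ) : Submodule Rh (Vac N c) where
  carrier := {v | ∃ n : ℕ, h ^ n • v ∈ MPrime c G}
  zero_mem' := ⟨0, by simp⟩
  add_mem' := by
    rintro v w ⟨m, hm⟩ ⟨n, hn⟩
    refine ⟨m + n, ?_⟩
    rw [smul_add]
    refine add_mem ?_ ?_
    · rw [pow_add, mul_comm, mul_smul]
      exact Submodule.smul_mem _ _ hm
    · rw [pow_add, mul_smul]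
      exact Submodule.smul_mem _ _ hn
  smul_mem' := by
    rintro a v ⟨n, hn⟩
    exact ⟨n, by rw [smul_comm]; exact Submodule.smul_mem _ _ hn⟩

/-- The vacuum module `M_c(g_N)`: the `h`-adic completion of `MSat`, realized as the `h`-adic closure
of `MSat` in the complete module `V_c(gl_N)`, whose topology induces the `h`-adic topology. -/
def Mc (c : ℂ) (G : Matrix (Fin N) (Fin N) ℂ) : Submodule Rh (Vac N c) :=
  ⨅ n : ℕ, MSat c G ⊔ hIdeal ^ n • (⊤ : Submodule Rh (Vac N c))

/-- The submodule of invariants `z(M_c(g_N)) = {w ∈ M_c(g_N) : S(u) w = G ⊗ w}`; the condition is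
written out for every matrix entry and every power of `u`. -/
def invariants (c : ℂ) (G : Matrix (Fin N) (Fin N) ℂ) : Set (Vac N c) :=
  {w | w ∈ Mc c G ∧ ∀ (i j : Fin N) (m : ℕ),
    act (PowerSeries.coeff m (S c G) i j) w = if m = 0 then PowerSeries.C (G i j) • w else 0}

/-! ### The series `A(u)` -/

/-- The matrix index set of `(End ℂᴺ)^{⊗N}`. -/
abbrev IdxN (N : ℕ) : Type := Fin N → Fin N

/-- The copy `X_i` of a matrix `X` on the `i`-th tensor factor of `(End ℂᴺ)^{⊗N}`. -/
def embAt {D : Type*} [Zero D] (i : Fin N) (X : Matrix (Fin N) (Fin N) D) :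
    Matrix (IdxN N) (IdxN N) D :=
  Matrix.of fun I K => if ∀ l, l ≠ i → I l = K l then X (I i) (K i) else 0

/-- The copy `X_{ij}` of `X ∈ (End ℂᴺ)^{⊗2}` on the `i`-th and `j`-th tensor factors. -/
def embAt₂ {D : Type*} [Zero D] (i j : Fin N) (X : Matrix (Idx2 N) (Idx2 N) D) :
    Matrix (IdxN N) (IdxN N) D :=
  Matrix.of fun I K =>
    if ∀ l, l ≠ i → l ≠ j → I l = K l then X (I i, I j) (K i, K j) else 0

/-- The coefficients of `R̄ᵗ_{ij}(-2u + b)`, a series in `u⁻¹`. -/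
def RbarT (c : ℂ) (i j : Fin N) (b : Rh) : PowerSeries (Matrix (IdxN N) (IdxN N) (DY N c)) :=
  PowerSeries.mk fun m => embAt₂ i j
    ((expandInv (-2) b (fun p => transp₁ (Rbar N p)) m).map (algebraMap Rh (DY N c)))

/-- The tensor positions following `i`, in increasing order. -/
def later (i : Fin N) : List (Fin N) := (List.finRange N).filter fun j => decide (i < j)

/-- `S_{[N]}(u₋ + hc/2)`, a series in `u⁻¹`. The positions are numbered from `0`, so that
`u_i = u - i h`; the factors are `S_i(u_i + hc/2)` and
`R̄ᵗ_{ij}(-u_i - u_j - 2hc) = R̄ᵗ_{ij}(-2u + (i + j - 2c) h)`. -/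
def SN (c : ℂ) (G : Matrix (Fin N) (Fin N) ℂ) :
    PowerSeries (Matrix (IdxN N) (IdxN N) (DY N c)) :=
  ((List.finRange N).map fun i : Fin N =>
    (PowerSeries.mk fun m => embAt i (PowerSeries.coeff m
        (substInv 1 (h * PowerSeries.C (c / 2 - (i : ℕ))) (S c G))))
      * ((later i).map fun j : Fin N =>
          RbarT c i j (h * PowerSeries.C (((i : ℕ) : ℂ) + (j : ℕ) - 2 * c))).prod).prod

/-- Series in `u^{±1}` whose coefficients are operators on `(ℂᴺ)^{⊗N} ⊗ V_c(gl_N)`, given by their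
matrix entries: the argument `k : ℤ` is the power of `u`. -/
abbrev OpSer (N : ℕ) (c : ℂ) : Type := ℤ → IdxN N → IdxN N → Vac N c → Vac N c

/-- Series in `(ℂᴺ)^{⊗N} ⊗ V_c(gl_N) [[u^{±1}]]`. -/
abbrev VecSer (N : ℕ) (c : ℂ) : Type := ℤ → IdxN N → Vac N c

/-- The operator series given by a series in `u⁻¹` over the double Yangian. -/
def ofInv {c : ℂ} (F : PowerSeries (Matrix (IdxN N) (IdxN N) (DY N c))) : OpSer N c :=
  fun k I K w => if k ≤ 0 then act (PowerSeries.coeff (-k).toNat F I K) w else 0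

/-- The terms of the expansion of the coefficient of `uᵏ` in `S⁺_i(u + a)`, applied to `w`:
`(u + a)^{k+l}` contributes `(k+l choose l) aˡ uᵏ`. -/
def shiftTerm (c : ℂ) (G : Matrix (Fin N) (Fin N) ℂ) (i : Fin N) (a : Rh) (k : ℕ)
    (I K : IdxN N) (w : Vac N c) (l : ℕ) : Vac N c :=
  ((((k + l).choose l : ℕ) : Rh) * a ^ l) •
    act (embAt i (PowerSeries.coeff (k + l) (SPlus c G)) I K) w

/-- The operator series `S⁺_i(u + a)` for `a ∈ h ℂ[[h]]`; the sums converge `h`-adically. -/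
def SPlusOp (c : ℂ) (G : Matrix (Fin N) (Fin N) ℂ) (i : Fin N) (a : Rh) : OpSer N c :=
  fun k I K w => if 0 ≤ k then ∑' l : ℕ, shiftTerm c G i a k.toNat I K w l else 0

/-- The terms of the coefficient of `uᵏ` in the product `F(u) X(u)`. -/
def applyTerm {c : ℂ} (F : OpSer N c) (X : VecSer N c) (k : ℤ) (I : IdxN N) (m : ℤ) : Vac N c :=
  ∑ K : IdxN N, F m I K (X (k - m) K)

/-- The product `F(u) X(u)`; its coefficients are `h`-adically convergent sums. -/
def applyOp {c : ℂ} (F : OpSer N c) (X : VecSer N c) : VecSer N c :=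
  fun k I => ∑' m : ℤ, applyTerm F X k I m

/-- The product `F₁(u) ⋯ F_r(u) X(u)`. -/
def applyList {c : ℂ} (L : List (OpSer N c)) (X : VecSer N c) : VecSer N c :=
  L.foldr applyOp X

/-- All sums occurring in `applyList L X` converge `h`-adically. -/
def ApplyConverges {c : ℂ} : List (OpSer N c) → VecSer N c → Prop
  | [], _ => True
  | F :: L, X => ApplyConverges L X ∧ ∀ k I, Summable (applyTerm F (applyList L X) k I)

/-- The factors, in order, of `S⁺_{[N]}(u₋)`: for `i = 0, …, N-1` the factor `S⁺_i(u - i h)`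
followed by `R̄ᵗ_{ij}(-u_i - u_j) = R̄ᵗ_{ij}(-2u + (i + j) h)` for `j > i`. -/
def SPlusN (c : ℂ) (G : Matrix (Fin N) (Fin N) ℂ) : List (OpSer N c) :=
  (List.finRange N).flatMap fun i : Fin N =>
    SPlusOp c G i (-(h * PowerSeries.C ((i : ℕ) : ℂ))) ::
      (later i).map fun j : Fin N =>
        ofInv (RbarT c i j (h * PowerSeries.C (((i : ℕ) : ℂ) + (j : ℕ))))

/-- The series `S_{[N]}(u₋ + hc/2)⁻¹ (e_K ⊗ w)`. -/
def startSer (c : ℂ) (G : Matrix (Fin N) (Fin N) ℂ) (w : Vac N c) (K : IdxN N) : VecSer N c :=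
  fun k I => ofInv (Ring.inverse (SN c G)) k I K w

/-- The anti-symmetrizer `(1/N!) ∑_σ sgn(σ) σ` acting on `(ℂᴺ)^{⊗N}`. -/
def antisym (N : ℕ) : Matrix (IdxN N) (IdxN N) ℂ :=
  Matrix.of fun I K => ((Nat.factorial N : ℕ) : ℂ)⁻¹ *
    ∑ σ : Equiv.Perm (Fin N), if I = K ∘ σ then (((Equiv.Perm.sign σ : ℤ)) : ℂ) else 0

/-- The coefficient of `uᵏ` in
`A(u) w = tr_{1,…,N} A^{(N)} S⁺_{[N]}(u₋) S_{[N]}(u₋ + hc/2)⁻¹ w`. -/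
def opA (c : ℂ) (G : Matrix (Fin N) (Fin N) ℂ) (k : ℤ) (w : Vac N c) : Vac N c :=
  ∑ K : IdxN N, ∑ I : IdxN N,
    PowerSeries.C (antisym N K I) • applyList (SPlusN c G) (startSer c G w K) k I

/-- The series `A(u) w` is well defined: `S_{[N]}(u₋ + hc/2)` is invertible and all sums in the
product converge `h`-adically. -/
def AWellDefined (c : ℂ) (G : Matrix (Fin N) (Fin N) ℂ) (w : Vac N c) : Prop :=
  IsUnit (SN c G) ∧
    (∀ (i : Fin N) (k : ℕ) (I K : IdxN N) (v : Vac N c),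
      Summable (shiftTerm c G i (-(h * PowerSeries.C ((i : ℕ) : ℂ))) k I K v)) ∧
    ∀ K : IdxN N, ApplyConverges (SPlusN c G) (startSer c G w K)

/-- The coefficients of the series `M(u) = A(u) 1`. -/
def M (c : ℂ) (G : Matrix (Fin N) (Fin N) ℂ) (k : ℤ) : Vac N c := opA c G k (vac N c)

end TwistedYangian

end

/-! Since `T(v)` fixes the vacuum, and `S(v)w = G ⊗ w` for every vector `w` fixed by `T(v)`, it is
enough to show that each coefficient of `M(u)` is obtained from the vacuum by an operator commuting
with `T(v)` (`actsAs_S`, `actsAs_T_M`).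

On the vacuum every factor of `S_{[N]}(u₋ + hc/2)` acts by a scalar matrix, so the inverse
contributes only a matrix of scalar series. There remains `A^{(N)} S⁺_{[N]}(u₋)`. Reordering with
the partially transposed RTT relation `T⁺_i(-u_i)ᵗ R̄ᵗ_{ij} T⁺_j(u_j) = T⁺_j(u_j) R̄ᵗ_{ij}
T⁺_i(-u_i)ᵗ` gives `S⁺_{[N]} = (∏ T⁺_i(u_i)) K (∏ T⁺_i(-u_i)ᵗ)` with `K` scalar (`lauS_eq`). The
arguments `u_i` differ by `h`, and `R(h) = 1 - P`; hence each of the three blocks `X` satisfies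
`A^{(N)} X = A^{(N)} X A^{(N)}` (`asym_mul_of_anti`). For `K` this rests on `Gᵗ = ±G`
(`anti_scalarPart`). So `A^{(N)} S⁺_{[N]}` is a product of three blocks, each preceded by its own
`A^{(N)}`.

The two non-scalar blocks are quantum determinants in disguise, and their entries commute with
`T(v)` (`row_fused`, `col_fused`). Passing `T_0(v)` through `∏ T⁺_i` costs a product of the matrices
`R̄_{0i}`. Next to `A^{(N)}` this product equals the scalar `∏ g · (1 - a)` with `a` the parameter
`h/x` at one end of the string: fusion collapses it to `1 - a ∑ P_{0i}`, and `A^{(N)} ∑ P_{0i} =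
A^{(N)}` because `N + 1` vectors of `ℂᴺ` are dependent. The functional equation of `g` says exactly
that this scalar is `1` (`prod_gser_subst`). The shifts `± hc/2` disappear together with `R̄`.

The analysis is done modulo `hⁿ` for every `n`. There `u - ih` may be substituted into series in
`u`, the operators become Laurent series, and infinite sums become finite. The price is that `h` is
nilpotent and cannot be cancelled; the specialization `u - v = ±h` of a relation carrying the factor
`u - v` therefore needs a division carried out beforehand, in two independent variables
(`commutator_of_sub_eq`). -/

noncomputable section

set_option linter.unusedSectionVars false

namespace TwistedYangian

open Matrix

/-! ### Operators on tensor factors -/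

section Tens

variable {n ι κ κ' : Type*} [Fintype n] [DecidableEq n] [Fintype ι] [DecidableEq ι]
  [Fintype κ] [DecidableEq κ] [Fintype κ'] [DecidableEq κ'] {D : Type*} [Ring D] [Algebra Rh D]

open Classical in
/-- An operator on the tensor factors `κ`, acting on the tensor factors `f k` among `ι`. -/
def tens (f : κ → ι) (X : Matrix (κ → n) (κ → n) D) : Matrix (ι → n) (ι → n) D :=
  Matrix.of fun I K => if ∀ l, l ∉ Set.range f → I l = K l then X (I ∘ f) (K ∘ f) else 0

/-- A nonzero summand requires an intermediate index equal to `I` off the range of `f`, and such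
indices are exactly the functions `Function.extend f M I`. -/
theorem tens_mul_apply {f : κ → ι} (hf : f.Injective) (X : Matrix (κ → n) (κ → n) D)
    (Y : Matrix (ι → n) (ι → n) D) (I K : ι → n) :
    (tens f X * Y) I K = ∑ M : κ → n, X (I ∘ f) M * Y (Function.extend f M I) K := by
  rw [Matrix.mul_apply]
  symm
  refine Fintype.sum_of_injective (fun M => Function.extend f M I) ?_ _ _ ?_ ?_
  · intro M M' hM
    funext k
    simpa [hf.extend_apply] using congrFun hM (f k)
  · intro L hL
    rw [tens, Matrix.of_apply, if_neg, zero_mul]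
    intro h
    refine hL ⟨L ∘ f, ?_⟩
    funext l
    by_cases hl : ∃ k, f k = l
    · obtain ⟨k, rfl⟩ := hl
      simp [hf.extend_apply]
    · simp only [Function.extend_apply' _ _ _ hl]
      exact h l fun ⟨k, hk⟩ => hl ⟨k, hk⟩
  · intro M
    rw [tens, Matrix.of_apply, if_pos]
    · congr 2
      funext k
      simp [hf.extend_apply]
    · intro l hl
      exact (Function.extend_apply' _ _ _ fun ⟨k, hk⟩ => hl ⟨k, hk⟩).symm

theorem tens_mul {f : κ → ι} (hf : f.Injective) (X Y : Matrix (κ → n) (κ → n) D) :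
    tens f (X * Y) = tens f X * tens f Y := by
  ext I K
  rw [tens_mul_apply hf]
  have h1 : ∀ M : κ → n, Function.extend f M I ∘ f = M := fun M => by
    funext k; simp [hf.extend_apply]
  have h2 : ∀ M : κ → n, (∀ l, l ∉ Set.range f → Function.extend f M I l = K l) ↔
      ∀ l, l ∉ Set.range f → I l = K l := fun M => by
    refine forall₂_congr fun l hl => ?_
    rw [Function.extend_apply' _ _ _ fun ⟨k, hk⟩ => hl ⟨k, hk⟩]
  simp only [tens, Matrix.of_apply, h1, h2, Matrix.mul_apply]
  split_ifs <;> simp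

theorem tens_one {f : κ → ι} : tens f (1 : Matrix (κ → n) (κ → n) D) = 1 := by
  ext I K
  simp only [tens, Matrix.of_apply, Matrix.one_apply]
  by_cases h : I = K
  · simp [h]
  · rw [if_neg h]
    split_ifs with h1 h2
    · refine absurd (funext fun l => ?_) h
      by_cases hl : l ∈ Set.range f
      · obtain ⟨k, rfl⟩ := hl
        exact congrFun h2 k
      · exact h1 l hl
    · rfl
    · rfl

/-- `tens f` as a homomorphism of algebras. -/
def tensHom (f : κ → ι) (hf : f.Injective) :
    Matrix (κ → n) (κ → n) D →ₐ[Rh] Matrix (ι → n) (ι → n) D :=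
  AlgHom.ofLinearMap
    { toFun := tens f
      map_add' := fun X Y => by
        ext I K
        simp only [tens, Matrix.of_apply, Matrix.add_apply]
        split_ifs <;> simp
      map_smul' := fun a X => by
        ext I K
        simp only [tens, Matrix.of_apply, Matrix.smul_apply, RingHom.id_apply]
        split_ifs <;> simp }
    tens_one (tens_mul hf)

theorem tensHom_apply (f : κ → ι) (hf : f.Injective) (X : Matrix (κ → n) (κ → n) D) :
    tensHom f hf X = tens f X := rfl

theorem tens_tens {f : κ → κ'} {g : κ' → ι} (hg : g.Injective)
    (X : Matrix (κ → n) (κ → n) D) : tens g (tens f X) = tens (g ∘ f) X := by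
  ext I K
  simp only [tens, Matrix.of_apply, ← ite_and]
  refine if_congr ⟨fun h l hl => ?_, fun h => ⟨fun l hl => h l ?_, fun l hl => h _ ?_⟩⟩ rfl rfl
  · by_cases hl' : l ∈ Set.range g
    · obtain ⟨k, rfl⟩ := hl'
      exact h.2 k fun ⟨m, hm⟩ => hl ⟨m, by simp [hm]⟩
    · exact h.1 l hl'
  · rintro ⟨m, rfl⟩
    exact hl ⟨f m, rfl⟩
  · rintro ⟨m, hm⟩
    exact hl ⟨m, hg hm⟩

-- On disjoint factors the intermediate index is forced, so no summation survives. Commuting tensor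
-- operators and commuting entries thus become the same thing; both directions are used later.
open Classical in
theorem tens_mul_tens_apply {f : κ → ι} {g : κ' → ι} (hf : f.Injective)
    (h : Disjoint (Set.range f) (Set.range g)) (X : Matrix (κ → n) (κ → n) D)
    (Y : Matrix (κ' → n) (κ' → n) D) (I K : ι → n) :
    (tens f X * tens g Y) I K = if ∀ l, l ∉ Set.range f → l ∉ Set.range g → I l = K l then
      X (I ∘ f) (K ∘ f) * Y (I ∘ g) (K ∘ g) else 0 := by
  have hd : ∀ l, l ∈ Set.range f → l ∉ Set.range g := fun l h1 h2 =>
    Set.disjoint_left.1 h h1 h2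
  rw [tens_mul_apply hf, Finset.sum_eq_single (K ∘ f)]
  · simp only [tens, Matrix.of_apply, mul_ite, mul_zero]
    have h1 : Function.extend f (K ∘ f) I ∘ g = I ∘ g := by
      funext k
      refine Function.extend_apply' _ _ _ fun ⟨m, hm⟩ => hd (g k) ⟨m, hm⟩ ⟨k, rfl⟩
    rw [h1]
    refine if_congr ⟨fun H l hl hl' => ?_, fun H l hl => ?_⟩ rfl rfl
    · rw [← H l hl', Function.extend_apply' _ _ _ fun ⟨k, hk⟩ => hl ⟨k, hk⟩]
    · by_cases hl' : l ∈ Set.range f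
      · obtain ⟨k, rfl⟩ := hl'
        simp [hf.extend_apply]
      · rw [Function.extend_apply' _ _ _ fun ⟨k, hk⟩ => hl' ⟨k, hk⟩]
        exact H l hl' hl
  · intro M _ hM
    rw [tens, Matrix.of_apply, if_neg, mul_zero]
    intro H
    refine hM (funext fun k => ?_)
    simpa [hf.extend_apply] using H (f k) (hd _ ⟨k, rfl⟩)
  · simp

theorem tens_commute {f : κ → ι} {g : κ' → ι} (hf : f.Injective) (hg : g.Injective)
    (h : Disjoint (Set.range f) (Set.range g)) {X : Matrix (κ → n) (κ → n) D}
    {Y : Matrix (κ' → n) (κ' → n) D} (hXY : ∀ a b c d, Commute (X a b) (Y c d)) :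
    Commute (tens f X) (tens g Y) := by
  ext I K
  rw [tens_mul_tens_apply hf h, tens_mul_tens_apply hg h.symm]
  refine if_congr ⟨fun H l h1 h2 => H l h2 h1, fun H l h1 h2 => H l h2 h1⟩ (hXY _ _ _ _) rfl

/-- The operator permuting the tensor factors. -/
def permMat (D : Type*) [Ring D] (σ : Equiv.Perm ι) : Matrix (ι → n) (ι → n) D :=
  Matrix.of fun I K => if K = I ∘ σ then 1 else 0

theorem permMat_mul_apply (σ : Equiv.Perm ι) (Y : Matrix (ι → n) (ι → n) D) (I K : ι → n) :
    (permMat D σ * Y : Matrix (ι → n) (ι → n) D) I K = Y (I ∘ σ) K := by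
  simp [permMat, Matrix.mul_apply]

theorem mul_permMat_apply (σ : Equiv.Perm ι) (Y : Matrix (ι → n) (ι → n) D) (I K : ι → n) :
    (Y * permMat D σ : Matrix (ι → n) (ι → n) D) I K = Y I (K ∘ σ.symm) := by
  have : ∀ L : ι → n, (K = L ∘ σ) ↔ (L = K ∘ σ.symm) := fun L =>
    ⟨fun h => by subst h; funext; simp, fun h => by subst h; funext; simp⟩
  simp [permMat, Matrix.mul_apply, this]

theorem permMat_mul (σ τ : Equiv.Perm ι) :
    (permMat D σ * permMat D τ : Matrix (ι → n) (ι → n) D) = permMat D (σ * τ) := by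
  ext I K
  rw [permMat_mul_apply]
  rfl

theorem permMat_one : (permMat D (1 : Equiv.Perm ι) : Matrix (ι → n) (ι → n) D) = 1 := by
  ext I K
  simp [permMat, Matrix.one_apply, eq_comm]

theorem permMat_mul_tens (σ : Equiv.Perm ι) (f : κ → ι) (X : Matrix (κ → n) (κ → n) D) :
    permMat D σ * tens f X = tens (σ ∘ f) X * permMat D σ := by
  ext I K
  rw [permMat_mul_apply, mul_permMat_apply]
  simp only [tens, Matrix.of_apply]
  refine if_congr ⟨fun H l hl => ?_, fun H l hl => ?_⟩ ?_ rfl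
  · have := H (σ.symm l) fun ⟨k, hk⟩ => hl ⟨k, by simp [hk]⟩
    simpa using this
  · have := H (σ l) fun ⟨k, hk⟩ => hl ⟨k, by simpa using hk⟩
    simpa using this
  · congr 1
    funext k
    simp

end Tens

/-! ### Copies of matrices on one or two tensor factors; the algebra of `P` and `Q = Pᵗ`. -/

section Sites

variable {N : ℕ} {ι κ : Type*} [Fintype ι] [DecidableEq ι] [Fintype κ] [DecidableEq κ]
  {D : Type*} [Ring D] [Algebra Rh D]

/-- The copy of a matrix on the tensor factor `i`. -/
def at₁ (i : ι) : Matrix (Fin N) (Fin N) D →ₐ[Rh] Matrix (ι → Fin N) (ι → Fin N) D :=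
  (tensHom (fun _ : Unit => i) (Function.injective_of_subsingleton _)).comp
    (Matrix.reindexAlgEquiv Rh D (Equiv.funUnique Unit (Fin N)).symm).toAlgHom

theorem pair_injective {i j : ι} (h : i ≠ j) : Function.Injective ![i, j] := by
  intro a b
  fin_cases a <;> fin_cases b <;> simp [h, h.symm]

/-- The copy of a matrix on the tensor factors `i` and `j`. -/
def at₂ (i j : ι) (h : i ≠ j) :
    Matrix (Idx2 N) (Idx2 N) D →ₐ[Rh] Matrix (ι → Fin N) (ι → Fin N) D :=
  (tensHom ![i, j] (pair_injective h)).comp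
    (Matrix.reindexAlgEquiv Rh D (finTwoArrowEquiv (Fin N)).symm).toAlgHom

theorem at₁_def (i : ι) (X : Matrix (Fin N) (Fin N) D) : at₁ i X =
    tens (fun _ : Unit => i) (X.submatrix (fun I => I ()) (fun I => I ())) := rfl

theorem at₂_def {i j : ι} (h : i ≠ j) (X : Matrix (Idx2 N) (Idx2 N) D) : at₂ i j h X =
    tens ![i, j] (X.submatrix (fun I => (I 0, I 1)) (fun I => (I 0, I 1))) := rfl

theorem at₁_apply (i : ι) (X : Matrix (Fin N) (Fin N) D) (I K : ι → Fin N) :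
    at₁ i X I K = if ∀ l, l ≠ i → I l = K l then X (I i) (K i) else 0 := by
  rw [at₁_def]
  simp only [tens, Matrix.of_apply]
  refine if_congr ?_ rfl rfl
  simp [eq_comm]

theorem at₂_apply {i j : ι} (h : i ≠ j) (X : Matrix (Idx2 N) (Idx2 N) D) (I K : ι → Fin N) :
    at₂ i j h X I K =
      if ∀ l, l ≠ i → l ≠ j → I l = K l then X (I i, I j) (K i, K j) else 0 := by
  rw [at₂_def]
  simp only [tens, Matrix.of_apply]
  refine if_congr ?_ rfl rfl
  simp only [Matrix.range_cons, Matrix.range_empty, Set.union_empty, Set.mem_union,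
    Set.mem_singleton_iff, not_or, and_imp, ne_eq]

theorem at₁_eq_embAt (i : Fin N) (X : Matrix (Fin N) (Fin N) D) : at₁ i X = embAt i X := by
  ext I K
  rw [at₁_apply, embAt, Matrix.of_apply]
  congr

theorem at₂_eq_embAt₂ {i j : Fin N} (h : i ≠ j) (X : Matrix (Idx2 N) (Idx2 N) D) :
    at₂ i j h X = embAt₂ i j X := by
  ext I K
  rw [at₂_apply, embAt₂, Matrix.of_apply]
  congr

theorem at₂_emb₁ {i j : ι} (h : i ≠ j) (X : Matrix (Fin N) (Fin N) D) :
    at₂ i j h (emb₁ X) = at₁ i X := by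
  ext I K
  rw [at₂_apply, at₁_apply, emb₁]
  simp only [Matrix.of_apply, ← ite_and]
  refine if_congr ⟨fun H l hl => ?_, fun H => ⟨fun l hl _ => H l hl, H j h.symm⟩⟩ rfl rfl
  by_cases hj : l = j
  · exact hj ▸ H.2
  · exact H.1 l hl hj

theorem at₂_emb₂ {i j : ι} (h : i ≠ j) (X : Matrix (Fin N) (Fin N) D) :
    at₂ i j h (emb₂ X) = at₁ j X := by
  ext I K
  rw [at₂_apply, at₁_apply, emb₂]
  simp only [Matrix.of_apply, ← ite_and]
  refine if_congr ⟨fun H l hl => ?_, fun H => ⟨fun l _ hl => H l hl, H i h⟩⟩ rfl rfl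
  by_cases hj : l = i
  · exact hj ▸ H.2
  · exact H.1 l hj hl

theorem tens_at₁ {g : ι → κ} (hg : g.Injective) (i : ι) (X : Matrix (Fin N) (Fin N) D) :
    tens g (at₁ i X) = at₁ (g i) X := by
  rw [at₁_def, tens_tens hg]
  rfl

theorem tens_at₂ {g : ι → κ} (hg : g.Injective) {i j : ι} (h : i ≠ j)
    (X : Matrix (Idx2 N) (Idx2 N) D) :
    tens g (at₂ i j h X) = at₂ (g i) (g j) (hg.ne h) X := by
  rw [at₂_def, tens_tens hg, at₂_def]
  congr 1
  funext k
  fin_cases k <;> rfl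

theorem permMat_mul_at₁ (σ : Equiv.Perm ι) (i : ι) (X : Matrix (Fin N) (Fin N) D) :
    permMat D σ * at₁ i X = at₁ (σ i) X * permMat D σ := permMat_mul_tens _ _ _

theorem permMat_mul_at₂ (σ : Equiv.Perm ι) {i j : ι} (h : i ≠ j)
    (X : Matrix (Idx2 N) (Idx2 N) D) :
    permMat D σ * at₂ i j h X = at₂ (σ i) (σ j) (σ.injective.ne h) X * permMat D σ := by
  rw [at₂_def, permMat_mul_tens, at₂_def]
  congr 2
  funext k
  fin_cases k <;> rfl

theorem at₁_commute_at₁ {i j : ι} (h : i ≠ j) {X Y : Matrix (Fin N) (Fin N) D}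
    (hXY : ∀ a b c d, Commute (X a b) (Y c d)) : Commute (at₁ i X) (at₁ j Y) := by
  rw [at₁_def, at₁_def]
  refine tens_commute (Function.injective_of_subsingleton _)
    (Function.injective_of_subsingleton _) ?_ fun a b c d => hXY _ _ _ _
  simp [h]

theorem at₂_commute_at₁ {i j k : ι} (h : i ≠ j) (hi : k ≠ i) (hj : k ≠ j)
    {X : Matrix (Idx2 N) (Idx2 N) D} {Y : Matrix (Fin N) (Fin N) D}
    (hXY : ∀ a b c d, Commute (X a b) (Y c d)) : Commute (at₂ i j h X) (at₁ k Y) := by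
  rw [at₂_def, at₁_def]
  refine tens_commute (pair_injective h) (Function.injective_of_subsingleton _) ?_
    fun a b c d => hXY _ _ _ _
  simp [hi, hj]

theorem at₂_commute_at₂ {i j k l : ι} (h : i ≠ j) (h' : k ≠ l) (h1 : k ≠ i) (h2 : k ≠ j)
    (h3 : l ≠ i) (h4 : l ≠ j) {X Y : Matrix (Idx2 N) (Idx2 N) D}
    (hXY : ∀ a b c d, Commute (X a b) (Y c d)) : Commute (at₂ i j h X) (at₂ k l h' Y) := by
  rw [at₂_def, at₂_def]
  refine tens_commute (pair_injective h) (pair_injective h') ?_ fun a b c d => hXY _ _ _ _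
  simp [h1.symm, h2.symm, h3.symm, h4.symm, Set.disjoint_left]

theorem at₂_perm {i j : ι} (h : i ≠ j) :
    at₂ i j h (perm D : Matrix (Idx2 N) (Idx2 N) D) = permMat D (Equiv.swap i j) := by
  ext I K
  rw [at₂_apply, perm, permMat]
  simp only [Matrix.of_apply, ← ite_and]
  refine if_congr ⟨fun H => funext fun l => ?_, ?_⟩ rfl rfl
  · by_cases hi : l = i
    · subst hi; simp [H.2.2]
    · by_cases hj : l = j
      · subst hj; simp [H.2.1]
      · simp [Equiv.swap_apply_of_ne_of_ne hi hj, H.1 l hi hj]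
  · rintro rfl
    refine ⟨fun l hi hj => by simp [Equiv.swap_apply_of_ne_of_ne hi hj], by simp, by simp⟩

/-- The operator `Q = Pᵗ`. -/
def qop (N : ℕ) (D : Type*) [Ring D] : Matrix (Idx2 N) (Idx2 N) D := transp₁ (perm D)

theorem qop_apply (a b : Idx2 N) :
    qop N D a b = if a.1 = a.2 ∧ b.1 = b.2 then 1 else 0 := by
  simp only [qop, transp₁, perm, Matrix.of_apply]
  refine if_congr ⟨fun h => ⟨h.2.symm, h.1⟩, fun h => ⟨h.2, h.1.symm⟩⟩ rfl rfl

theorem emb₁_mul_apply (X : Matrix (Fin N) (Fin N) D) (Y : Matrix (Idx2 N) (Idx2 N) D)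
    (a b : Idx2 N) : (emb₁ X * Y) a b = ∑ c, X a.1 c * Y (c, a.2) b := by
  simp [Matrix.mul_apply, emb₁, Fintype.sum_prod_type, ite_mul]

theorem emb₂_mul_apply (X : Matrix (Fin N) (Fin N) D) (Y : Matrix (Idx2 N) (Idx2 N) D)
    (a b : Idx2 N) : (emb₂ X * Y) a b = ∑ c, X a.2 c * Y (a.1, c) b := by
  simp [Matrix.mul_apply, emb₂, Fintype.sum_prod_type, ite_mul]

theorem mul_emb₁_apply (X : Matrix (Fin N) (Fin N) D) (Y : Matrix (Idx2 N) (Idx2 N) D)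
    (a b : Idx2 N) : (Y * emb₁ X) a b = ∑ c, Y a (c, b.2) * X c b.1 := by
  simp [Matrix.mul_apply, emb₁, Fintype.sum_prod_type]

theorem mul_emb₂_apply (X : Matrix (Fin N) (Fin N) D) (Y : Matrix (Idx2 N) (Idx2 N) D)
    (a b : Idx2 N) : (Y * emb₂ X) a b = ∑ c, Y a (b.1, c) * X c b.2 := by
  simp [Matrix.mul_apply, emb₂, Fintype.sum_prod_type]

theorem perm_mul_apply (Y : Matrix (Idx2 N) (Idx2 N) D) (a b : Idx2 N) :
    (perm D * Y : Matrix (Idx2 N) (Idx2 N) D) a b = Y (a.2, a.1) b := by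
  have : ∀ c : Idx2 N, (a.1 = c.2 ∧ a.2 = c.1) ↔ (c = (a.2, a.1)) := fun c => by
    rw [Prod.ext_iff]; constructor <;> rintro ⟨h1, h2⟩ <;> simp [h1, h2]
  simp [Matrix.mul_apply, perm, this]

theorem mul_perm_apply (Y : Matrix (Idx2 N) (Idx2 N) D) (a b : Idx2 N) :
    (Y * perm D : Matrix (Idx2 N) (Idx2 N) D) a b = Y a (b.2, b.1) := by
  have : ∀ c : Idx2 N, (c.1 = b.2 ∧ c.2 = b.1) ↔ (c = (b.2, b.1)) := fun c => by
    rw [Prod.ext_iff]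
  simp [Matrix.mul_apply, perm, this]

theorem emb₁_mul_emb₂_apply (X Y : Matrix (Fin N) (Fin N) D) (a b : Idx2 N) :
    (emb₁ X * emb₂ Y) a b = X a.1 b.1 * Y a.2 b.2 := by
  simp [emb₁_mul_apply, emb₂]

theorem emb₂_mul_emb₁_apply (X Y : Matrix (Fin N) (Fin N) D) (a b : Idx2 N) :
    (emb₂ X * emb₁ Y) a b = X a.2 b.2 * Y a.1 b.1 := by
  simp [emb₂_mul_apply, emb₁]

theorem perm_mul_emb₁ (X : Matrix (Fin N) (Fin N) D) : perm D * emb₁ X = emb₂ X * perm D := by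
  ext a b
  rw [perm_mul_apply, mul_perm_apply]
  simp [emb₁, emb₂]

theorem perm_mul_perm : (perm D * perm D : Matrix (Idx2 N) (Idx2 N) D) = 1 := by
  ext a b
  rw [perm_mul_apply, perm, Matrix.one_apply, Matrix.of_apply]
  exact if_congr (by rw [Prod.ext_iff]; exact and_comm) rfl rfl

theorem qop_mul_perm : qop N D * perm D = qop N D := by
  ext a b
  rw [mul_perm_apply, qop_apply, qop_apply]
  exact if_congr (by simp [eq_comm]) rfl rfl

theorem perm_mul_qop : perm D * qop N D = qop N D := by
  ext a b
  rw [perm_mul_apply, qop_apply, qop_apply]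
  exact if_congr (by simp [eq_comm]) rfl rfl

/-- `Q = ξ ξᵗ` for `ξ = ∑ e_a ⊗ e_a`, and `(X ⊗ 1) ξ = (1 ⊗ Xᵗ) ξ`. Noncommuting entries of `X` do
no harm, since those of `Q` are `0` and `1`. -/
theorem emb₁_mul_qop (X : Matrix (Fin N) (Fin N) D) :
    emb₁ X * qop N D = emb₂ X.transpose * qop N D := by
  ext a b
  simp [emb₁_mul_apply, emb₂_mul_apply, qop_apply, ite_and]

theorem qop_mul_emb₁ (X : Matrix (Fin N) (Fin N) D) :
    qop N D * emb₁ X = qop N D * emb₂ X.transpose := by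
  ext a b
  simp [mul_emb₁_apply, mul_emb₂_apply, qop_apply, ite_and]

theorem at₂_qop_symm {i j : ι} (h : i ≠ j) :
    at₂ i j h (qop N D) = at₂ j i h.symm (qop N D) := by
  ext I K
  rw [at₂_apply, at₂_apply, qop_apply, qop_apply]
  refine if_congr ⟨fun H l h1 h2 => H l h2 h1, fun H l h1 h2 => H l h2 h1⟩
    (if_congr (by simp [eq_comm]) rfl rfl) rfl

theorem qop_eq_sum : qop N D = ∑ a, ∑ b, emb₁ (single a b (1 : D)) * emb₂ (single a b 1) := by
  ext x y
  simp only [Matrix.sum_apply, emb₁_mul_emb₂_apply, qop_apply, single_apply]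
  simp only [ite_and, mul_ite, mul_one, mul_zero]
  rw [Finset.sum_eq_single x.2, Finset.sum_eq_single y.2]
  · simp [eq_comm]
  all_goals simp +contextual

theorem perm_eq_sum : (perm D : Matrix (Idx2 N) (Idx2 N) D) =
    ∑ a, ∑ b, emb₁ (single b a (1 : D)) * emb₂ (single a b 1) := by
  ext x y
  simp only [Matrix.sum_apply, emb₁_mul_emb₂_apply, perm, Matrix.of_apply, single_apply]
  simp only [ite_and, mul_ite, mul_one, mul_zero]
  rw [Finset.sum_eq_single x.2, Finset.sum_eq_single y.2]
  · simp [eq_comm]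
  all_goals simp +contextual

theorem at₂_qop_mul_at₁ {k i : ι} (h : k ≠ i) (X : Matrix (Fin N) (Fin N) D) :
    at₂ k i h (qop N D) * at₁ k X = at₂ k i h (qop N D) * at₁ i X.transpose := by
  rw [← at₂_emb₁ h, ← at₂_emb₂ h, ← map_mul, ← map_mul, qop_mul_emb₁]

/-- Expand the second `Q` in matrix units and carry its units on the factor `k` through `Q_{ki}` to
the factor `i`; they arrive transposed, which turns `∑ e_{ab} ⊗ e_{ab}` into `∑ e_{ba} ⊗ e_{ab} =
P_{ij}`. -/
theorem at₂_qop_mul_at₂_qop {k i j : ι} (hi : k ≠ i) (hj : k ≠ j) (hij : i ≠ j) :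
    at₂ k i hi (qop N D) * at₂ k j hj (qop N D) =
      at₂ k i hi (qop N D) * at₂ i j hij (perm D) := by
  conv_lhs => rw [qop_eq_sum (D := D) (N := N)]
  rw [← qop_eq_sum, perm_eq_sum]
  conv_lhs => enter [2]; rw [qop_eq_sum]
  simp only [map_sum, map_mul, at₂_emb₁, at₂_emb₂, Finset.mul_sum, ← mul_assoc,
    at₂_qop_mul_at₁, transpose_single]

end Sites

end TwistedYangian

namespace TwistedYangian

open Matrix

/-! ### The anti-symmetrizer -/

section Antisym

variable {N : ℕ} {D : Type*} [Ring D] [Algebra Rh D]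

/-- Through this form the sign rules become row and column permutations of a determinant, and the
dependence of `N + 1` vectors becomes the adjugate identity. -/
theorem antisym_eq_det (I K : IdxN N) : antisym N I K = ((Nat.factorial N : ℕ) : ℂ)⁻¹ *
    det (of fun b a => if I a = K b then (1 : ℂ) else 0) := by
  rw [antisym, of_apply, det_apply]
  congr 1
  refine Finset.sum_congr rfl fun σ _ => ?_
  simp only [of_apply, Finset.prod_ite_zero, Finset.prod_const_one]
  have : (I = K ∘ σ) ↔ ∀ i ∈ Finset.univ, I i = K (σ i) := by
    rw [funext_iff]; simp
  rw [if_congr this rfl rfl]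
  split_ifs
  · rw [Units.smul_def, zsmul_eq_mul, mul_one]
  · rw [smul_zero]

theorem antisym_comp_right (I K : IdxN N) (σ : Equiv.Perm (Fin N)) :
    antisym N I (K ∘ σ) = (Equiv.Perm.sign σ : ℤ) * antisym N I K := by
  have := det_permute σ (of fun b a => if I a = K b then (1 : ℂ) else 0)
  rw [antisym_eq_det, antisym_eq_det, mul_left_comm, ← this]
  rfl

theorem antisym_comp_left (I K : IdxN N) (σ : Equiv.Perm (Fin N)) :
    antisym N (I ∘ σ) K = (Equiv.Perm.sign σ : ℤ) * antisym N I K := by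
  have := det_permute' σ (of fun b a => if I a = K b then (1 : ℂ) else 0)
  rw [antisym_eq_det, antisym_eq_det, mul_left_comm, ← this]
  rfl

/-- Every `N + 1` vectors of `ℂᴺ` are linearly dependent, expressed by anti-symmetrizers. -/
theorem sum_antisym_update (I K : IdxN N) (a b : Fin N) :
    ∑ i, (if a = K i then antisym N I (Function.update K i b) else 0) =
      if a = b then antisym N I K else 0 := by
  set Y : Matrix (Fin N) (Fin N) ℂ := of fun i c => if K i = c then 1 else 0 with hY
  set X : Matrix (Fin N) (Fin N) ℂ := of fun c i => if I i = c then 1 else 0 with hX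
  have hdet : ∀ K' : IdxN N, (of fun i a => if I a = K' i then (1 : ℂ) else 0) =
      (of fun i c => if K' i = c then 1 else 0) * X := by
    intro K'
    ext i j
    simp [Matrix.mul_apply, hX, eq_comm]
  have hup : ∀ i, (of fun j c => if Function.update K i b j = c then (1 : ℂ) else 0) =
      Y.updateRow i (Pi.single b 1) := by
    intro i
    ext j c
    by_cases h : j = i
    · subst h
      simp [Pi.single_apply, eq_comm]
    · simp [h, hY, updateRow_ne]
  -- Cramer's rule: the entries of the adjugate are the determinants of `Y` with the row `i`
  -- replaced by `e_b`, which is how the update of `K` at `i` enters.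
  have key := congrFun (congrFun (adjugate_mul Y) b) a
  rw [Matrix.mul_apply] at key
  simp only [adjugate_apply] at key
  simp only [antisym_eq_det, hdet, hup, det_mul]
  have h1 : ∀ i, (if a = K i then ((Nat.factorial N : ℕ) : ℂ)⁻¹ *
      ((Y.updateRow i (Pi.single b 1)).det * X.det) else 0) =
      ((Nat.factorial N : ℕ) : ℂ)⁻¹ * X.det * ((Y.updateRow i (Pi.single b 1)).det * Y i a) := by
    intro i
    simp only [hY, of_apply, eq_comm (a := a)]
    split_ifs <;> ring
  rw [Finset.sum_congr rfl fun i _ => h1 i, ← Finset.mul_sum, key]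
  rw [Matrix.smul_apply, Matrix.one_apply, smul_eq_mul]
  simp only [eq_comm (a := a)]
  rw [← hY]
  split_ifs <;> ring

/-- The anti-symmetrizer over a `ℂ[[h]]`-algebra. -/
def asym (N : ℕ) (D : Type*) [Ring D] [Algebra Rh D] : Matrix (IdxN N) (IdxN N) D :=
  of fun I K => algebraMap Rh D (PowerSeries.C (antisym N I K))

theorem asym_mul_permMat (σ : Equiv.Perm (Fin N)) :
    asym N D * permMat D σ = (Equiv.Perm.sign σ : ℤ) • asym N D := by
  ext I K
  rw [mul_permMat_apply, Matrix.smul_apply, asym, of_apply, of_apply]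
  have := antisym_comp_right I K σ.symm
  rw [this, Equiv.Perm.sign_symm, map_mul, map_mul, map_intCast, map_intCast, zsmul_eq_mul]

theorem permMat_mul_asym (σ : Equiv.Perm (Fin N)) :
    permMat D σ * asym N D = (Equiv.Perm.sign σ : ℤ) • asym N D := by
  ext I K
  rw [permMat_mul_apply, Matrix.smul_apply, asym, of_apply, of_apply]
  rw [antisym_comp_left, map_mul, map_mul, map_intCast, map_intCast, zsmul_eq_mul]

theorem asym_eq_sum : asym N D = (PowerSeries.C (((Nat.factorial N : ℕ) : ℂ)⁻¹) : Rh) •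
    ∑ σ : Equiv.Perm (Fin N), (Equiv.Perm.sign σ : ℤ) • permMat D σ⁻¹ := by
  ext I K
  rw [asym, of_apply, antisym, of_apply, map_mul, map_mul, Matrix.smul_apply, Matrix.sum_apply,
    Algebra.smul_def]
  congr 1
  rw [map_sum, map_sum]
  refine Finset.sum_congr rfl fun σ _ => ?_
  have : (I = K ∘ σ) ↔ (K = I ∘ (σ⁻¹ : Equiv.Perm (Fin N))) :=
    ⟨fun h => by subst h; funext; simp, fun h => by subst h; funext; simp⟩
  rw [Matrix.smul_apply, permMat, of_apply, if_congr this rfl rfl]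
  split_ifs <;> simp

theorem inv_factorial_smul_card {M : Type*} [AddCommGroup M] [Module Rh M] (x : M) :
    (PowerSeries.C (((Nat.factorial N : ℕ) : ℂ)⁻¹) : Rh) •
      ∑ _σ : Equiv.Perm (Fin N), x = x := by
  have hN : ((Nat.factorial N : ℕ) : ℂ) ≠ 0 := by exact_mod_cast Nat.factorial_ne_zero N
  have : ((Nat.factorial N : ℕ) : Rh) = PowerSeries.C ((Nat.factorial N : ℕ) : ℂ) := by simp
  rw [Finset.sum_const, Finset.card_univ, Fintype.card_perm, Fintype.card_fin,
    ← Nat.cast_smul_eq_nsmul Rh, smul_smul, this, ← map_mul, inv_mul_cancel₀ hN, map_one, one_smul]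

theorem int_sign_smul_smul {M : Type*} [AddCommGroup M] (σ : Equiv.Perm (Fin N)) (x : M) :
    (Equiv.Perm.sign σ : ℤ) • (Equiv.Perm.sign σ : ℤ) • x = x := by
  rw [smul_smul, ← Units.val_mul, Int.units_mul_self, Units.val_one, one_smul]

theorem mul_asym_of_sign {X : Matrix (IdxN N) (IdxN N) D}
    (h : ∀ σ : Equiv.Perm (Fin N), X * permMat D σ = (Equiv.Perm.sign σ : ℤ) • X) :
    X * asym N D = X := by
  rw [asym_eq_sum, mul_smul_comm, Finset.mul_sum]
  have : ∀ σ : Equiv.Perm (Fin N), X * ((Equiv.Perm.sign σ : ℤ) • permMat D σ⁻¹) = X := by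
    intro σ
    rw [mul_smul_comm, h, Equiv.Perm.sign_inv, int_sign_smul_smul]
  rw [Finset.sum_congr rfl fun σ _ => this σ, inv_factorial_smul_card]

/-- The anti-symmetrizer on the last `N` of `N + 1` tensor factors. -/
def asym' (N : ℕ) (D : Type*) [Ring D] [Algebra Rh D] :
    Matrix (Option (Fin N) → Fin N) (Option (Fin N) → Fin N) D := tens some (asym N D)

theorem asym'_mul_at₂_perm {i j : Fin N} (h : i ≠ j) :
    asym' N D * at₂ (some i) (some j) (by simpa using h) (perm D) = -asym' N D := by
  have h1 := tens_at₂ (Option.some_injective (Fin N)) h (perm D : Matrix (Idx2 N) (Idx2 N) D)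
  rw [asym', ← h1, ← tens_mul (Option.some_injective _), at₂_perm, asym_mul_permMat,
    Equiv.Perm.sign_swap h, ← tensHom_apply _ (Option.some_injective _), map_zsmul,
    tensHom_apply]
  simp

theorem at₂_perm_mul_asym' {i j : Fin N} (h : i ≠ j) :
    at₂ (some i) (some j) (by simpa using h) (perm D) * asym' N D = -asym' N D := by
  have h1 := tens_at₂ (Option.some_injective (Fin N)) h (perm D : Matrix (Idx2 N) (Idx2 N) D)
  rw [asym', ← h1, ← tens_mul (Option.some_injective _), at₂_perm, permMat_mul_asym,
    Equiv.Perm.sign_swap h, ← tensHom_apply _ (Option.some_injective _), map_zsmul,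
    tensHom_apply]
  simp

theorem tens_some_apply {X : Matrix (IdxN N) (IdxN N) D} (I K : Option (Fin N) → Fin N) :
    tens some X I K = if I none = K none then X (I ∘ some) (K ∘ some) else 0 := by
  simp only [tens, of_apply]
  refine if_congr ⟨fun H => H none (by simp), fun H l hl => ?_⟩ rfl rfl
  cases l with
  | none => exact H
  | some i => exact absurd ⟨i, rfl⟩ hl

/-- The antisymmetrizer on all `N + 1` factors is a multiple of `A^{(N)} (1 - ∑ P_{0i})` and
vanishes on tensors of `ℂᴺ`. In entries, `P_{0i}` exchanges the index of the extra factor with the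
`i`-th one, and the sum is that of `sum_antisym_update`. -/
theorem asym'_mul_sum_perm :
    asym' N D * ∑ i : Fin N, at₂ none (some i) (by simp) (perm D) = asym' N D := by
  ext I K
  rw [Finset.mul_sum, Matrix.sum_apply]
  simp only [at₂_perm, mul_permMat_apply, asym', tens_some_apply, Equiv.symm_swap]
  have h2 : ∀ i : Fin N, (K ∘ ⇑(Equiv.swap none (some i))) ∘ some =
      Function.update (K ∘ some) i (K none) := by
    intro i
    funext j
    by_cases hj : j = i
    · subst hj; simp
    · rw [Function.update_of_ne hj, Function.comp_apply, Function.comp_apply,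
        Equiv.swap_apply_of_ne_of_ne (by simp) (by simpa using hj)]
      rfl
  have := congrArg (fun z => algebraMap Rh D (PowerSeries.C z))
    (sum_antisym_update (I ∘ some) (K ∘ some) (I none) (K none))
  simp only [map_sum, apply_ite (fun z => algebraMap Rh D (PowerSeries.C z)), map_zero] at this
  simp only [h2, asym, of_apply, Function.comp_apply, Equiv.swap_apply_left]
  exact this

theorem tens_some_permMat (σ : Equiv.Perm (Fin N)) :
    tens some (permMat D σ) = permMat D (Equiv.optionCongr σ) (n := Fin N) := by
  ext I K
  rw [tens_some_apply]
  simp only [permMat, of_apply, ← ite_and]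
  refine if_congr ⟨fun h => ?_, fun h => ?_⟩ rfl rfl
  · funext l
    cases l with
    | none => exact h.1.symm
    | some i => exact congrFun h.2 i
  · subst h
    exact ⟨rfl, rfl⟩

theorem permMat_mul_sum_perm (σ : Equiv.Perm (Fin N)) :
    permMat D (Equiv.optionCongr σ) *
        ∑ i : Fin N, at₂ none (some i) (by simp) (perm D : Matrix (Idx2 N) (Idx2 N) D) =
      (∑ i : Fin N, at₂ none (some i) (by simp) (perm D)) * permMat D (Equiv.optionCongr σ) := by
  rw [Finset.mul_sum, Finset.sum_mul]
  conv_rhs => rw [← Equiv.sum_comp σ]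
  refine Finset.sum_congr rfl fun i _ => ?_
  rw [permMat_mul_at₂]
  rfl

theorem asym'_eq_sum : asym' N D = (PowerSeries.C (((Nat.factorial N : ℕ) : ℂ)⁻¹) : Rh) •
    ∑ σ : Equiv.Perm (Fin N), (Equiv.Perm.sign σ : ℤ) • permMat D (Equiv.optionCongr σ⁻¹) := by
  rw [asym', asym_eq_sum, ← tensHom_apply _ (Option.some_injective _), map_smul, map_sum]
  simp only [map_zsmul, tensHom_apply, tens_some_permMat]

/-- The sum of the `P_{0i}` is invariant under permutations of the last `N` factors, hence commutes
with the antisymmetrizer. -/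
theorem sum_perm_mul_asym' :
    (∑ i : Fin N, at₂ none (some i) (by simp) (perm D)) * asym' N D = asym' N D := by
  conv_rhs => rw [← asym'_mul_sum_perm]
  rw [asym'_eq_sum, mul_smul_comm, smul_mul_assoc, Finset.mul_sum, Finset.sum_mul]
  congr 1
  refine Finset.sum_congr rfl fun σ _ => ?_
  rw [mul_smul_comm, smul_mul_assoc, permMat_mul_sum_perm]

end Antisym

end TwistedYangian

namespace TwistedYangian

/-! ### Fusion and reordering in an abstract ring -/

section Abstract

variable {ι k B : Type*} [CommRing k] [Ring B] [Algebra k B]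

/-- The fusion computation. By `hp`, products of several `p`'s next to `E` reduce to single ones up
to sign. The chain condition says `1/a_j = 1/a_i + 1`, as for `a_i = h/(x + ih)`; it is what
combines the coefficients `a_j + a_i a_j` into `a_i`. -/
theorem mul_prod_one_sub_smul {E : B} {p : ι → B} {a : ι → k}
    (hp : ∀ i j, i ≠ j → E * p i * p j = -(E * p i)) :
    ∀ (i : ι) (l : List ι), (i :: l).Nodup →
      (i :: l).IsChain (fun i j => a j * (1 + a i) = a i) →
      E * ((i :: l).reverse.map fun i => 1 - a i • p i).prod =
        E - a i • (E * ((i :: l).map p).sum)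
  | i, [], _, _ => by simp [mul_sub]
  | i, j :: l, hn, hc => by
    have hc' := List.isChain_cons_cons.1 hc
    have ih := mul_prod_one_sub_smul hp j l (List.nodup_cons.1 hn).2 hc'.2
    have hs : E * ((j :: l).map p).sum * p i = -(E * ((j :: l).map p).sum) := by
      have : ∀ l' : List ι, i ∉ l' → E * (l'.map p).sum * p i = -(E * (l'.map p).sum) := by
        intro l'
        induction l' with
        | nil => simp
        | cons b l' ih =>
          intro hb
          rw [List.mem_cons, not_or] at hb
          rw [List.map_cons, List.sum_cons, mul_add, add_mul, ih hb.2, hp b i (Ne.symm hb.1),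
            neg_add]
      exact this _ (List.nodup_cons.1 hn).1
    rw [List.reverse_cons, List.map_append, List.prod_append, ← mul_assoc, ih,
      show ([i].map fun i => 1 - a i • p i).prod = 1 - a i • p i by simp,
      show ((i :: j :: l).map p).sum = p i + ((j :: l).map p).sum from rfl]
    have h1 : a i • (E * ((j :: l).map p).sum) = a j • (E * ((j :: l).map p).sum) +
        (a i * a j) • (E * ((j :: l).map p).sum) := by
      rw [← add_smul]; congr 1; linear_combination -hc'.1
    rw [mul_add, smul_add, h1, mul_sub, mul_one, mul_smul_comm, sub_mul, smul_mul_assoc, hs,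
      smul_sub, smul_smul, smul_neg, mul_smul]
    rw [smul_smul]
    abel

/-- The mirror image, with `E` on the right and the product in the order of the list; it serves the
transposed block, where the arguments run the other way. -/
theorem prod_one_sub_smul_mul {E : B} {p : ι → B} {a : ι → k}
    (hp : ∀ i j, i ≠ j → p i * p j * E = -(p j * E)) :
    ∀ (i : ι) (l : List ι), (i :: l).Nodup →
      (i :: l).IsChain (fun i j => a j * (1 + a i) = a i) →
      ((i :: l).map fun i => 1 - a i • p i).prod * E =
        E - a i • (((i :: l).map p).sum * E)
  | i, [], _, _ => by simp [sub_mul]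
  | i, j :: l, hn, hc => by
    have hc' := List.isChain_cons_cons.1 hc
    have ih := prod_one_sub_smul_mul hp j l (List.nodup_cons.1 hn).2 hc'.2
    have hs : p i * (((j :: l).map p).sum * E) = -(((j :: l).map p).sum * E) := by
      have : ∀ l' : List ι, i ∉ l' → p i * ((l'.map p).sum * E) = -((l'.map p).sum * E) := by
        intro l'
        induction l' with
        | nil => simp
        | cons b l' ih =>
          intro hb
          rw [List.mem_cons, not_or] at hb
          rw [List.map_cons, List.sum_cons, add_mul, mul_add, ih hb.2, ← mul_assoc,
            hp i b hb.1, neg_add]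
      exact this _ (List.nodup_cons.1 hn).1
    rw [List.map_cons, List.prod_cons, mul_assoc, ih,
      show ((i :: j :: l).map p).sum = p i + ((j :: l).map p).sum from rfl]
    have h1 : a i • (((j :: l).map p).sum * E) = a j • (((j :: l).map p).sum * E) +
        (a i * a j) • (((j :: l).map p).sum * E) := by
      rw [← add_smul]; congr 1; linear_combination -hc'.1
    rw [add_mul, smul_add, h1, sub_mul, one_mul, smul_mul_assoc, mul_sub, mul_smul_comm, hs,
      smul_sub, smul_smul, smul_neg, mul_smul]
    rw [smul_smul]
    abel

theorem prod_map_smul (γ : ι → k) (x : ι → B) (l : List ι) :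
    (l.map fun i => γ i • x i).prod = (l.map γ).prod • (l.map x).prod := by
  induction l with
  | nil => simp
  | cons i l ih => simp [ih, smul_smul, mul_comm]

theorem commute_list_prod {x : B} {f : ι → B} {l : List ι} (h : ∀ b ∈ l, Commute x (f b)) :
    Commute x (l.map f).prod := by
  refine Commute.list_prod_right _ _ fun y hy => ?_
  obtain ⟨b, hb, rfl⟩ := List.mem_map.1 hy
  exact h b hb

/-- The train argument: the element `t` passes the factors `T` one at a time, and each `R` meets
only the `T` with its own index, commuting with all the others. -/
theorem prod_reverse_mul_prod {T R R' : ι → B} {t : B}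
    (h : ∀ i, R i * t * T i = T i * t * R' i)
    (hc : ∀ i j, i ≠ j → Commute (R i) (T j)) (hc' : ∀ i j, i ≠ j → Commute (R' i) (T j)) :
    ∀ l : List ι, l.Nodup →
      (l.reverse.map R).prod * t * (l.map T).prod = (l.map T).prod * t * (l.reverse.map R').prod
  | [], _ => by simp
  | i :: l, hn => by
    have hn' := List.nodup_cons.1 hn
    have ih := prod_reverse_mul_prod h hc hc' l hn'.2
    have h1 : Commute (R' i) (l.map T).prod :=
      commute_list_prod fun b hb => hc' i b fun e => hn'.1 (e ▸ hb)
    have h2 : Commute (T i) (l.reverse.map R).prod :=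
      commute_list_prod fun b hb => (hc b i fun e => hn'.1 (e ▸ (List.mem_reverse.1 hb))).symm
    simp only [List.reverse_cons, List.map_append, List.prod_append, List.map_cons, List.prod_cons,
      List.map_nil, List.prod_nil, mul_one]
    calc _ = (l.reverse.map R).prod * (R i * t * T i) * (l.map T).prod := by
            simp only [mul_assoc]
      _ = ((l.reverse.map R).prod * T i) * t * (R' i * (l.map T).prod) := by
            rw [h]; simp only [mul_assoc]
      _ = T i * ((l.reverse.map R).prod * t * (l.map T).prod) * R' i := by
            rw [← h2.eq, h1.eq]; simp only [mul_assoc]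
      _ = _ := by rw [ih]; simp only [mul_assoc]

/-- `X` maps the symmetric part of `P` to the symmetric part, from the right. -/
def Anti (P X : B) : Prop := (1 - P) * X * (1 + P) = 0

theorem Anti.of_commute {P X : B} (hP : P * P = 1) (h : Commute P X) : Anti P X := by
  have h1 : Commute (1 - P) X := (Commute.one_left X).sub_left h
  rw [Anti, h1.eq, mul_assoc, mul_add, sub_mul, sub_mul, hP]
  simp

/-- From `(1 - P) X P = -(1 - P) X` one gets `(1 - P) X (1 - P) = 2 (1 - P) X`, so a factor `1 - P`
can be inserted between `X` and `Y` at the cost of a `2`. -/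
theorem Anti.mul {P X Y : B} (h2 : ∀ x : B, x + x = 0 → x = 0) (hX : Anti P X) (hY : Anti P Y) :
    Anti P (X * Y) := by
  refine h2 _ ?_
  have h1 : (1 - P) * X * (1 - P) = (1 - P) * X + (1 - P) * X := by
    have : (1 - P) * X * P = -((1 - P) * X) := by
      rw [Anti, mul_add, mul_one] at hX
      exact (neg_eq_of_add_eq_zero_right hX).symm
    rw [mul_sub, mul_one, this]; abel
  calc _ = ((1 - P) * X + (1 - P) * X) * Y * (1 + P) := by simp only [add_mul, mul_assoc]
    _ = (1 - P) * X * ((1 - P) * Y * (1 + P)) := by rw [← h1]; simp only [mul_assoc]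
    _ = 0 := by rw [hY, mul_zero]

theorem Anti.list_prod {P : B} (h2 : ∀ x : B, x + x = 0 → x = 0) (hP : P * P = 1) (f : ι → B) :
    ∀ l : List ι, (∀ b ∈ l, Anti P (f b)) → Anti P (l.map f).prod
  | [], _ => Anti.of_commute hP (Commute.one_right P)
  | b :: l, h => by
    rw [List.map_cons, List.prod_cons]
    exact (h b (by simp)).mul h2 (Anti.list_prod h2 hP f l fun c hc => h c (by simp [hc]))

/-- The hypothesis on `E` gives `2E = E (1 - P)`, which supplies the left factor in `Anti`. -/
theorem Anti.mul_eq_neg {P X E : B} (h2 : ∀ x : B, x + x = 0 → x = 0) (hE : E * P = -E)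
    (hX : Anti P X) : E * X * P = -(E * X) := by
  rw [← add_eq_zero_iff_eq_neg]
  refine h2 _ ?_
  have h1 : E * (1 - P) = E + E := by rw [mul_sub, mul_one, hE]; abel
  calc _ = E * (1 - P) * X * (1 + P) := by rw [h1]; noncomm_ring
    _ = E * ((1 - P) * X * (1 + P)) := by simp only [mul_assoc]
    _ = 0 := by rw [hX, mul_zero]

/-- The ordered product `∏ₐ (X_a ∏_{b > a} R_{ab})`. -/
def ordProd (X : ι → B) (R : ι → ι → B) : List ι → B
  | [] => 1
  | a :: l => X a * (l.map (R a)).prod * ordProd X R l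

/-- The commutation allows the two products to be interleaved into `∏ (f b · g b)`. -/
theorem Anti.prod_mul_prod {P : B} (h2 : ∀ x : B, x + x = 0 → x = 0) (hP : P * P = 1)
    {f g : ι → B} (hc : ∀ a b, a ≠ b → Commute (f a) (g b)) :
    ∀ l : List ι, l.Nodup → (∀ b ∈ l, Anti P (f b * g b)) →
      Anti P ((l.map f).prod * (l.map g).prod)
  | [], _, _ => Anti.of_commute hP (by simp)
  | b :: l, hn, h => by
    have hn' := List.nodup_cons.1 hn
    have h1 : Commute (g b) (l.map f).prod :=
      commute_list_prod fun a ha => (hc a b fun e => hn'.1 (e ▸ ha)).symm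
    have : ((b :: l).map f).prod * ((b :: l).map g).prod =
        (f b * g b) * ((l.map f).prod * (l.map g).prod) := by
      simp only [List.map_cons, List.prod_cons]
      calc _ = f b * ((l.map f).prod * g b) * (l.map g).prod := by simp only [mul_assoc]
        _ = _ := by rw [← h1.eq]; simp only [mul_assoc]
    rw [this]
    exact (h b (by simp)).mul h2
      (Anti.prod_mul_prod h2 hP hc l hn'.2 fun c hc => h c (by simp [hc]))

/-- For adjacent `i`, `j` the product can be rearranged into pieces `R_{ai} R_{aj}` for `a` before
them, `X_i R_{ij} X_j`, and `R_{ia} R_{ja}` for `a` after them, the remaining factors commuting with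
`P`. Only `X_j` has to move past `R_{ia}`, and `R_{ia}` past `R_{jb}`. -/
theorem Anti.ordProd {P : B} (h2 : ∀ x : B, x + x = 0 → x = 0) (hP : P * P = 1) {X : ι → B}
    {R : ι → ι → B} {i j : ι} (hX : ∀ a, a ≠ i → a ≠ j → Commute P (X a))
    (hR : ∀ a b, a ≠ b → a ≠ i → a ≠ j → b ≠ i → b ≠ j → Commute P (R a b))
    (hij : Anti P (X i * R i j * X j))
    (hl : ∀ a, a ≠ i → a ≠ j → Anti P (R a i * R a j))
    (hr : ∀ a, a ≠ i → a ≠ j → Anti P (R i a * R j a))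
    (hXR : ∀ a, a ≠ i → a ≠ j → Commute (X j) (R i a))
    (hRR : ∀ a b, a ≠ b → a ≠ i → a ≠ j → b ≠ i → b ≠ j → Commute (R i a) (R j b))
    (l₂ : List ι) : ∀ l₁ : List ι, (l₁ ++ i :: j :: l₂).Nodup →
      Anti P (ordProd X R (l₁ ++ i :: j :: l₂)) := by
  classical
  have hlast : ∀ l : List ι, i ∉ l → j ∉ l → l.Nodup → Anti P (TwistedYangian.ordProd X R l) := by
    intro l
    induction l with
    | nil => exact fun _ _ _ => Anti.of_commute hP (Commute.one_right P)
    | cons a l ih =>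
      intro h1 h2' hn
      have hn' := List.nodup_cons.1 hn
      rw [List.mem_cons, not_or] at h1 h2'
      refine (Anti.mul h2 (Anti.of_commute hP (hX a (Ne.symm h1.1) (Ne.symm h2'.1))) ?_).mul h2
        (ih h1.2 h2'.2 hn'.2)
      refine Anti.list_prod h2 hP _ _ fun b hb => Anti.of_commute hP (hR a b ?_ (Ne.symm h1.1)
        (Ne.symm h2'.1) ?_ ?_)
      · exact fun e => hn'.1 (e ▸ hb)
      · exact fun e => h1.2 (e ▸ hb)
      · exact fun e => h2'.2 (e ▸ hb)
  intro l₁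
  induction l₁ with
  | nil =>
    intro hn
    rw [List.nil_append] at hn ⊢
    have hn1 := List.nodup_cons.1 hn
    have hn2 := List.nodup_cons.1 hn1.2
    have hi : ∀ b ∈ l₂, b ≠ i := fun b hb e => hn1.1 (by simp [← e, hb])
    have hj : ∀ b ∈ l₂, b ≠ j := fun b hb e => hn2.1 (by simp [← e, hb])
    have hc : Commute (X j) (l₂.map (R i)).prod :=
      commute_list_prod fun b hb => hXR b (hi b hb) (hj b hb)
    have : TwistedYangian.ordProd X R (i :: j :: l₂) = (X i * R i j * X j) *
        ((l₂.map (R i)).prod * (l₂.map (R j)).prod) * TwistedYangian.ordProd X R l₂ := by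
      simp only [TwistedYangian.ordProd, List.map_cons, List.prod_cons]
      calc _ = X i * R i j * ((l₂.map (R i)).prod * X j) * (l₂.map (R j)).prod *
            TwistedYangian.ordProd X R l₂ := by simp only [mul_assoc]
        _ = _ := by rw [← hc.eq]; simp only [mul_assoc]
    rw [this]
    refine (hij.mul h2 ?_).mul h2 (hlast l₂ (fun h => hi _ h rfl) (fun h => hj _ h rfl) hn2.2)
    -- The commutation is known only for indices other than `i` and `j`; replacing the factors there
    -- by `1` makes it hold for all distinct indices and changes nothing on `l₂`.
    have key := Anti.prod_mul_prod h2 hP (f := fun b => if b = i ∨ b = j then 1 else R i b)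
      (g := fun b => if b = i ∨ b = j then 1 else R j b) (fun a b hab => by
        by_cases ha : a = i ∨ a = j
        · simp [ha]
        · by_cases hb : b = i ∨ b = j
          · simp [hb]
          · rw [not_or] at ha hb
            simpa [ha, hb] using hRR a b hab ha.1 ha.2 hb.1 hb.2) l₂ hn2.2 (fun b hb => by
              simpa [hi b hb, hj b hb] using hr b (hi b hb) (hj b hb))
    have e1 : ∀ f : ι → B, l₂.map (fun b => if b = i ∨ b = j then 1 else f b) = l₂.map f :=
      fun f => List.map_congr_left fun b hb => by simp [hi b hb, hj b hb]
    rwa [e1, e1] at key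
  | cons a l₁ ih =>
    intro hn
    rw [List.cons_append] at hn ⊢
    have hn' := List.nodup_cons.1 hn
    have hai : a ≠ i := fun e => hn'.1 (by simp [e])
    have haj : a ≠ j := fun e => hn'.1 (by simp [e])
    have hd := List.nodup_append.1 hn'.2
    refine (Anti.mul h2 (Anti.of_commute hP (hX a hai haj)) ?_).mul h2 (ih hn'.2)
    rw [List.map_append, List.prod_append, List.map_cons, List.map_cons, List.prod_cons,
      List.prod_cons, ← mul_assoc (R a i)]
    have hn1 := List.nodup_cons.1 hd.2.1
    have hn2 := List.nodup_cons.1 hn1.2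
    refine Anti.mul h2 (Anti.list_prod h2 hP _ _ fun b hb => ?_)
      ((hl a hai haj).mul h2 (Anti.list_prod h2 hP _ _ fun b hb => ?_))
    · exact Anti.of_commute hP (hR a b (fun e => hn'.1 (by simp [e, hb])) hai haj
        (hd.2.2 b hb i (by simp)) (hd.2.2 b hb j (by simp)))
    · exact Anti.of_commute hP (hR a b (fun e => hn'.1 (by simp [e, hb])) hai haj
        (fun e => hn1.1 (by simp [← e, hb])) (fun e => hn2.1 (by simp [← e, hb])))

/-- The exchange relation `h` lets `T' a` move right through the block `∏ R_{ab}` and past every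
later `T b`, so all `T` collect on the left and all `T'` on the right, in their original order. -/
theorem ordProd_mul_mul {T G T' : ι → B} {R : ι → ι → B}
    (h : ∀ a b, a ≠ b → T' a * R a b * T b = T b * R a b * T' a)
    (hRT : ∀ a b c, a ≠ b → c ≠ a → c ≠ b → Commute (R a b) (T c))
    (hGT : ∀ a b, a ≠ b → Commute (G a) (T b))
    (hTG : ∀ a b, a ≠ b → Commute (T' a) (G b))
    (hTR : ∀ a b c, a ≠ b → c ≠ a → c ≠ b → Commute (T' c) (R a b)) :
    ∀ l : List ι, l.Nodup → ordProd (fun a => T a * G a * T' a) R l =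
      (l.map T).prod * ordProd G R l * (l.map T').prod
  | [], _ => by simp [ordProd]
  | a :: l, hn => by
    have hn' := List.nodup_cons.1 hn
    have ih := ordProd_mul_mul h hRT hGT hTG hTR l hn'.2
    have hne : ∀ b ∈ l, a ≠ b := fun b hb e => hn'.1 (e ▸ hb)
    have h1 : ∀ l' : List ι, (∀ b ∈ l', a ≠ b) → l'.Nodup →
        T' a * (l'.map (R a)).prod * (l'.map T).prod =
          (l'.map T).prod * (l'.map (R a)).prod * T' a := by
      intro l'
      induction l' with
      | nil => simp
      | cons b l' ih' =>
        intro hb hn2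
        have hn3 := List.nodup_cons.1 hn2
        have hab := hb b (by simp)
        have c1 : Commute (T b) (l'.map (R a)).prod := commute_list_prod fun c hc =>
          (hRT a c b (hb c (by simp [hc])) hab.symm fun e => hn3.1 (e ▸ hc)).symm
        have c2 : Commute (R a b) (l'.map T).prod := commute_list_prod fun c hc =>
          hRT a b c hab (hb c (by simp [hc])).symm fun e => hn3.1 (e ▸ hc)
        have ih2 := ih' (fun c hc => hb c (by simp [hc])) hn3.2
        simp only [List.map_cons, List.prod_cons]
        calc _ = T' a * R a b * ((l'.map (R a)).prod * T b) * (l'.map T).prod := by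
              simp only [mul_assoc]
          _ = (T' a * R a b * T b) * (l'.map (R a)).prod * (l'.map T).prod := by
              rw [← c1.eq]; simp only [mul_assoc]
          _ = T b * R a b * (T' a * (l'.map (R a)).prod * (l'.map T).prod) := by
              rw [h a b hab]; simp only [mul_assoc]
          _ = T b * (R a b * (l'.map T).prod) * (l'.map (R a)).prod * T' a := by
              rw [ih2]; simp only [mul_assoc]
          _ = _ := by rw [c2.eq]; simp only [mul_assoc]
    have hK : Commute (T' a) (ordProd G R l) := by
      have : ∀ l' : List ι, (∀ b ∈ l', a ≠ b) → l'.Nodup → Commute (T' a) (ordProd G R l') := by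
        intro l'
        induction l' with
        | nil => exact fun _ _ => Commute.one_right _
        | cons b l' ih' =>
          intro hb hn2
          have hn3 := List.nodup_cons.1 hn2
          have hab := hb b (by simp)
          refine ((hTG a b hab).mul_right (commute_list_prod fun c hc => ?_)).mul_right
            (ih' (fun c hc => hb c (by simp [hc])) hn3.2)
          exact hTR b c a (fun e => hn3.1 (e ▸ hc)) hab (hb c (by simp [hc]))
      exact this l hne hn'.2
    have hG : Commute (G a) (l.map T).prod := commute_list_prod fun b hb => hGT a b (hne b hb)
    rw [ordProd, ih, ordProd]
    simp only [List.map_cons, List.prod_cons]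
    calc _ = T a * G a * (T' a * (l.map (R a)).prod * (l.map T).prod) * ordProd G R l *
          (l.map T').prod := by simp only [mul_assoc]
      _ = T a * (G a * (l.map T).prod) * (l.map (R a)).prod * (T' a * ordProd G R l) *
          (l.map T').prod := by rw [h1 l hne hn'.2]; simp only [mul_assoc]
      _ = _ := by rw [hG.eq, hK.eq]; simp only [mul_assoc]

end Abstract

end TwistedYangian

namespace TwistedYangian

open PowerSeries (C X coeff mk subst HasSubst constantCoeff)

/-! ### The inverse variable `(α u + β)⁻¹` and the series `g` -/

section Scalar

variable {S : Type*} [CommRing S] [Algebra ℂ S]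

/-- The series `(α u + β)⁻¹` in the variable `u⁻¹`. -/
def rho (α : ℂ) (β : S) : PowerSeries S :=
  mk fun m => match m with
    | 0 => 0
    | m + 1 => algebraMap ℂ S (α⁻¹ ^ (m + 1)) * (-β) ^ m

/-- With `X = u⁻¹` the factor on the left is `(α u + β) u⁻¹`, a unit in power series. Identities
between such inverses are proved by multiplying with these units and cancelling. -/
theorem rho_eq (α : ℂ) (hα : α ≠ 0) (β : S) :
    (C (algebraMap ℂ S α) + C β * X) * rho α β = X := by
  ext m
  rw [add_mul, mul_comm (C β), mul_assoc, map_add, PowerSeries.coeff_C_mul]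
  rcases m with _ | _ | m
  · simp [rho]
  · simp [rho, ← map_mul, hα]
  · rw [PowerSeries.coeff_succ_X_mul, PowerSeries.coeff_C_mul, PowerSeries.coeff_X,
      if_neg (by omega)]
    have : algebraMap ℂ S (α⁻¹ ^ (m + 1)) = algebraMap ℂ S α * algebraMap ℂ S (α⁻¹ ^ (m + 2)) := by
      rw [← map_mul, pow_succ' _ (m + 1), mul_inv_cancel_left₀ hα]
    simp only [rho, PowerSeries.coeff_mk, this]
    ring

theorem isUnit_denom {α : ℂ} (hα : α ≠ 0) (β : S) :
    IsUnit (C (algebraMap ℂ S α) + C β * X : PowerSeries S) := by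
  rw [PowerSeries.isUnit_iff_constantCoeff]
  simpa using (IsUnit.mk0 α hα).map (algebraMap ℂ S)

theorem constantCoeff_rho (α : ℂ) (β : S) : constantCoeff (rho α β) = 0 := by
  rw [← PowerSeries.coeff_zero_eq_constantCoeff_apply]; simp [rho]

/-- Both sides satisfy `(α + βX) e_{p+1} = X e_p`; for the binomial coefficients with upper entry
`-p` this is Pascal's rule. -/
theorem coeff_rho_pow {α : ℂ} (hα : α ≠ 0) (β : S) (p m : ℕ) :
    coeff m (rho α β ^ p) = if p ≤ m then
      ((Ring.choose (-(p : ℤ)) (m - p) : ℤ) : S) * algebraMap ℂ S ((α⁻¹) ^ m) * β ^ (m - p)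
      else 0 := by
  set e : ℕ → PowerSeries S := fun p => mk fun m => if p ≤ m then
      ((Ring.choose (-(p : ℤ)) (m - p) : ℤ) : S) * algebraMap ℂ S ((α⁻¹) ^ m) * β ^ (m - p)
      else 0 with he
  have hstep : ∀ p, (C (algebraMap ℂ S α) + C β * X) * e (p + 1) = X * e p := by
    intro p
    ext m
    rw [add_mul, mul_comm (C β), mul_assoc, map_add, PowerSeries.coeff_C_mul]
    rcases m with _ | m
    · simp [he]
    · rw [PowerSeries.coeff_succ_X_mul, PowerSeries.coeff_C_mul, PowerSeries.coeff_succ_X_mul]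
      simp only [he, PowerSeries.coeff_mk]
      have h1 : algebraMap ℂ S (α⁻¹ ^ m) = algebraMap ℂ S α * algebraMap ℂ S (α⁻¹ ^ (m + 1)) := by
        rw [← map_mul, pow_succ', mul_inv_cancel_left₀ hα]
      rcases lt_trichotomy m p with hm | rfl | hm
      · simp [show ¬ p + 1 ≤ m + 1 by omega, show ¬ p + 1 ≤ m by omega, show ¬ p ≤ m by omega]
      · simp only [le_refl, if_true, show ¬ m + 1 ≤ m by omega, if_false, Nat.sub_self, h1]
        simp
      · obtain ⟨k, rfl⟩ : ∃ k, m = p + k + 1 := ⟨m - p - 1, by omega⟩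
        rw [if_pos (by omega), if_pos (by omega), if_pos (by omega), h1,
          show p + k + 1 + 1 - (p + 1) = k + 1 by omega, show p + k + 1 - (p + 1) = k by omega,
          show p + k + 1 - p = k + 1 by omega]
        have h2 := Ring.choose_succ_succ (-((p + 1 : ℕ) : ℤ)) k
        rw [show -((p + 1 : ℕ) : ℤ) + 1 = -(p : ℤ) by push_cast; ring] at h2
        rw [h2]
        push_cast
        ring
  have hpow : ∀ p, rho α β ^ p = e p := by
    intro p
    induction p with
    | zero =>
      ext m
      rcases m with _ | m
      · simp [he]
      · simp [he, PowerSeries.coeff_one, Ring.choose_zero_succ]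
    | succ p ih =>
      refine (isUnit_denom hα β).mul_left_cancel ?_
      rw [hstep, pow_succ', ← mul_assoc, rho_eq α hα, ih]
  rw [hpow, he, PowerSeries.coeff_mk]

theorem expandInv_eq {M : Type*} [AddCommGroup M] [Module S M] {α : ℂ} (hα : α ≠ 0) (β : S)
    (f : ℕ → M) (m : ℕ) :
    expandInv α β f m = ∑ p ∈ Finset.range (m + 1), coeff m (rho α β ^ p) • f p := by
  refine Finset.sum_congr rfl fun p hp => ?_
  rw [coeff_rho_pow hα, if_pos (by simpa [Nat.lt_succ_iff] using hp)]

theorem hasSubst_mul_rho (η : S) (α : ℂ) (β : S) : HasSubst (C η * rho α β) :=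
  HasSubst.of_constantCoeff_zero' (by simp [constantCoeff_rho])

theorem coeff_mul_rho_pow (η : S) (α : ℂ) (β : S) (p m : ℕ) :
    coeff m ((C η * rho α β) ^ p) = η ^ p * coeff m (rho α β ^ p) := by
  rw [mul_pow, ← map_pow, PowerSeries.coeff_C_mul]

theorem coeff_subst_mul_rho {α : ℂ} (hα : α ≠ 0) (η β : S) (f : PowerSeries ℂ) (m : ℕ) :
    coeff m (f.subst (C η * rho α β)) = ∑ p ∈ Finset.range (m + 1),
      coeff p f • (η ^ p * coeff m (rho α β ^ p)) := by
  rw [PowerSeries.coeff_subst' (hasSubst_mul_rho η α β), finsum_eq_sum_of_support_subset]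
  · exact Finset.sum_congr rfl fun p _ => by rw [coeff_mul_rho_pow]
  · intro p hp
    by_contra h
    refine hp ?_
    change coeff p f • _ = 0
    rw [coeff_mul_rho_pow, coeff_rho_pow hα, if_neg (by simpa using h), mul_zero, smul_zero]

/-- The series `g`. -/
def gser (N : ℕ) : PowerSeries ℂ := mk (gCoeff N)

/-- `g((α u + β) / η)`, a series in `u⁻¹`. -/
def gam (N : ℕ) (η : S) (α : ℂ) (β : S) : PowerSeries S := (gser N).subst (C η * rho α β)

theorem coeff_gam {N : ℕ} {α : ℂ} (hα : α ≠ 0) (η β : S) (m : ℕ) :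
    coeff m (gam N η α β) = ∑ p ∈ Finset.range (m + 1),
      algebraMap ℂ S (gCoeff N p) * (η ^ p * coeff m (rho α β ^ p)) := by
  rw [gam, coeff_subst_mul_rho hα]
  exact Finset.sum_congr rfl fun p _ => by rw [gser, PowerSeries.coeff_mk, Algebra.smul_def]

theorem coeff_rho_mul_gam {N : ℕ} {α : ℂ} (hα : α ≠ 0) (η β : S) (m : ℕ) :
    coeff m (C η * rho α β * gam N η α β) = ∑ p ∈ Finset.range m,
      algebraMap ℂ S (gCoeff N p) * (η ^ (p + 1) * coeff m (rho α β ^ (p + 1))) := by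
  have h1 : C η * rho α β * gam N η α β = (X * gser N).subst (C η * rho α β) := by
    rw [PowerSeries.subst_mul (hasSubst_mul_rho η α β), PowerSeries.subst_X
      (hasSubst_mul_rho η α β), gam]
  rw [h1, coeff_subst_mul_rho hα, Finset.sum_range_succ']
  simp only [PowerSeries.coeff_succ_X_mul, PowerSeries.coeff_zero_X_mul, add_zero, gser,
    PowerSeries.coeff_mk, Algebra.smul_def, map_zero, zero_mul]

/-- The normalized `R`-matrix `R̄(α u + β)`, expanded in `u⁻¹`, in terms of `g`. -/
theorem sum_rho_smul_Rbar {N : ℕ} {α : ℂ} (hα : α ≠ 0) (η β : S)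
    (f : ℕ → Matrix (Idx2 N) (Idx2 N) S) (Y : Matrix (Idx2 N) (Idx2 N) S) (h0 : f 0 = 1)
    (hf : ∀ p, f (p + 1) = η ^ (p + 1) • (algebraMap ℂ S (gCoeff N (p + 1)) • 1
      - algebraMap ℂ S (gCoeff N p) • Y)) (m : ℕ) :
    expandInv α β f m =
      coeff m (gam N η α β) • (1 : Matrix (Idx2 N) (Idx2 N) S)
        - coeff m (C η * rho α β * gam N η α β) • Y := by
  rw [expandInv_eq hα, coeff_gam hα, coeff_rho_mul_gam hα, Finset.sum_range_succ',
    Finset.sum_range_succ' (fun p => algebraMap ℂ S (gCoeff N p) * _), h0]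
  simp only [hf, Finset.sum_smul, add_smul, smul_sub, Finset.sum_sub_distrib, smul_smul]
  have h1 : gCoeff N 0 = 1 := by rw [gCoeff]
  rw [h1, map_one, one_mul, pow_zero, pow_zero, one_mul, add_sub_right_comm]
  congr 2
  · exact Finset.sum_congr rfl fun p _ => by congr 1; ring
  · exact Finset.sum_congr rfl fun p _ => by congr 1; ring

/-- For `y = (u + β)/η` this is `1/(y + a) = η/(u + β + aη)`. -/
theorem subst_rho (η β : S) (a : ℂ) :
    (rho 1 a).subst (C η * rho 1 β) = C η * rho 1 (β + algebraMap ℂ S a * η) := by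
  have hs := hasSubst_mul_rho η 1 β
  have h1 := congrArg (PowerSeries.subst (C η * rho 1 β)) (rho_eq 1 one_ne_zero a)
  have h2 := rho_eq 1 one_ne_zero β
  have h3 := rho_eq 1 one_ne_zero (β + algebraMap ℂ S a * η)
  rw [PowerSeries.subst_mul hs, PowerSeries.subst_add hs, PowerSeries.subst_mul hs,
    PowerSeries.subst_X hs] at h1
  have hC : ∀ z : ℂ, (C (algebraMap ℂ ℂ z)).subst (C η * rho 1 β) = C (algebraMap ℂ S z) := by
    intro z
    have := PowerSeries.subst_smul hs z (1 : PowerSeries ℂ)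
    have h4 : (1 : PowerSeries ℂ).subst (C η * rho 1 β) = (1 : PowerSeries S) := by
      rw [← PowerSeries.coe_substAlgHom hs, map_one]
    rw [h4] at this
    have h5 : (C (algebraMap ℂ ℂ z) : PowerSeries ℂ) = z • 1 := by
      rw [PowerSeries.smul_eq_C_mul, mul_one]; rfl
    have h6 : (C (algebraMap ℂ S z) : PowerSeries S) = z • 1 := by
      ext m; simp [PowerSeries.coeff_C, PowerSeries.coeff_one, Algebra.algebraMap_eq_smul_one]
    rw [h5, this, h6]
  have hC' := hC a
  rw [Algebra.algebraMap_self, RingHom.id_apply] at hC'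
  rw [hC, hC'] at h1
  refine (isUnit_denom one_ne_zero (β + algebraMap ℂ S a * η)).mul_left_cancel ?_
  rw [mul_left_comm, h3, map_add, map_mul]
  rw [map_one, map_one] at *
  linear_combination (1 + C β * X) * h1 + (C η - C (algebraMap ℂ S a) * C η *
    (rho 1 a).subst (C η * rho 1 β)) * h2

/-- The chain condition of the fusion lemmas: with `x = u + β`, `η/(x + η) · (1 + η/x) = η/x`. -/
theorem rho_shift (η β : S) :
    C η * rho 1 (β + η) * (1 + C η * rho 1 β) = C η * rho 1 β := by
  have h2 := rho_eq 1 one_ne_zero β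
  have h3 := rho_eq 1 one_ne_zero (β + η)
  rw [map_one, map_one, map_add] at *
  have hu := isUnit_denom (S := S) one_ne_zero β
  rw [map_one, map_one] at hu
  refine hu.mul_left_cancel ?_
  linear_combination C η * h3 - C η * h2 + C η * C η * rho 1 (β + η) * h2

/-- `1/x - 1/(x+1) = 1/(x(x+1))` at `x = -2u + β`; it feeds the hypothesis `hbc` of
`one_sub_mul_one_sub`. -/
theorem rho_neg_two_shift (β : ℂ) :
    rho (-2) β = rho (-2) (β + 1) + rho (-2) β * rho (-2) (β + 1) := by
  have h0 : (-2 : ℂ) ≠ 0 := by norm_num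
  have h2 := rho_eq (-2) h0 β
  have h3 := rho_eq (-2) h0 (β + 1)
  rw [map_add, map_one] at h3
  refine ((isUnit_denom h0 β).mul (isUnit_denom h0 (β + 1))).mul_left_cancel ?_
  rw [map_add, map_one]
  linear_combination (C (algebraMap ℂ ℂ (-2)) + (C β + 1) * X) * h2
    - (C (algebraMap ℂ ℂ (-2)) + C β * X) * h3
    - (C (algebraMap ℂ ℂ (-2)) + (C β + 1) * X) * rho (-2) (β + 1) * h2 - X * h3

end Scalar

/-! ### The product identity for the normalizing series `g`. -/

section Fusion

/-- A first nonconstant term `f_q u⁻q` would contribute `-q f_q` to the coefficient of `u^{-q-1}` in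
`f(u + 1) - f(u)`, and nothing else does. -/
theorem subst_one_eq_one {f : PowerSeries ℂ} (h0 : constantCoeff f = 1)
    (hf : f.subst (rho 1 (1 : ℂ)) = f) : f = 1 := by
  have hs : ∀ f : PowerSeries ℂ, f.subst (rho 1 (1 : ℂ)) = f.subst (C 1 * rho 1 (1 : ℂ)) := by
    intro f; rw [map_one, one_mul]
  have key : ∀ p, ∀ q, q < p → 0 < q → coeff q f = 0 := by
    intro p
    induction p with
    | zero => intro q hq; omega
    | succ p ih =>
      intro q hq hq0
      rcases Nat.lt_succ_iff_lt_or_eq.1 hq with hq | rfl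
      · exact ih q hq hq0
      have h1 := congrArg (coeff (q + 1)) hf
      rw [hs, coeff_subst_mul_rho one_ne_zero, Finset.sum_range_succ, Finset.sum_range_succ,
        Finset.sum_eq_zero] at h1
      · rw [coeff_rho_pow one_ne_zero, coeff_rho_pow one_ne_zero] at h1
        have : (q : ℂ) ≠ 0 := by exact_mod_cast hq0.ne'
        simpa [this] using h1
      · intro r hr
        rcases Nat.eq_zero_or_pos r with rfl | hr0
        · simp [PowerSeries.coeff_one]
        · rw [ih r (by simpa using hr) hr0, zero_smul]
  ext m
  rcases m with _ | m
  · simpa using h0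
  · rw [key (m + 2) (m + 1) (by omega) (by omega), PowerSeries.coeff_one, if_neg (by omega)]

theorem subst_rho_rho (a b : ℂ) : (rho 1 a).subst (rho 1 b) = rho 1 (b + a) := by
  have := subst_rho (1 : ℂ) b a
  simpa using this

theorem hasSubst_rho (b : ℂ) : HasSubst (rho 1 b) := by
  simpa using hasSubst_mul_rho (1 : ℂ) 1 b

theorem gser_subst {N : ℕ} (hN : N ≠ 0) :
    (gser N).subst (rho 1 (N : ℂ)) = gser N * (1 - X ^ 2) := by
  rw [gser, ← gSeries_spec hN]
  ext m
  have := coeff_subst_mul_rho one_ne_zero 1 (N : ℂ) (gser N) m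
  rw [map_one, one_mul] at this
  rw [← gser, this, PowerSeries.coeff_mk, expandInv_eq one_ne_zero]
  refine Finset.sum_congr rfl fun p _ => ?_
  rw [one_pow, one_mul, smul_eq_mul, smul_eq_mul, gser, PowerSeries.coeff_mk, mul_comm]

theorem constantCoeff_gser_subst (N : ℕ) (b : ℂ) :
    constantCoeff ((gser N).subst (rho 1 b)) = 1 := by
  have := coeff_subst_mul_rho one_ne_zero 1 b (gser N) 0
  rw [map_one, one_mul] at this
  rw [← PowerSeries.coeff_zero_eq_constantCoeff_apply, this]
  simp [gser, gCoeff]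

/-- The left side is invariant under `u ↦ u + 1`: the product of the `g(u + i)` gets multiplied by
`g(u + N)/g(u) = 1 - u⁻²`, while `1 - 1/u` becomes `u/(u + 1)`. This is the purpose of the
functional equation: the scalar left over by fusion is cancelled. -/
theorem prod_gser_subst {N : ℕ} (hN : N ≠ 0) :
    (∏ i ∈ Finset.range N, (gser N).subst (rho 1 (i : ℂ))) * (1 - X) = 1 := by
  refine subst_one_eq_one ?_ ?_
  · simp [map_prod, constantCoeff_gser_subst]
  have hs := hasSubst_rho 1
  have hX := subst_rho_rho 0 1
  have h0 : rho 1 (0 : ℂ) = X := by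
    simpa using rho_eq 1 one_ne_zero (0 : ℂ)
  have hr := rho_eq 1 one_ne_zero (1 : ℂ)
  have h1 : ∀ i : ℕ, PowerSeries.subst (rho 1 (1 : ℂ)) ((gser N).subst (rho 1 (i : ℂ))) =
      (gser N).subst (rho 1 ((i + 1 : ℕ) : ℂ)) := by
    intro i
    rw [PowerSeries.subst_comp_subst_apply (hasSubst_rho _) hs, subst_rho_rho]
    push_cast
    rw [add_comm]
  have hg : gser N ≠ 0 := by
    intro h
    have := congrArg (coeff 0) h
    simp [gser, gCoeff] at this
  have hN' := gser_subst hN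
  refine mul_right_cancel₀ hg ?_
  have h10 : (1 : PowerSeries ℂ).subst (rho 1 (1 : ℂ)) = (1 : PowerSeries ℂ) := by
    rw [← PowerSeries.coe_substAlgHom hs, map_one]
  have hp : PowerSeries.subst (rho 1 (1 : ℂ))
      (∏ i ∈ Finset.range N, (gser N).subst (rho 1 (i : ℂ)) : PowerSeries ℂ) =
      ∏ i ∈ Finset.range N, (gser N).subst (rho 1 ((i + 1 : ℕ) : ℂ)) := by
    rw [← PowerSeries.coe_substAlgHom hs, map_prod, PowerSeries.coe_substAlgHom hs]
    exact Finset.prod_congr rfl fun i _ => h1 i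
  rw [PowerSeries.subst_mul hs, PowerSeries.subst_sub hs, PowerSeries.subst_X hs, hp, h10]
  have h2 := Finset.prod_range_succ (fun i : ℕ => (gser N).subst (rho 1 (i : ℂ))) N
  -- Splitting the product over `0, …, N` at either end compares the shifted product with the
  -- original one, without dividing by `g`.
  rw [Finset.prod_range_succ', Nat.cast_zero, h0, PowerSeries.X_subst, hN'] at h2
  rw [map_one, map_one, one_mul] at hr
  set A := ∏ i ∈ Finset.range N, (gser N).subst (rho 1 ((i + 1 : ℕ) : ℂ))
  set B := ∏ i ∈ Finset.range N, (gser N).subst (rho 1 (i : ℂ))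
  have h3 : (1 + X : PowerSeries ℂ) ≠ 0 := by
    intro h
    have := congrArg (coeff 0) h
    simp at this
  have h4 : (1 + X) * (1 - rho 1 (1 : ℂ)) = 1 := by linear_combination -hr
  refine mul_left_cancel₀ h3 ?_
  linear_combination A * gser N * h4 + h2

theorem prod_gam_mul {S : Type*} [CommRing S] [Algebra ℂ S] {N : ℕ} (hN : N ≠ 0) (η β : S) :
    (∏ i ∈ Finset.range N, gam N η 1 (β + (i : S) * η)) * (1 - C η * rho 1 β) = 1 := by
  have hs := hasSubst_mul_rho η 1 β
  have h := congrArg (PowerSeries.subst (C η * rho 1 β)) (prod_gser_subst hN)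
  rw [← PowerSeries.coe_substAlgHom hs, map_mul, map_prod, map_sub, map_one,
    PowerSeries.coe_substAlgHom hs, PowerSeries.subst_X hs] at h
  refine Eq.trans ?_ h
  congr 1
  refine Finset.prod_congr rfl fun i _ => ?_
  rw [PowerSeries.subst_comp_subst_apply (hasSubst_rho _) hs, subst_rho, gam, map_natCast]

end Fusion

end TwistedYangian

namespace TwistedYangian

open PowerSeries (C X coeff mk constantCoeff)

/-! ### Substitution of `z ∈ ℂ[[h]][[u]]` with `h ∣ z(0)` into series over `h`-nilpotent algebras -/

section Subst

/-- `F` belongs to the `d`-th power of the ideal `(u, h)`. -/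
def Filt (d : ℕ) (F : PowerSeries Rh) : Prop := ∀ k, h ^ (d - k) ∣ coeff k F

theorem Filt.mul {d e : ℕ} {F G : PowerSeries Rh} (hF : Filt d F) (hG : Filt e G) :
    Filt (d + e) (F * G) := by
  intro k
  rw [PowerSeries.coeff_mul]
  refine Finset.dvd_sum fun ij hij => ?_
  have := Finset.HasAntidiagonal.mem_antidiagonal.1 hij
  refine (pow_dvd_pow h ?_).trans ((pow_add h (d - ij.1) (e - ij.2)).symm ▸
    mul_dvd_mul (hF ij.1) (hG ij.2))
  omega

theorem Filt.pow {F : PowerSeries Rh} (hF : Filt 1 F) : ∀ p, Filt p (F ^ p)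
  | 0 => fun k => by simp
  | p + 1 => by rw [pow_succ]; exact (Filt.pow hF p).mul hF

theorem filt_one {F : PowerSeries Rh} (hF : h ∣ coeff 0 F) : Filt 1 F := by
  intro k
  rcases k with _ | k
  · simpa using hF
  · simp

variable {B : Type*} [Ring B] [Algebra Rh B] {n : ℕ}

/-- `hⁿ = 0` on `B`. -/
def NilH (n : ℕ) (B : Type*) [Ring B] [Algebra Rh B] : Prop := ∀ x : B, (h ^ n : Rh) • x = 0

theorem NilH.smul_eq_zero (hB : NilH n B) {r : Rh} {k : ℕ} (hk : n ≤ k) (hr : h ^ k ∣ r) (x : B) :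
    r • x = 0 := by
  obtain ⟨s, rfl⟩ := (pow_dvd_pow h hk).trans hr
  rw [mul_smul, hB]

/-- The scalar series. -/
def scal (B : Type*) [Ring B] [Algebra Rh B] : PowerSeries Rh →+* PowerSeries B :=
  PowerSeries.map (algebraMap Rh B)

theorem coeff_scal_mul (z : PowerSeries Rh) (F : PowerSeries B) (k : ℕ) :
    coeff k (scal B z * F) = ∑ ij ∈ Finset.HasAntidiagonal.antidiagonal k, coeff ij.1 z • coeff ij.2 F := by
  rw [PowerSeries.coeff_mul]
  exact Finset.sum_congr rfl fun ij _ => by rw [scal, PowerSeries.coeff_map, Algebra.smul_def]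

theorem scal_commute (z : PowerSeries Rh) (F : PowerSeries B) : scal B z * F = F * scal B z := by
  ext k
  rw [coeff_scal_mul, PowerSeries.coeff_mul, ← Finset.Nat.sum_antidiagonal_swap]
  refine Finset.sum_congr rfl fun ij _ => ?_
  rw [scal, PowerSeries.coeff_map]
  rw [Algebra.smul_def, Algebra.commutes]
  rfl

/-- `F(z)`, for `z` in the ideal `(u, h)`. -/
def sh (n : ℕ) (z : PowerSeries Rh) (F : PowerSeries B) : PowerSeries B :=
  mk fun k => ∑ p ∈ Finset.range (k + n), coeff k (z ^ p) • coeff p F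

/-- `∑ z₁ᵖ z₂^q D_{pq}`, for `z₁`, `z₂` in the ideal `(u, h)`. -/
def sh₂ (n : ℕ) (z₁ z₂ : PowerSeries Rh) (D : ℕ → ℕ → B) : PowerSeries B :=
  mk fun k => ∑ p ∈ Finset.range (k + n), ∑ q ∈ Finset.range (k + n),
    coeff k (z₁ ^ p * z₂ ^ q) • D p q

/-- The cut-off `k + n` is a convenience: beyond it the coefficient of `uᵏ` in `zᵖ` is divisible by
`h^{p-k}` with `p - k ≥ n`, so longer sums give the same value. -/
theorem coeff_sh (hB : NilH n B) {z : PowerSeries Rh} (hz : Filt 1 z) (F : PowerSeries B)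
    {k M : ℕ} (hM : k + n ≤ M) :
    coeff k (sh n z F) = ∑ p ∈ Finset.range M, coeff k (z ^ p) • coeff p F := by
  rw [sh, PowerSeries.coeff_mk]
  refine Finset.sum_subset (fun p => by simp only [Finset.mem_range]; omega) fun p _ hp => ?_
  exact hB.smul_eq_zero (k := p - k) (by simp at hp; omega) (hz.pow p k) _

theorem sum_square_subset {M' : Type*} [AddCommMonoid M'] {f : ℕ → ℕ → M'} {a b c : ℕ}
    (hb : a ≤ b) (hc : a ≤ c) (hf : ∀ p q, a ≤ p + q → f p q = 0) :
    ∑ p ∈ Finset.range a, ∑ q ∈ Finset.range a, f p q =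
      ∑ p ∈ Finset.range b, ∑ q ∈ Finset.range c, f p q := by
  rw [Finset.sum_subset (s₂ := Finset.range b)
    (fun p => by simp only [Finset.mem_range]; omega)]
  · refine Finset.sum_congr rfl fun p _ => ?_
    refine Finset.sum_subset (fun q => by simp only [Finset.mem_range]; omega) fun q _ hq => ?_
    exact hf p q (by simp at hq; omega)
  · intro p _ hp
    exact Finset.sum_eq_zero fun q _ => hf p q (by simp at hp; omega)

theorem coeff_sh₂ (hB : NilH n B) {z₁ z₂ : PowerSeries Rh} (h₁ : Filt 1 z₁) (h₂ : Filt 1 z₂)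
    (D : ℕ → ℕ → B) {k M M' : ℕ} (hM : k + n ≤ M) (hM' : k + n ≤ M') :
    coeff k (sh₂ n z₁ z₂ D) = ∑ p ∈ Finset.range M, ∑ q ∈ Finset.range M',
      coeff k (z₁ ^ p * z₂ ^ q) • D p q := by
  rw [sh₂, PowerSeries.coeff_mk]
  refine sum_square_subset hM hM' fun p q hpq => ?_
  exact hB.smul_eq_zero (k := p + q - k) (by omega) ((h₁.pow p).mul (h₂.pow q) k) _

theorem sh_mul_sh (hB : NilH n B) {z₁ z₂ : PowerSeries Rh} (h₁ : Filt 1 z₁) (h₂ : Filt 1 z₂)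
    (F G : PowerSeries B) :
    sh n z₁ F * sh n z₂ G = sh₂ n z₁ z₂ fun p q => coeff p F * coeff q G := by
  ext k
  rw [coeff_sh₂ hB h₁ h₂ _ le_rfl le_rfl, PowerSeries.coeff_mul]
  have : ∀ ij ∈ Finset.HasAntidiagonal.antidiagonal k, coeff ij.1 (sh n z₁ F) * coeff ij.2 (sh n z₂ G) =
      ∑ p ∈ Finset.range (k + n), ∑ q ∈ Finset.range (k + n),
        (coeff ij.1 (z₁ ^ p) * coeff ij.2 (z₂ ^ q)) • (coeff p F * coeff q G) := by
    intro ij hij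
    have := Finset.HasAntidiagonal.mem_antidiagonal.1 hij
    rw [coeff_sh hB h₁ F (M := k + n) (by omega), coeff_sh hB h₂ G (M := k + n) (by omega),
      Finset.sum_mul_sum]
    simp only [smul_mul_smul_comm]
  rw [Finset.sum_congr rfl this, Finset.sum_comm]
  refine Finset.sum_congr rfl fun p _ => ?_
  rw [Finset.sum_comm]
  refine Finset.sum_congr rfl fun q _ => ?_
  rw [PowerSeries.coeff_mul, Finset.sum_smul]

theorem sh₂_swap (z₁ z₂ : PowerSeries Rh) (D : ℕ → ℕ → B) :
    sh₂ n z₁ z₂ D = sh₂ n z₂ z₁ fun p q => D q p := by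
  ext k
  rw [sh₂, sh₂, PowerSeries.coeff_mk, PowerSeries.coeff_mk, Finset.sum_comm]
  simp only [mul_comm]

theorem sh_mul (hB : NilH n B) {z : PowerSeries Rh} (hz : Filt 1 z) (F G : PowerSeries B) :
    sh n z (F * G) = sh n z F * sh n z G := by
  ext k
  rw [sh_mul_sh hB hz hz, coeff_sh₂ hB hz hz _ le_rfl le_rfl, coeff_sh hB hz _ le_rfl]
  simp only [PowerSeries.coeff_mul _ F G, Finset.Nat.sum_antidiagonal_eq_sum_range_succ
    (fun p q => coeff p F * coeff q G), Finset.smul_sum]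
  have : ∀ m, ∀ p ∈ Finset.range (m + 1), coeff k (z ^ m) • (coeff p F * coeff (m - p) G) =
      (fun p q => coeff k (z ^ (p + q)) • (coeff p F * coeff q G)) p (m - p) := by
    intro m p hp
    have : p + (m - p) = m := by simp at hp; omega
    simp only [this]
  rw [Finset.sum_congr rfl fun m _ => Finset.sum_congr rfl (this m),
    Finset.sum_range_diag_flip (k + n) fun p q => coeff k (z ^ (p + q)) • (coeff p F * coeff q G)]
  refine Finset.sum_congr rfl fun p _ => ?_
  rw [Finset.sum_subset (s₂ := Finset.range (k + n))
    (fun q => by simp only [Finset.mem_range]; omega)]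
  · simp only [pow_add]
  · intro q _ hq
    refine hB.smul_eq_zero (k := p + q - k) ?_ (hz.pow _ k) _
    simp at hq; omega

theorem sh_C (hB : NilH n B) {z : PowerSeries Rh} (hz : Filt 1 z) (b : B) :
    sh n z (C b) = C b := by
  ext k
  rw [coeff_sh hB hz _ (M := k + n + 1) (by omega), Finset.sum_eq_single 0]
  · simp [PowerSeries.coeff_one, PowerSeries.coeff_C]
  · intro p _ hp
    rw [PowerSeries.coeff_C, if_neg hp, smul_zero]
  · simp

theorem sh_X (hB : NilH n B) {z : PowerSeries Rh} (hz : Filt 1 z) :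
    sh n z (X : PowerSeries B) = scal B z := by
  ext k
  rw [coeff_sh hB hz _ (M := k + n + 2) (by omega), Finset.sum_eq_single 1]
  · simp [scal, Algebra.algebraMap_eq_smul_one]
  · intro p _ hp
    rw [PowerSeries.coeff_X, if_neg hp, smul_zero]
  · simp

/-- `F ↦ F(z)` as a homomorphism of rings. -/
def shHom (hB : NilH n B) {z : PowerSeries Rh} (hz : Filt 1 z) : PowerSeries B →+* PowerSeries B where
  toFun := sh n z
  map_one' := by
    rw [← map_one (C : B →+* _)]
    exact sh_C hB hz 1
  map_mul' := sh_mul hB hz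
  map_zero' := by ext k; simp [sh]
  map_add' := fun F G => by ext k; simp [sh, Finset.sum_add_distrib]

theorem shHom_apply (hB : NilH n B) {z : PowerSeries Rh} (hz : Filt 1 z) (F : PowerSeries B) :
    shHom hB hz F = sh n z F := rfl

theorem sh_map {B' : Type*} [Ring B'] [Algebra Rh B'] (f : B →ₐ[Rh] B') (z : PowerSeries Rh)
    (F : PowerSeries B) :
    sh n z (PowerSeries.map f.toRingHom F) = PowerSeries.map f.toRingHom (sh n z F) := by
  ext k
  simp [sh]

theorem sh₂_sub (z₁ z₂ : PowerSeries Rh) (D D' : ℕ → ℕ → B) :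
    sh₂ n z₁ z₂ (fun p q => D p q - D' p q) = sh₂ n z₁ z₂ D - sh₂ n z₁ z₂ D' := by
  ext k; simp [sh₂, smul_sub]

theorem sh₂_smul (z₁ z₂ : PowerSeries Rh) (r : Rh) (D : ℕ → ℕ → B) :
    sh₂ n z₁ z₂ (fun p q => r • D p q) = r • sh₂ n z₁ z₂ D := by
  ext k; simp [sh₂, smul_comm r, Finset.smul_sum]

theorem sh₂_C_mul (z₁ z₂ : PowerSeries Rh) (b : B) (D : ℕ → ℕ → B) :
    sh₂ n z₁ z₂ (fun p q => b * D p q) = C b * sh₂ n z₁ z₂ D := by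
  ext k; simp [sh₂, Finset.mul_sum]

theorem sh₂_mul_C (z₁ z₂ : PowerSeries Rh) (b : B) (D : ℕ → ℕ → B) :
    sh₂ n z₁ z₂ (fun p q => D p q * b) = sh₂ n z₁ z₂ D * C b := by
  ext k; simp [sh₂, Finset.sum_mul]

/-- Multiplication by the first variable. -/
def mulFst (D : ℕ → ℕ → B) : ℕ → ℕ → B
  | 0, _ => 0
  | p + 1, q => D p q

/-- Multiplication by the second variable. -/
def mulSnd (D : ℕ → ℕ → B) : ℕ → ℕ → B
  | _, 0 => 0
  | p, q + 1 => D p q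

theorem sh₂_mulFst (hB : NilH n B) {z₁ z₂ : PowerSeries Rh} (h₁ : Filt 1 z₁) (h₂ : Filt 1 z₂)
    (D : ℕ → ℕ → B) : sh₂ n z₁ z₂ (mulFst D) = scal B z₁ * sh₂ n z₁ z₂ D := by
  ext k
  rw [coeff_sh₂ hB h₁ h₂ _ (M := k + n + 1) (M' := k + n) (by omega) le_rfl,
    Finset.sum_range_succ', coeff_scal_mul]
  have : ∀ ij ∈ Finset.HasAntidiagonal.antidiagonal k, coeff ij.1 z₁ • coeff ij.2 (sh₂ n z₁ z₂ D) =
      ∑ p ∈ Finset.range (k + n), ∑ q ∈ Finset.range (k + n),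
        (coeff ij.1 z₁ * coeff ij.2 (z₁ ^ p * z₂ ^ q)) • D p q := by
    intro ij hij
    have := Finset.HasAntidiagonal.mem_antidiagonal.1 hij
    rw [coeff_sh₂ hB h₁ h₂ _ (M := k + n) (M' := k + n) (by omega) (by omega)]
    simp only [Finset.smul_sum, smul_smul]
  rw [Finset.sum_congr rfl this,
    Finset.sum_comm (s := Finset.HasAntidiagonal.antidiagonal k)]
  simp only [mulFst, smul_zero, Finset.sum_const_zero, add_zero]
  refine Finset.sum_congr rfl fun p _ => ?_
  rw [Finset.sum_comm (s := Finset.HasAntidiagonal.antidiagonal k)]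
  refine Finset.sum_congr rfl fun q _ => ?_
  rw [← Finset.sum_smul, ← PowerSeries.coeff_mul, pow_succ', mul_assoc]

theorem sh₂_mulSnd (hB : NilH n B) {z₁ z₂ : PowerSeries Rh} (h₁ : Filt 1 z₁) (h₂ : Filt 1 z₂)
    (D : ℕ → ℕ → B) : sh₂ n z₁ z₂ (mulSnd D) = scal B z₂ * sh₂ n z₁ z₂ D := by
  rw [sh₂_swap, sh₂_swap (D := D), ← sh₂_mulFst hB h₂ h₁]
  congr 1
  funext p q
  cases p <;> rfl

theorem eq_zero_of_mulFst_eq_mulSnd {D : ℕ → ℕ → B} (hD : mulFst D = mulSnd D) : D = 0 := by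
  have key : ∀ q p, D p q = 0 := by
    intro q
    induction q with
    | zero => exact fun p => congrFun (congrFun hD (p + 1)) 0
    | succ q ih => exact fun p => (congrFun (congrFun hD (p + 1)) (q + 1)).trans (ih (p + 1))
  funext p q
  exact key q p

/-- A series in `x`, `y` that changes sign under `x ↔ y` is divisible by `x - y`. -/
theorem exists_eq_mulFst_sub_mulSnd {E : ℕ → ℕ → B} (hE : ∀ p q, E p q = -E q p)
    (h2 : ∀ x : B, x + x = 0 → x = 0) :
    ∃ D : ℕ → ℕ → B, ∀ p q, E p q = mulFst D p q - mulSnd D p q := by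
  -- Solving `E(p,q) = D(p-1,q) - D(p,q-1)` along an antidiagonal from `p = 0` forces these partial
  -- sums. The condition left at the end `q = 0` is that `E` sums to zero on each antidiagonal,
  -- which follows from the antisymmetry.
  refine ⟨fun p q => -∑ i ∈ Finset.range (p + 1), E i (p + q + 1 - i), fun p q => ?_⟩
  have hdiag : ∀ s, ∑ i ∈ Finset.range (s + 1), E i (s - i) = 0 := by
    intro s
    refine h2 _ ?_
    conv_lhs => enter [2]; rw [← Finset.sum_range_reflect]
    rw [← Finset.sum_add_distrib]
    refine Finset.sum_eq_zero fun i hi => ?_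
    have hi' : i ≤ s := by simpa [Nat.lt_succ_iff] using hi
    rw [show s + 1 - 1 - i = s - i by omega, show s - (s - i) = i by omega, hE (s - i) i]
    abel
  rcases p with _ | p <;> rcases q with _ | q
  · have := hdiag 0
    simpa [mulFst, mulSnd] using this
  · simp [mulFst, mulSnd]
  · have := hdiag (p + 1)
    rw [Finset.sum_range_succ, Nat.sub_self] at this
    simp only [mulFst, mulSnd, sub_zero, add_zero]
    rw [eq_neg_iff_add_eq_zero, add_comm]
    exact this
  · simp only [mulFst, mulSnd]
    rw [show p + 1 + q + 1 = p + (q + 1) + 1 by omega, Finset.sum_range_succ _ (p + 1),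
      show p + (q + 1) + 1 - (p + 1) = q + 1 by omega]
    abel

/-- The consequences of `(x - y) [F(x), G(y)] = h (P F(x) G(y) - G(y) F(x) P)`. -/
theorem scal_sub_mul_commutator (hB : NilH n B) {z₁ z₂ : PowerSeries Rh} (h₁ : Filt 1 z₁)
    (h₂ : Filt 1 z₂) {F G : PowerSeries B} {P : B}
    (hrel : ∀ p q, mulFst (fun p q => coeff p F * coeff q G - coeff q G * coeff p F) p q
      - mulSnd (fun p q => coeff p F * coeff q G - coeff q G * coeff p F) p q =
        h • (P * (coeff p F * coeff q G) - coeff q G * coeff p F * P)) :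
    (scal B z₁ - scal B z₂) * (sh n z₁ F * sh n z₂ G - sh n z₂ G * sh n z₁ F) =
      h • (C P * (sh n z₁ F * sh n z₂ G) - sh n z₂ G * sh n z₁ F * C P) := by
  have hW := congrArg (sh₂ n z₁ z₂) (funext fun p => funext fun q => hrel p q)
  rw [sh₂_sub, sh₂_mulFst hB h₁ h₂, sh₂_mulSnd hB h₁ h₂, sh₂_smul, sh₂_sub, sh₂_sub, sh₂_C_mul,
    sh₂_mul_C, ← sh_mul_sh hB h₁ h₂, ← sub_mul,
    sh₂_swap z₁ z₂ (fun p q => coeff q G * coeff p F), ← sh_mul_sh hB h₂ h₁] at hW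
  exact hW

/-- Substituting `z₁ - z₂ = ±h` directly would give the assertion multiplied by `h`, which is
worthless when `h` is nilpotent. Instead, let `W` be the commutator and `E` the right side as double
series, `(x - y) W = h E`. Since `P` intertwines `F` and `G`, `E` is antisymmetric, so `E = (x - y)
D` and `W = h D`. After the substitution `E = εh D`, hence `W = ε E`. -/
theorem commutator_of_sub_eq (hB : NilH n B) (h2 : ∀ x : B, x + x = 0 → x = 0)
    {z₁ z₂ : PowerSeries Rh} (h₁ : Filt 1 z₁) (h₂ : Filt 1 z₂) {ε : Rh} (hε : ε * ε = 1)
    (hz : z₁ - z₂ = C (ε * h)) {F G : PowerSeries B} {P : B}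
    (hP : P * P = 1) (hFG : ∀ p, P * coeff p F = coeff p G * P)
    (hrel : ∀ p q, mulFst (fun p q => coeff p F * coeff q G - coeff q G * coeff p F) p q
      - mulSnd (fun p q => coeff p F * coeff q G - coeff q G * coeff p F) p q =
        h • (P * (coeff p F * coeff q G) - coeff q G * coeff p F * P)) :
    sh n z₁ F * sh n z₂ G - sh n z₂ G * sh n z₁ F =
      ε • (C P * (sh n z₁ F * sh n z₂ G) - sh n z₂ G * sh n z₁ F * C P) := by
  set W : ℕ → ℕ → B := fun p q => coeff p F * coeff q G - coeff q G * coeff p F with hW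
  set E : ℕ → ℕ → B := fun p q => P * (coeff p F * coeff q G) - coeff q G * coeff p F * P with hE
  have hGF : ∀ p, P * coeff p G = coeff p F * P := by
    intro p
    have := congrArg (fun x => P * x * P) (hFG p)
    simp only [← mul_assoc, hP, one_mul] at this
    rw [mul_assoc, hP, mul_one] at this
    exact this.symm
  have hanti : ∀ p q, E p q = -E q p := by
    intro p q
    have e1 : ∀ p q, coeff q G * coeff p F * P = P * (coeff q F * coeff p G) := by
      intro p q
      rw [mul_assoc, ← hGF, ← mul_assoc, ← hFG, mul_assoc]
    simp only [hE, e1, neg_sub]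
  obtain ⟨D, hD⟩ := exists_eq_mulFst_sub_mulSnd hanti h2
  -- `x - y` is cancelled while `x` and `y` are still independent variables, where it is not a zero
  -- divisor.
  have hWD : W = fun p q => h • D p q := by
    have := eq_zero_of_mulFst_eq_mulSnd (D := fun p q => W p q - h • D p q) ?_
    · funext p q
      exact sub_eq_zero.1 (congrFun (congrFun this p) q)
    · funext p q
      have h3 := (hrel p q).trans (congrArg (h • ·) (hD p q))
      rcases p with _ | p <;> rcases q with _ | q <;>
        simp only [mulFst, mulSnd, sub_zero, zero_sub, smul_sub, smul_neg, smul_zero] at h3 ⊢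
      · rw [eq_comm, sub_eq_zero]; exact neg_injective h3
      · rw [sub_eq_zero]; exact h3
      · rw [sub_eq_sub_iff_sub_eq_sub]; exact h3
  have e1 : sh₂ n z₁ z₂ W = sh n z₁ F * sh n z₂ G - sh n z₂ G * sh n z₁ F := by
    rw [hW, sh₂_sub, ← sh_mul_sh hB h₁ h₂, sh₂_swap z₁ z₂ (fun p q => coeff q G * coeff p F),
      ← sh_mul_sh hB h₂ h₁]
  have e2 : sh₂ n z₁ z₂ E =
      C P * (sh n z₁ F * sh n z₂ G) - sh n z₂ G * sh n z₁ F * C P := by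
    rw [hE, sh₂_sub, sh₂_C_mul, sh₂_mul_C, ← sh_mul_sh hB h₁ h₂,
      sh₂_swap z₁ z₂ (fun p q => coeff q G * coeff p F), ← sh_mul_sh hB h₂ h₁]
  have e3 : sh₂ n z₁ z₂ E = (ε * h) • sh₂ n z₁ z₂ D := by
    rw [show E = fun p q => mulFst D p q - mulSnd D p q from funext fun p => funext (hD p),
      sh₂_sub, sh₂_mulFst hB h₁ h₂, sh₂_mulSnd hB h₁ h₂, ← sub_mul, ← map_sub, hz]
    ext k
    rw [scal, PowerSeries.map_C, PowerSeries.coeff_C_mul, PowerSeries.coeff_smul, Algebra.smul_def]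
  rw [← e1, ← e2, e3, hWD, sh₂_smul, smul_smul, ← mul_assoc, hε, one_mul]

end Subst

end TwistedYangian

namespace TwistedYangian

open PowerSeries (C X coeff mk constantCoeff)

/-! ### Consequences of the defining relations over `h`-nilpotent algebras -/

theorem eq_zero_of_add_self {M : Type*} [AddCommGroup M] [Module Rh M] (x : M) (hx : x + x = 0) :
    x = 0 := by
  have h1 : (C (2⁻¹ : ℂ) : Rh) * 2 = 1 := by
    rw [← map_ofNat C 2, ← map_mul]; norm_num
  rw [← one_smul Rh x, ← h1, mul_smul, two_smul, hx, smul_zero]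

section Emb

variable {N : ℕ} {D : Type*} [Ring D] [Algebra Rh D]

/-- `emb₁` as a homomorphism of algebras. -/
def embHom₁ : Matrix (Fin N) (Fin N) D →ₐ[Rh] Matrix (Idx2 N) (Idx2 N) D :=
  AlgHom.ofLinearMap
    { toFun := emb₁
      map_add' := fun X Y => by
        ext a b; simp only [emb₁, Matrix.of_apply, Matrix.add_apply]; split_ifs <;> simp
      map_smul' := fun r X => by
        ext a b; simp only [emb₁, Matrix.of_apply, Matrix.smul_apply, RingHom.id_apply]
        split_ifs <;> simp }
    (by
      ext a b
      simp only [LinearMap.coe_mk, AddHom.coe_mk, emb₁, Matrix.of_apply, Matrix.one_apply,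
        ← ite_and]
      exact if_congr (by rw [Prod.ext_iff]; exact and_comm) rfl rfl)
    (fun X Y => by
      ext a b
      simp only [LinearMap.coe_mk, AddHom.coe_mk, emb₁_mul_apply]
      simp only [emb₁, Matrix.of_apply, Matrix.mul_apply]
      split_ifs <;> simp)

/-- `emb₂` as a homomorphism of algebras. -/
def embHom₂ : Matrix (Fin N) (Fin N) D →ₐ[Rh] Matrix (Idx2 N) (Idx2 N) D :=
  AlgHom.ofLinearMap
    { toFun := emb₂
      map_add' := fun X Y => by
        ext a b; simp only [emb₂, Matrix.of_apply, Matrix.add_apply]; split_ifs <;> simp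
      map_smul' := fun r X => by
        ext a b; simp only [emb₂, Matrix.of_apply, Matrix.smul_apply, RingHom.id_apply]
        split_ifs <;> simp }
    (by
      ext a b
      simp only [LinearMap.coe_mk, AddHom.coe_mk, emb₂, Matrix.of_apply, Matrix.one_apply,
        ← ite_and]
      exact if_congr (by rw [Prod.ext_iff]) rfl rfl)
    (fun X Y => by
      ext a b
      simp only [LinearMap.coe_mk, AddHom.coe_mk, emb₂_mul_apply]
      simp only [emb₂, Matrix.of_apply, Matrix.mul_apply]
      split_ifs <;> simp)

theorem NilH.matrix {n : ℕ} (hD : NilH n D) (m : Type*) [Fintype m] [DecidableEq m] :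
    NilH n (Matrix m m D) := fun x => by
  ext i j
  exact hD _

theorem coeff_first_mul_second (F G : PowerSeries (Matrix (Fin N) (Fin N) D)) (a b : ℕ) :
    coeff b (coeff a (first F * second G)) = emb₁ (coeff a F) * emb₂ (coeff b G) := by
  rw [first, second, PowerSeries.coeff_mul_C, PowerSeries.coeff_mk, PowerSeries.coeff_C_mul,
    PowerSeries.coeff_mk]

theorem coeff_second_mul_first (F G : PowerSeries (Matrix (Fin N) (Fin N) D)) (a b : ℕ) :
    coeff b (coeff a (second G * first F)) = emb₂ (coeff b G) * emb₁ (coeff a F) := by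
  rw [first, second, PowerSeries.coeff_C_mul, PowerSeries.coeff_mk, PowerSeries.coeff_mul_C,
    PowerSeries.coeff_mk]

theorem coeff_xvar_mul (W : Ser2 N D) (a b : ℕ) :
    coeff b (coeff a (xvar * W)) = mulFst (fun a b => coeff b (coeff a W)) a b := by
  rcases a with _ | a
  · simp [xvar, mulFst]
  · rw [xvar, PowerSeries.coeff_succ_X_mul]; rfl

theorem coeff_yvar_mul (W : Ser2 N D) (a b : ℕ) :
    coeff b (coeff a (yvar * W)) = mulSnd (fun a b => coeff b (coeff a W)) a b := by
  rw [yvar, PowerSeries.coeff_C_mul]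
  rcases b with _ | b
  · simp [mulSnd]
  · rw [PowerSeries.coeff_succ_X_mul]; rfl

theorem xvar_commute (W : Ser2 N D) : W * xvar = xvar * W := PowerSeries.commute_X W

theorem yvar_commute (W : Ser2 N D) : W * yvar = yvar * W := by
  ext1 a
  rw [yvar, PowerSeries.coeff_C_mul, PowerSeries.coeff_mul_C]
  exact PowerSeries.commute_X _

/-- The RTT relation solved for the commutator, coefficient by coefficient; this is the shape
required by the specialization lemmas above. -/
theorem relation_plus {c : ℂ} {t : Gen N → D} (hrel : relationSeries c t 1 = 0) (p q : ℕ) :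
    mulFst (fun p q => coeff p (PowerSeries.map embHom₁.toRingHom (TPlus t)) *
          coeff q (PowerSeries.map embHom₂.toRingHom (TPlus t))
        - coeff q (PowerSeries.map embHom₂.toRingHom (TPlus t)) *
          coeff p (PowerSeries.map embHom₁.toRingHom (TPlus t))) p q
      - mulSnd (fun p q => coeff p (PowerSeries.map embHom₁.toRingHom (TPlus t)) *
          coeff q (PowerSeries.map embHom₂.toRingHom (TPlus t))
        - coeff q (PowerSeries.map embHom₂.toRingHom (TPlus t)) *
          coeff p (PowerSeries.map embHom₁.toRingHom (TPlus t))) p q =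
      h • (perm D * (coeff p (PowerSeries.map embHom₁.toRingHom (TPlus t)) *
          coeff q (PowerSeries.map embHom₂.toRingHom (TPlus t)))
        - coeff q (PowerSeries.map embHom₂.toRingHom (TPlus t)) *
          coeff p (PowerSeries.map embHom₁.toRingHom (TPlus t)) * perm D) := by
  have hf : ∀ p, coeff p (PowerSeries.map embHom₁.toRingHom (TPlus t)) =
      emb₁ (coeff p (TPlus t)) := fun p => rfl
  have hs : ∀ p, coeff p (PowerSeries.map embHom₂.toRingHom (TPlus t)) =
      emb₂ (coeff p (TPlus t)) := fun p => rfl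
  simp only [hf, hs]
  have h1 : xvar * (first (TPlus t) * second (TPlus t) - second (TPlus t) * first (TPlus t))
      - yvar * (first (TPlus t) * second (TPlus t) - second (TPlus t) * first (TPlus t))
      = h • (permSer * (first (TPlus t) * second (TPlus t))
        - second (TPlus t) * first (TPlus t) * permSer) := by
    have e := hrel
    simp only [relationSeries] at e
    rw [mul_assoc _ (first _), mul_sub, mul_sub, mul_smul_comm, sub_mul, sub_mul, smul_mul_assoc,
      xvar_commute, yvar_commute] at e
    rw [← sub_eq_zero, ← e, mul_sub, mul_sub, smul_sub]
    abel
  have h2 := congrArg (fun W => coeff q (coeff p W)) h1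
  simp only [map_sub, coeff_xvar_mul, coeff_yvar_mul, PowerSeries.coeff_smul,
    coeff_first_mul_second, coeff_second_mul_first] at h2
  rw [h2, permSer, PowerSeries.coeff_C_mul, PowerSeries.coeff_C_mul, PowerSeries.coeff_mul_C,
    PowerSeries.coeff_mul_C, coeff_first_mul_second, coeff_second_mul_first]

end Emb

/-! ### Specializations and transposes of the relation for `T⁺` on two tensor factors. -/

section Sites

variable {N : ℕ} {A : Type*} [Ring A] [Algebra Rh A] {ι : Type*} [Fintype ι] [DecidableEq ι]

/-- The copy of a matrix series on the tensor factor `i`. -/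
def atS (i : ι) : PowerSeries (Matrix (Fin N) (Fin N) A) →+*
    PowerSeries (Matrix (ι → Fin N) (ι → Fin N) A) :=
  PowerSeries.map (at₁ i).toRingHom

/-- The copy of a matrix series on the tensor factors `i` and `j`. -/
def atS₂ (i j : ι) (hij : i ≠ j) : PowerSeries (Matrix (Idx2 N) (Idx2 N) A) →+*
    PowerSeries (Matrix (ι → Fin N) (ι → Fin N) A) :=
  PowerSeries.map (at₂ i j hij).toRingHom

theorem atS₂_map_emb₁ {i j : ι} (hij : i ≠ j) (F : PowerSeries (Matrix (Fin N) (Fin N) A)) :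
    atS₂ i j hij (PowerSeries.map embHom₁.toRingHom F) = atS i F := by
  ext1 k
  exact at₂_emb₁ hij _

theorem atS₂_map_emb₂ {i j : ι} (hij : i ≠ j) (F : PowerSeries (Matrix (Fin N) (Fin N) A)) :
    atS₂ i j hij (PowerSeries.map embHom₂.toRingHom F) = atS j F := by
  ext1 k
  exact at₂_emb₂ hij _

theorem atS₂_C {i j : ι} (hij : i ≠ j) (Y : Matrix (Idx2 N) (Idx2 N) A) :
    atS₂ i j hij (C Y) = C (at₂ i j hij Y) := PowerSeries.map_C _ _

/-- A linear map applied to the coefficients of a series. -/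
def mapCoeff {B B' : Type*} [Ring B] [Ring B'] [Algebra Rh B] [Algebra Rh B']
    (f : B →ₗ[Rh] B') (F : PowerSeries B) : PowerSeries B' := mk fun k => f (coeff k F)

/-- Partial transposition as a linear map. -/
def transpLin₁ : Matrix (Idx2 N) (Idx2 N) A →ₗ[Rh] Matrix (Idx2 N) (Idx2 N) A where
  toFun := transp₁
  map_add' _ _ := rfl
  map_smul' _ _ := rfl

theorem mapCoeff_scal_mul {B B' : Type*} [Ring B] [Ring B'] [Algebra Rh B] [Algebra Rh B']
    (f : B →ₗ[Rh] B') (z : PowerSeries Rh) (F : PowerSeries B) :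
    mapCoeff f (scal B z * F) = scal B' z * mapCoeff f F := by
  ext k
  rw [mapCoeff, PowerSeries.coeff_mk, coeff_scal_mul, coeff_scal_mul, map_sum]
  exact Finset.sum_congr rfl fun ij _ => by rw [map_smul, mapCoeff, PowerSeries.coeff_mk]

theorem mapCoeff_sub {B B' : Type*} [Ring B] [Ring B'] [Algebra Rh B] [Algebra Rh B'] (f : B →ₗ[Rh] B') (F G : PowerSeries B) :
    mapCoeff f (F - G) = mapCoeff f F - mapCoeff f G := by
  ext k; simp [mapCoeff]

theorem mapCoeff_smul {B B' : Type*} [Ring B] [Ring B'] [Algebra Rh B] [Algebra Rh B'] (f : B →ₗ[Rh] B') (r : Rh) (F : PowerSeries B) :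
    mapCoeff f (r • F) = r • mapCoeff f F := by
  ext k; simp [mapCoeff]

/-- `X₁ ↦ X₁` on series. -/
abbrev s₁ (F : PowerSeries (Matrix (Fin N) (Fin N) A)) : PowerSeries (Matrix (Idx2 N) (Idx2 N) A) :=
  PowerSeries.map embHom₁.toRingHom F

/-- `X ↦ X₂` on series. -/
abbrev s₂ (F : PowerSeries (Matrix (Fin N) (Fin N) A)) : PowerSeries (Matrix (Idx2 N) (Idx2 N) A) :=
  PowerSeries.map embHom₂.toRingHom F

theorem coeff_s₁ (F : PowerSeries (Matrix (Fin N) (Fin N) A)) (k : ℕ) :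
    coeff k (s₁ F) = emb₁ (coeff k F) := PowerSeries.coeff_map _ _ _

theorem coeff_s₂ (F : PowerSeries (Matrix (Fin N) (Fin N) A)) (k : ℕ) :
    coeff k (s₂ F) = emb₂ (coeff k F) := PowerSeries.coeff_map _ _ _

theorem coeff_transpSer (F : PowerSeries (Matrix (Fin N) (Fin N) A)) (k : ℕ) :
    coeff k (transpSer F) = (coeff k F).transpose := PowerSeries.coeff_mk _ _

section Transposes

variable (X Y : Matrix (Fin N) (Fin N) A)

theorem transp₁_mul : transp₁ (emb₁ X * emb₂ Y) = emb₁ X.transpose * emb₂ Y := by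
  ext a b
  simp [transp₁, emb₁_mul_emb₂_apply]

theorem transp₁_mul' : transp₁ (emb₂ Y * emb₁ X) = emb₂ Y * emb₁ X.transpose := by
  ext a b
  simp [transp₁, emb₂_mul_emb₁_apply]

theorem transp₁_perm_mul : transp₁ (perm A * (emb₁ X * emb₂ Y)) =
    emb₁ X.transpose * qop N A * emb₂ Y := by
  ext a b
  rw [transp₁, Matrix.of_apply, perm_mul_apply, emb₁_mul_emb₂_apply, mul_emb₂_apply]
  simp [emb₁_mul_apply, qop_apply, ite_and]

theorem transp₁_mul_perm : transp₁ (emb₂ Y * emb₁ X * perm A) =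
    emb₂ Y * qop N A * emb₁ X.transpose := by
  ext a b
  rw [transp₁, Matrix.of_apply, mul_perm_apply, emb₂_mul_emb₁_apply, mul_emb₁_apply]
  simp [emb₂_mul_apply, qop_apply, ite_and]

theorem transpose_emb_mul : (emb₁ X * emb₂ Y).transpose = emb₁ X.transpose * emb₂ Y.transpose := by
  ext a b
  simp [emb₁_mul_emb₂_apply]

theorem transpose_perm_mul (Z : Matrix (Idx2 N) (Idx2 N) A) :
    (perm A * Z).transpose = Z.transpose * perm A := by
  ext a b
  rw [mul_perm_apply, Matrix.transpose_apply, Matrix.transpose_apply, perm_mul_apply]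

theorem transpose_mul_perm (Z : Matrix (Idx2 N) (Idx2 N) A) :
    (Z * perm A).transpose = perm A * Z.transpose := by
  ext a b
  rw [perm_mul_apply, Matrix.transpose_apply, Matrix.transpose_apply, mul_perm_apply]

end Transposes

variable (F G : PowerSeries (Matrix (Fin N) (Fin N) A))

theorem mapCoeff_transp₁_mul :
    mapCoeff transpLin₁ (s₁ F * s₂ G) = s₁ (transpSer F) * s₂ G := by
  ext1 k
  rw [mapCoeff, PowerSeries.coeff_mk, PowerSeries.coeff_mul, PowerSeries.coeff_mul, map_sum]
  exact Finset.sum_congr rfl fun ij _ => by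
    rw [coeff_s₁, coeff_s₂, coeff_s₁, coeff_transpSer]; exact transp₁_mul _ _

theorem mapCoeff_transp₁_mul' :
    mapCoeff transpLin₁ (s₂ G * s₁ F) = s₂ G * s₁ (transpSer F) := by
  ext1 k
  rw [mapCoeff, PowerSeries.coeff_mk, PowerSeries.coeff_mul, PowerSeries.coeff_mul, map_sum]
  exact Finset.sum_congr rfl fun ij _ => by
    rw [coeff_s₁, coeff_s₂, coeff_s₁, coeff_transpSer]; exact transp₁_mul' _ _

theorem mapCoeff_transp₁_perm_mul :
    mapCoeff transpLin₁ (C (perm A) * (s₁ F * s₂ G)) = s₁ (transpSer F) * C (qop N A) * s₂ G := by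
  ext1 k
  rw [mapCoeff, PowerSeries.coeff_mk, PowerSeries.coeff_C_mul, PowerSeries.coeff_mul,
    PowerSeries.coeff_mul, Finset.mul_sum, map_sum]
  refine Finset.sum_congr rfl fun ij _ => ?_
  rw [PowerSeries.coeff_mul_C, coeff_s₁, coeff_s₂, coeff_s₁, coeff_transpSer]
  exact transp₁_perm_mul _ _

theorem mapCoeff_transp₁_mul_perm :
    mapCoeff transpLin₁ (s₂ G * s₁ F * C (perm A)) = s₂ G * C (qop N A) * s₁ (transpSer F) := by
  ext1 k
  rw [mapCoeff, PowerSeries.coeff_mk, PowerSeries.coeff_mul_C, PowerSeries.coeff_mul,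
    PowerSeries.coeff_mul, Finset.sum_mul, map_sum]
  refine Finset.sum_congr rfl fun ij _ => ?_
  rw [PowerSeries.coeff_mul_C, coeff_s₁, coeff_s₂, coeff_s₁, coeff_transpSer]
  exact transp₁_mul_perm _ _

variable {c : ℂ} {t : Gen N → A} {n : ℕ}

/-- The permutation of the tensor factors `i` and `j`, as a constant series. -/
def cperm (i j : ι) : PowerSeries (Matrix (ι → Fin N) (ι → Fin N) A) :=
  C (permMat A (Equiv.swap i j))

/-- The hypothesis is `(1 - P) xy = yx (1 - P)`, and `(1 - P)(1 + P) = 0`. -/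
theorem anti_of_commutator {B : Type*} [Ring B] {P x y : B} (hP : P * P = 1)
    (hxy : x * y - y * x = P * (x * y) - y * x * P) : Anti P (x * y) := by
  have h1 : (1 - P) * (x * y) = y * x * (1 - P) := by
    rw [sub_mul, mul_sub, one_mul, mul_one, sub_eq_sub_iff_sub_eq_sub, hxy]
  rw [Anti, h1, mul_assoc, mul_add, sub_mul, sub_mul, hP]
  simp

theorem perm_mul_emb_coeff (p : ℕ) : perm A * coeff p (s₁ F) = coeff p (s₂ F) * perm A :=
  perm_mul_emb₁ _

/-- The arguments differ by `h`, where the `R`-matrix degenerates to `1 - P`. -/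
theorem anti_TPlus (hA : NilH n A) (hrel : relationSeries c t 1 = 0) {z₁ z₂ : PowerSeries Rh}
    (h₁ : Filt 1 z₁) (h₂ : Filt 1 z₂) (hz : z₁ - z₂ = C h) {i j : ι} (hij : i ≠ j) :
    Anti (cperm i j) (atS i (sh n z₁ (TPlus t)) * atS j (sh n z₂ (TPlus t))) := by
  have h1 := commutator_of_sub_eq (hA.matrix (Idx2 N)) eq_zero_of_add_self h₁ h₂ (ε := 1)
    (one_mul 1) (by rw [one_mul, hz]) perm_mul_perm (perm_mul_emb_coeff (TPlus t))
    (relation_plus hrel)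
  rw [one_smul, sh_map, sh_map] at h1
  have h2 := anti_of_commutator (by rw [← map_mul, perm_mul_perm, map_one]) h1
  have h3 := congrArg (atS₂ i j hij) h2
  simp only [map_mul, map_sub, map_add, map_one, map_zero, atS₂_C, at₂_perm] at h3
  erw [atS₂_map_emb₁, atS₂_map_emb₂] at h3
  exact h3

/-- The difference of arguments is now `-h` and `R(-h) = 1 + P`, so the untransposed product
satisfies `(1 + P) xy (1 - P) = 0`. Transposing both factors reverses the positions of `1 + P` and
`1 - P`, but not the order of the entries of `x` and `y`. -/
theorem anti_transpose_TPlus (hA : NilH n A) (hrel : relationSeries c t 1 = 0)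
    {z₁ z₂ : PowerSeries Rh} (h₁ : Filt 1 z₁) (h₂ : Filt 1 z₂) (hz : z₂ - z₁ = C h) {i j : ι}
    (hij : i ≠ j) :
    Anti (cperm i j)
      (atS i (transpSer (sh n z₁ (TPlus t))) * atS j (transpSer (sh n z₂ (TPlus t)))) := by
  have h1 := commutator_of_sub_eq (hA.matrix (Idx2 N)) eq_zero_of_add_self h₁ h₂ (ε := -1)
    (by ring) (by rw [← neg_sub, hz]; simp) perm_mul_perm (perm_mul_emb_coeff (TPlus t))
    (relation_plus hrel)
  rw [neg_smul, one_smul, sh_map, sh_map, ← neg_one_mul, mul_sub, ← mul_assoc (-1 : PowerSeries _),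
    ← mul_neg_one, ← mul_neg_one] at h1
  set x := PowerSeries.map (embHom₁ : Matrix (Fin N) (Fin N) A →ₐ[Rh] _).toRingHom
    (sh n z₁ (TPlus t))
  set y := PowerSeries.map (embHom₂ : Matrix (Fin N) (Fin N) A →ₐ[Rh] _).toRingHom
    (sh n z₂ (TPlus t))
  have h2 : Anti (-C (perm A)) (x * y) := by
    refine anti_of_commutator (by rw [neg_mul_neg, ← map_mul, perm_mul_perm, map_one]) ?_
    refine Eq.trans h1 ?_
    noncomm_ring
  have h3 : Anti (C (perm A)) (s₁ (transpSer (sh n z₁ (TPlus t))) *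
      s₂ (transpSer (sh n z₂ (TPlus t)))) := by
    rw [Anti] at h2 ⊢
    ext1 k
    have h4 := congrArg (coeff k) h2
    have e1 : ∀ Z : PowerSeries (Matrix (Idx2 N) (Idx2 N) A), (1 - -C (perm A)) * Z * (1 + -C (perm A)) =
      Z + C (perm A) * Z - Z * C (perm A) - C (perm A) * Z * C (perm A) := fun Z => by noncomm_ring
    have e2 : ∀ Z : PowerSeries (Matrix (Idx2 N) (Idx2 N) A), (1 - C (perm A)) * Z * (1 + C (perm A)) =
      Z + Z * C (perm A) - C (perm A) * Z - C (perm A) * Z * C (perm A) := fun Z => by noncomm_ring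
    rw [e1] at h4
    rw [e2]
    simp only [map_sub, map_add, PowerSeries.coeff_C_mul, PowerSeries.coeff_mul_C, map_zero] at h4 ⊢
    have h5 := congrArg Matrix.transpose h4
    rw [Matrix.transpose_sub, Matrix.transpose_sub, Matrix.transpose_add, transpose_mul_perm,
      transpose_mul_perm, transpose_perm_mul, Matrix.transpose_zero] at h5
    have e3 : (coeff k (x * y)).transpose = coeff k (s₁ (transpSer (sh n z₁ (TPlus t))) *
        s₂ (transpSer (sh n z₂ (TPlus t)))) := by
      rw [PowerSeries.coeff_mul, PowerSeries.coeff_mul, Matrix.transpose_sum]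
      exact Finset.sum_congr rfl fun ij _ => by
        rw [coeff_s₁ (transpSer _), coeff_s₂ (transpSer _), coeff_transpSer, coeff_transpSer]
        exact transpose_emb_mul _ _
    rw [e3] at h5
    rw [← mul_assoc] at h5
    exact h5
  have h6 := congrArg (atS₂ i j hij) h3
  simp only [map_mul, map_sub, map_add, map_one, map_zero, atS₂_C, at₂_perm] at h6
  erw [atS₂_map_emb₁, atS₂_map_emb₂] at h6
  exact h6

/-- Partial transposition in the first factor turns `P` into `Q` and keeps the order of the
noncommuting entries. The difference `z₁ - z₂` is left in place: at `-u_a - u_b` it becomes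
invertible among Laurent series. -/
theorem transpose_commutator (hA : NilH n A) (hrel : relationSeries c t 1 = 0)
    {z₁ z₂ : PowerSeries Rh} (h₁ : Filt 1 z₁) (h₂ : Filt 1 z₂) {i j : ι} (hij : i ≠ j) :
    scal _ (z₁ - z₂) * (atS i (transpSer (sh n z₁ (TPlus t))) * atS j (sh n z₂ (TPlus t))
        - atS j (sh n z₂ (TPlus t)) * atS i (transpSer (sh n z₁ (TPlus t)))) =
      h • (atS i (transpSer (sh n z₁ (TPlus t))) * C (at₂ i j hij (qop N A)) *
          atS j (sh n z₂ (TPlus t))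
        - atS j (sh n z₂ (TPlus t)) * C (at₂ i j hij (qop N A)) *
          atS i (transpSer (sh n z₁ (TPlus t)))) := by
  have h1 := scal_sub_mul_commutator (hA.matrix (Idx2 N)) h₁ h₂ (relation_plus hrel)
  rw [sh_map, sh_map, ← map_sub] at h1
  have h2 := congrArg (mapCoeff transpLin₁) h1
  rw [mapCoeff_scal_mul, mapCoeff_smul, mapCoeff_sub, mapCoeff_sub] at h2
  erw [mapCoeff_transp₁_mul, mapCoeff_transp₁_mul', mapCoeff_transp₁_perm_mul,
    mapCoeff_transp₁_mul_perm] at h2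
  have h3 := congrArg (atS₂ i j hij) h2
  have e1 : ∀ (z : PowerSeries Rh) (Z : PowerSeries (Matrix (Idx2 N) (Idx2 N) A)),
      atS₂ i j hij (scal _ z * Z) = scal _ z * atS₂ i j hij Z := by
    intro z Z
    rw [map_mul]
    congr 1
    ext1 k
    exact (at₂ i j hij).commutes _
  have e2 : ∀ (r : Rh) (Z : PowerSeries (Matrix (Idx2 N) (Idx2 N) A)),
      atS₂ i j hij (r • Z) = r • atS₂ i j hij Z := by
    intro r Z
    ext1 k
    exact map_smul (at₂ i j hij : Matrix (Idx2 N) (Idx2 N) A →ₐ[Rh] _) r (coeff k Z)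
  rw [e1, e2] at h3
  simp only [map_mul, map_sub, atS₂_C] at h3
  erw [atS₂_map_emb₁, atS₂_map_emb₂] at h3
  rw [map_sub]
  exact h3

end Sites

end TwistedYangian

namespace TwistedYangian

open PowerSeries (C X coeff mk constantCoeff)

/-! ### Fusion of the normalized `R`-matrices with the anti-symmetrizer -/

/-- The coefficients are universal polynomials over `ℂ` in `η` and `β`, so they can be compared in
any common target of the two base rings. -/
theorem map_coeff_gam {S S' R : Type*} [CommRing S] [CommRing S'] [Algebra ℂ S] [Algebra ℂ S']
    [Ring R] {N : ℕ} {α : ℂ} (hα : α ≠ 0) {η β : S} {η' β' : S'} (f : S →+* R) (g : S' →+* R)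
    (h0 : ∀ x : ℂ, f (algebraMap ℂ S x) = g (algebraMap ℂ S' x)) (hη : f η = g η')
    (hβ : f β = g β') (m : ℕ) :
    f (coeff m (gam N η α β)) = g (coeff m (gam N η' α β')) ∧
    f (coeff m (C η * rho α β * gam N η α β)) = g (coeff m (C η' * rho α β' * gam N η' α β')) := by
  have h1 : ∀ p m, f (coeff m (rho α β ^ p)) = g (coeff m (rho α β' ^ p)) := by
    intro p m
    rw [coeff_rho_pow hα, coeff_rho_pow hα]
    split_ifs
    · rw [map_mul, map_mul, map_mul, map_mul, map_intCast, map_intCast, h0, map_pow f, map_pow g β', hβ]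
    · rw [map_zero, map_zero]
  constructor
  · rw [coeff_gam hα, coeff_gam hα, map_sum, map_sum]
    refine Finset.sum_congr rfl fun p _ => ?_
    rw [map_mul, map_mul, map_mul, map_mul, h0, h1, map_pow f, map_pow g η', hη]
  · rw [coeff_rho_mul_gam hα, coeff_rho_mul_gam hα, map_sum, map_sum]
    refine Finset.sum_congr rfl fun p _ => ?_
    rw [map_mul, map_mul, map_mul, map_mul, h0, h1, map_pow f, map_pow g η', hη]

/-- The scalar series in two variables. -/
def scal2 (B : Type*) [Ring B] [Algebra Rh B] :
    PowerSeries (PowerSeries Rh) →+* PowerSeries (PowerSeries B) :=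
  PowerSeries.map (scal B)

theorem scal2_commute {B : Type*} [Ring B] [Algebra Rh B] (z : PowerSeries (PowerSeries Rh))
    (F : PowerSeries (PowerSeries B)) : scal2 B z * F = F * scal2 B z := by
  ext1 k
  rw [PowerSeries.coeff_mul, PowerSeries.coeff_mul, ← Finset.Nat.sum_antidiagonal_swap]
  refine Finset.sum_congr rfl fun ij _ => ?_
  rw [scal2, PowerSeries.coeff_map, scal_commute]
  rfl

/-- The series in two variables as an algebra over the scalar series. -/
abbrev algebraScal2 (B : Type*) [Ring B] [Algebra Rh B] :
    Algebra (PowerSeries (PowerSeries Rh)) (PowerSeries (PowerSeries B)) :=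
  (scal2 B).toAlgebra' scal2_commute

/-- The permutation `P_{0i}`. -/
def perm₀ (N : ℕ) (A : Type*) [Ring A] [Algebra Rh A] (i : Fin N) :
    Matrix (Option (Fin N) → Fin N) (Option (Fin N) → Fin N) A :=
  at₂ none (some i) (by simp) (perm A)

section Fusion

variable {N : ℕ} {A : Type*} [Ring A] [Algebra Rh A]

theorem perm₀_mul_perm₀ {i j : Fin N} (hij : i ≠ j) :
    perm₀ N A i * perm₀ N A j = at₂ (some i) (some j) (by simpa using hij) (perm A) * perm₀ N A i := by
  rw [perm₀, perm₀, at₂_perm, at₂_perm, at₂_perm, permMat_mul, permMat_mul,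
    Equiv.mul_swap_eq_swap_mul, Equiv.swap_apply_left, Equiv.swap_apply_of_ne_of_ne] <;>
  simp [hij.symm]

theorem perm₀_mul_perm₀' {i j : Fin N} (hij : i ≠ j) :
    perm₀ N A i * perm₀ N A j = perm₀ N A j * at₂ (some i) (some j) (by simpa using hij) (perm A) := by
  rw [perm₀, perm₀, at₂_perm, at₂_perm, at₂_perm, permMat_mul, permMat_mul,
    Equiv.swap_mul_eq_mul_swap, Equiv.swap_inv, Equiv.swap_apply_left,
    Equiv.swap_apply_of_ne_of_ne, Equiv.swap_comm (some j)] <;>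
  simp [hij]

/-- The antisymmetrizer as a constant series in two variables. -/
def asym₂ (N : ℕ) (A : Type*) [Ring A] [Algebra Rh A] :
    PowerSeries (PowerSeries (Matrix (Option (Fin N) → Fin N) (Option (Fin N) → Fin N) A)) :=
  C (C (asym' N A))

/-- The normalized `R`-matrix `R̄_{0i}(u + β)`. -/
def rbar₀ (N : ℕ) (A : Type*) [Ring A] [Algebra Rh A] (i : Fin N) (β : PowerSeries Rh) :
    PowerSeries (PowerSeries (Matrix (Option (Fin N) → Fin N) (Option (Fin N) → Fin N) A)) :=
  scal2 _ (gam N (C h) 1 β) * (1 - scal2 _ (C (C h) * rho 1 β) * C (C (perm₀ N A i)))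

theorem isChain_finRange (N : ℕ) : (List.finRange N).IsChain fun i j : Fin N => (j : ℕ) = i + 1 := by
  rw [List.isChain_iff_getElem]
  intro i hi
  simp

/-- `A P_{0i} P_{0j} = A P_{ij} P_{0i} = -A P_{0i}`, so fusion reduces the product to `A (1 - a₀ ∑
P_{0i}) = (1 - a₀) A` with `a₀ = h/(u + β)`, and the factors `g` cancel `1 - a₀`. The arguments must
increase by `h` for the chain condition to hold. -/
theorem asym₂_mul_prod_rbar₀ (hN : N ≠ 0) (β : PowerSeries Rh) :
    asym₂ N A * ((List.finRange N).reverse.map fun i => rbar₀ N A i (β + ((i : ℕ) : PowerSeries Rh) * C h)).prod =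
      asym₂ N A := by
  obtain ⟨N, rfl⟩ := Nat.exists_eq_succ_of_ne_zero hN
  let _ := algebraScal2 (Matrix (Option (Fin N.succ) → Fin N.succ) (Option (Fin N.succ) → Fin N.succ) A)
  set a : Fin N.succ → PowerSeries (PowerSeries Rh) :=
    fun i => C (C h) * rho 1 (β + ((i : ℕ) : PowerSeries Rh) * C h) with ha
  set γ : Fin N.succ → PowerSeries (PowerSeries Rh) :=
    fun i => gam N.succ (C h) 1 (β + ((i : ℕ) : PowerSeries Rh) * C h) with hγ
  have e1 : (fun i => rbar₀ N.succ A i (β + ((i : ℕ) : PowerSeries Rh) * C h)) =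
      fun i => γ i • (1 - a i • C (C (perm₀ N.succ A i))) := rfl
  have hfin : List.finRange N.succ = 0 :: (List.finRange N).map Fin.succ := List.finRange_succ
  have h1 := mul_prod_one_sub_smul (E := asym₂ N.succ A) (p := fun i => C (C (perm₀ N.succ A i)))
    (a := a) (fun i j hij => by
      simp only [asym₂, ← map_mul, ← map_neg]
      rw [mul_assoc, perm₀_mul_perm₀ hij, ← mul_assoc, asym'_mul_at₂_perm hij, neg_mul])
    0 ((List.finRange N).map Fin.succ) (hfin ▸ List.nodup_finRange _) (hfin ▸
      (isChain_finRange _).imp fun i j hij => by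
        simp only [ha, hij]
        rw [show β + ((i + 1 : ℕ) : PowerSeries Rh) * C h = β + ((i : ℕ) : PowerSeries Rh) * C h + C h by
          push_cast; ring]
        exact rho_shift _ _)
  rw [← hfin] at h1
  have h2 : asym₂ N.succ A * ((List.finRange N.succ).map fun i => C (C (perm₀ N.succ A i))).sum =
      asym₂ N.succ A := by
    rw [← Fin.sum_univ_def, asym₂, ← map_sum, ← map_sum, ← map_mul, ← map_mul]
    congr 2
    exact asym'_mul_sum_perm
  have h3 : ((List.finRange N.succ).reverse.map γ).prod * (1 - a 0) = 1 := by
    rw [List.map_reverse, List.prod_reverse, ← Fin.prod_univ_def, Fin.prod_univ_eq_prod_range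
      (fun i => gam N.succ (C h) 1 (β + ((i : ℕ) : PowerSeries Rh) * C h))]
    have := prod_gam_mul (N := N.succ) hN (C h) β
    simpa [ha] using this
  rw [e1, prod_map_smul, mul_smul_comm, h1, h2, ← one_smul (PowerSeries (PowerSeries Rh)) (asym₂ N.succ A),
    smul_smul, ← sub_smul, mul_one, smul_smul, h3]

/-- With `A` on the right the arguments have to decrease by `h`. The surviving parameter belongs to
the last position, and reflecting the index set rewrites the product of the `g` as one with
increasing arguments. -/
theorem prod_rbar₀_mul_asym₂ (hN : N ≠ 0) (β : PowerSeries Rh) :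
    ((List.finRange N).reverse.map fun i => rbar₀ N A i (β - ((i : ℕ) : PowerSeries Rh) * C h)).prod * asym₂ N A =
      asym₂ N A := by
  obtain ⟨N, rfl⟩ := Nat.exists_eq_succ_of_ne_zero hN
  let _ := algebraScal2 (Matrix (Option (Fin N.succ) → Fin N.succ) (Option (Fin N.succ) → Fin N.succ) A)
  set a : Fin N.succ → PowerSeries (PowerSeries Rh) :=
    fun i => C (C h) * rho 1 (β - ((i : ℕ) : PowerSeries Rh) * C h) with ha
  set γ : Fin N.succ → PowerSeries (PowerSeries Rh) :=
    fun i => gam N.succ (C h) 1 (β - ((i : ℕ) : PowerSeries Rh) * C h) with hγ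
  have e1 : (fun i => rbar₀ N.succ A i (β - ((i : ℕ) : PowerSeries Rh) * C h)) =
      fun i => γ i • (1 - a i • C (C (perm₀ N.succ A i))) := rfl
  have hfin : (List.finRange N.succ).reverse =
      Fin.last N :: ((List.finRange N).map Fin.castSucc).reverse := by
    rw [List.finRange_succ_last, List.reverse_append]; rfl
  have h1 := prod_one_sub_smul_mul (E := asym₂ N.succ A) (p := fun i => C (C (perm₀ N.succ A i)))
    (a := a) (fun i j hij => by
      simp only [asym₂, ← map_mul, ← map_neg]
      rw [perm₀_mul_perm₀' hij, mul_assoc, at₂_perm_mul_asym' hij, mul_neg])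
    (Fin.last N) _ (hfin ▸ List.nodup_reverse.2 (List.nodup_finRange _)) (hfin ▸
      List.isChain_reverse.2 ((isChain_finRange _).imp fun j i hij => by
        simp only [ha, hij]
        rw [show β - ((j : ℕ) : PowerSeries Rh) * C h = β - ((j + 1 : ℕ) : PowerSeries Rh) * C h + C h by
          push_cast; ring]
        exact rho_shift _ _))
  rw [← hfin] at h1
  have h2 : ((List.finRange N.succ).reverse.map fun i => C (C (perm₀ N.succ A i))).sum * asym₂ N.succ A =
      asym₂ N.succ A := by
    rw [List.map_reverse, List.sum_reverse, ← Fin.sum_univ_def, asym₂, ← map_sum, ← map_sum, ← map_mul, ← map_mul]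
    congr 2
    exact sum_perm_mul_asym'
  have h3 : ((List.finRange N.succ).reverse.map γ).prod * (1 - a (Fin.last N)) = 1 := by
    rw [List.map_reverse, List.prod_reverse, ← Fin.prod_univ_def, Fin.prod_univ_eq_prod_range
      (fun i => gam N.succ (C h) 1 (β - ((i : ℕ) : PowerSeries Rh) * C h)), ← Finset.prod_range_reflect]
    have := prod_gam_mul (N := N.succ) hN (C h) (β - ((N : ℕ) : PowerSeries Rh) * C h)
    refine (congrArg (· * _) (Finset.prod_congr rfl fun i hi => ?_)).trans this
    refine congrArg (gam N.succ (C h) 1) ?_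
    have : i ≤ N := by simpa [Nat.lt_succ_iff] using hi
    rw [show N.succ - 1 - i = N - i by omega, Nat.cast_sub this]
    ring
  rw [e1, prod_map_smul, smul_mul_assoc, h1, h2, ← one_smul (PowerSeries (PowerSeries Rh)) (asym₂ N.succ A),
    smul_smul, ← sub_smul, mul_one, smul_smul, h3]

end Fusion

end TwistedYangian

namespace TwistedYangian

open PowerSeries (C X coeff mk constantCoeff)

/-! ### Commutation of `T(v)` with the fused products of `T⁺` -/

section Transport

variable {N : ℕ} {A : Type*} [Ring A] [Algebra Rh A] {n : ℕ}

theorem algebraMap_complex (x : ℂ) : algebraMap ℂ (PowerSeries Rh) x = C (C x) := by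
  rw [PowerSeries.algebraMap_apply, PowerSeries.algebraMap_apply]; rfl

theorem coeff_RbarSer (κ : Rh) (m : ℕ) :
    coeff m (RbarSer κ : Ser2 N A) =
      scal _ (coeff m (gam N (C h) 1 (C κ - X))) -
        scal _ (coeff m (C (C h) * rho 1 (C κ - X) * gam N (C h) 1 (C κ - X))) * C (perm A) := by
  rw [RbarSer, PowerSeries.coeff_mk, sum_rho_smul_Rbar one_ne_zero (C h : PowerSeries Rh)
    (C κ - X) (fun p => (Rbar N p).map PowerSeries.C) (perm (PowerSeries Rh))]
  · ext b a a'
    rw [map_sub, PowerSeries.coeff_mul_C, PowerSeries.coeff_mk, scal, PowerSeries.coeff_map,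
      PowerSeries.coeff_map, ← Algebra.smul_def, Algebra.algebraMap_eq_smul_one]
    simp only [Matrix.map_apply, Matrix.sub_apply, Matrix.smul_apply, smul_eq_mul, Matrix.one_apply,
      perm, Matrix.of_apply, mul_ite, mul_one, mul_zero, map_sub]
    split_ifs <;> simp [Algebra.algebraMap_eq_smul_one]
  · ext a a'
    simp only [Rbar, Matrix.map_apply, Matrix.one_apply]
    split_ifs <;> simp
  · intro p
    ext1 a a'
    simp only [Rbar, Matrix.map_apply, Matrix.smul_apply, Matrix.sub_apply, smul_eq_mul, map_mul,
      map_sub, map_pow, Matrix.one_apply, perm, Matrix.of_apply]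
    congr 2
    · split_ifs <;> simp [algebraMap_complex]
    · split_ifs <;> simp [algebraMap_complex]

/-- `T_0(u)` in the outer variable `u⁻¹`. -/
def ser₀ (F : PowerSeries (Matrix (Fin N) (Fin N) A)) :
    PowerSeries (PowerSeries (Matrix (Option (Fin N) → Fin N) (Option (Fin N) → Fin N) A)) :=
  mk fun m => C (at₁ none (coeff m F))

/-- The substitution `v = z` on the tensor factors `0` and `i`. -/
def transport (hA : NilH n A) {z : PowerSeries Rh} (hz : Filt 1 z) (i : Fin N) :
    Ser2 N A →+* PowerSeries (PowerSeries (Matrix (Option (Fin N) → Fin N) (Option (Fin N) → Fin N) A)) :=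
  PowerSeries.map ((atS₂ none (some i) (by simp)).comp (shHom (hA.matrix (Idx2 N)) hz))

theorem coeff_transport (hA : NilH n A) {z : PowerSeries Rh} (hz : Filt 1 z) (i : Fin N)
    (F : Ser2 N A) (m : ℕ) : coeff m (transport hA hz i F) =
      atS₂ none (some i) (by simp) (sh n z (coeff m F)) := by
  rw [transport, PowerSeries.coeff_map]; rfl

theorem transport_first (hA : NilH n A) {z : PowerSeries Rh} (hz : Filt 1 z) (i : Fin N)
    (F : PowerSeries (Matrix (Fin N) (Fin N) A)) : transport hA hz i (first F) = ser₀ F := by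
  ext1 m
  rw [coeff_transport, first, PowerSeries.coeff_mk, sh_C (hA.matrix _) hz, atS₂_C, ser₀,
    PowerSeries.coeff_mk, at₂_emb₁]

theorem transport_second (hA : NilH n A) {z : PowerSeries Rh} (hz : Filt 1 z) (i : Fin N)
    (F : PowerSeries (Matrix (Fin N) (Fin N) A)) :
    transport hA hz i (second F) = C (atS (some i) (sh n z F)) := by
  have h1 : (mk fun m => emb₂ (coeff m F)) = PowerSeries.map embHom₂.toRingHom F := by
    ext1 m; rw [PowerSeries.coeff_mk, PowerSeries.coeff_map]; rfl
  rw [second, transport, PowerSeries.map_C, RingHom.comp_apply, shHom_apply, h1, sh_map, atS₂_map_emb₂]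

theorem atS₂_scal {ι : Type*} [Fintype ι] [DecidableEq ι] {i j : ι} (hij : i ≠ j)
    (z : PowerSeries Rh) :
    atS₂ (N := N) (A := A) i j hij (scal _ z) = scal _ z := by
  ext1 k
  rw [atS₂, PowerSeries.coeff_map, scal, PowerSeries.coeff_map, scal, PowerSeries.coeff_map]
  exact (at₂ i j hij).commutes _

/-- The coefficients of `R̄` are polynomials in `κ - v`, and the substitution is a ring homomorphism
taking `v` to `z`. -/
theorem transport_RbarSer (hA : NilH n A) {z : PowerSeries Rh} (hz : Filt 1 z) (i : Fin N)
    (κ : Rh) : transport hA hz i (RbarSer κ) = rbar₀ N A i (C κ - z) := by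
  ext1 m
  have hs : ∀ x : Rh, shHom (hA.matrix (Idx2 N)) hz (scal _ (C x)) = scal _ (C x) := by
    intro x
    rw [scal, PowerSeries.map_C, shHom_apply, sh_C (hA.matrix _) hz]
  have hk := map_coeff_gam (N := N) (η := C h) (η' := C h) (β := C κ - X) (β' := C κ - z) one_ne_zero
    ((shHom (hA.matrix (Idx2 N)) hz).comp (scal _)) (scal _)
    (fun x => by
      rw [RingHom.comp_apply, algebraMap_complex]
      exact hs (C x))
    (by rw [RingHom.comp_apply, hs])
    (by
      rw [RingHom.comp_apply, map_sub, map_sub, map_sub, hs]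
      congr 1
      rw [scal, PowerSeries.map_X, shHom_apply, sh_X (hA.matrix _) hz]
      rfl) m
  rw [coeff_transport, coeff_RbarSer, ← shHom_apply (hA.matrix _) hz, map_sub, map_mul]
  rw [RingHom.comp_apply] at hk
  rw [RingHom.comp_apply] at hk
  rw [hk.1, hk.2, shHom_apply (hA.matrix _) hz (C _), sh_C (hA.matrix _) hz, map_sub, map_mul,
    atS₂_scal, atS₂_scal, atS₂_C]
  rw [rbar₀, mul_sub, mul_one, ← mul_assoc, ← map_mul, map_sub, PowerSeries.coeff_mul_C, scal2,
    PowerSeries.coeff_map, PowerSeries.coeff_map, mul_comm (gam _ _ _ _)]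
  rfl

theorem transport_relation (hA : NilH n A) {c : ℂ} {t : Gen N → A} (hrel : relationSeries c t 2 = 0)
    {z : PowerSeries Rh} (hz : Filt 1 z) (i : Fin N) :
    rbar₀ N A i (C (h * C (c / 2)) - z) * ser₀ (T t) * C (atS (some i) (sh n z (TPlus t))) =
      C (atS (some i) (sh n z (TPlus t))) * ser₀ (T t) * rbar₀ N A i (C (-(h * C (c / 2))) - z) := by
  have h1 := congrArg (transport hA hz i) hrel
  simp only [relationSeries, map_sub, map_mul, transport_first, transport_second, map_zero] at h1
  rw [transport_RbarSer, transport_RbarSer, sub_eq_zero] at h1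
  exact h1

theorem rbar₀_commute {i : Fin N} (β : PowerSeries Rh) {j : Fin N} (hij : i ≠ j)
    (F : PowerSeries (Matrix (Fin N) (Fin N) A)) :
    Commute (rbar₀ N A i β) (C (atS (some j) F)) := by
  have hc : ∀ z, Commute (scal2 _ z) (C (atS (some j) F)) := fun z => scal2_commute z _
  refine (hc _).mul_left ((Commute.one_left _).sub_left ((hc _).mul_left ?_))
  refine Commute.map (?_ : Commute (C (perm₀ N A i)) (atS (some j) F)) C
  refine PowerSeries.ext fun k => ?_
  rw [PowerSeries.coeff_C_mul, PowerSeries.coeff_mul_C, atS, PowerSeries.coeff_map]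
  refine (at₂_commute_at₁ _ (by simp) (by simpa using hij.symm) ?_).eq
  intro a b c d
  rw [perm, Matrix.of_apply]
  split_ifs
  · exact Commute.one_left _
  · exact Commute.zero_left _

theorem asym₂_commute (F : PowerSeries (Matrix (Fin N) (Fin N) A)) :
    Commute (asym₂ N A) (ser₀ F) := by
  ext m : 1
  rw [asym₂, PowerSeries.coeff_C_mul, PowerSeries.coeff_mul_C, ser₀, PowerSeries.coeff_mk, ← map_mul, ← map_mul]
  congr 1
  rw [asym', at₁_def]
  refine (tens_commute (Option.some_injective _) (Function.injective_of_subsingleton _) ?_ ?_).eq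
  · simp [Set.disjoint_left]
  · intro a b c d
    exact Algebra.commutes _ _

/-- The product `∏ᵢ T_i(z_i)`. -/
def prodT (n : ℕ) {ι : Type*} [Fintype ι] [DecidableEq ι] (e : Fin N → ι) (F : PowerSeries (Matrix (Fin N) (Fin N) A))
    (z : Fin N → PowerSeries Rh) : PowerSeries (Matrix (ι → Fin N) (ι → Fin N) A) :=
  ((List.finRange N).map fun i => atS (e i) (sh n (z i) F)).prod

/-- Moving `T_0(u)` through the product produces the `R̄_{0i}` with shift `hc/2` on the left and
`-hc/2` on the right. The antisymmetrizer absorbs the left ones at once, and the right ones after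
`hE` has supplied a second antisymmetrizer on that side. Fusion holds for any shift, so the two need
not agree. -/
theorem row_fused (hN : N ≠ 0) (hA : NilH n A) {c : ℂ} {t : Gen N → A} (hrel : relationSeries c t 2 = 0)
    (z₀ : PowerSeries Rh) (hz : ∀ i : Fin N, Filt 1 (z₀ - ((i : ℕ) : PowerSeries Rh) * C h))
    (hE : C (asym' N A) * prodT n some (TPlus t) (fun i => z₀ - ((i : ℕ) : PowerSeries Rh) * C h) =
      C (asym' N A) * prodT n some (TPlus t) (fun i => z₀ - ((i : ℕ) : PowerSeries Rh) * C h) *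
        C (asym' N A)) :
    Commute (ser₀ (T t))
      (C (C (asym' N A) * prodT n some (TPlus t) (fun i => z₀ - ((i : ℕ) : PowerSeries Rh) * C h))) := by
  set TT := prodT n some (TPlus t) (fun i => z₀ - ((i : ℕ) : PowerSeries Rh) * C h) with hTT
  have h1 := prod_reverse_mul_prod (t := ser₀ (T t))
    (T := fun i : Fin N => C (atS (some i) (sh n (z₀ - ((i : ℕ) : PowerSeries Rh) * C h) (TPlus t))))
    (R := fun i => rbar₀ N A i ((C (h * C (c / 2)) - z₀) + ((i : ℕ) : PowerSeries Rh) * C h))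
    (R' := fun i => rbar₀ N A i ((C (-(h * C (c / 2))) - z₀) + ((i : ℕ) : PowerSeries Rh) * C h))
    (fun i => by
      rw [sub_add, sub_add]
      exact transport_relation hA hrel (hz i) i)
    (fun i j hij => rbar₀_commute _ hij _) (fun i j hij => rbar₀_commute _ hij _)
    (List.finRange N) (List.nodup_finRange N)
  have hp : ((List.finRange N).map fun i : Fin N =>
      (C (atS (some i) (sh n (z₀ - ((i : ℕ) : PowerSeries Rh) * C h) (TPlus t))) :
        PowerSeries (PowerSeries _))).prod = C TT := by
    rw [hTT, prodT, map_list_prod, List.map_map]; rfl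
  rw [hp] at h1
  have hE2 : asym₂ N A * C TT = asym₂ N A * C TT * asym₂ N A := by
    rw [asym₂, ← map_mul, ← map_mul, ← hE]
  have hr := asym₂_mul_prod_rbar₀ (A := A) hN (C (h * C (c / 2)) - z₀)
  have hr' := asym₂_mul_prod_rbar₀ (A := A) hN (C (-(h * C (c / 2))) - z₀)
  have hc := asym₂_commute (T t)
  have h2 := congrArg (asym₂ N A * ·) h1
  simp only [← mul_assoc] at h2
  rw [hr, hE2, mul_assoc _ (asym₂ N A) (ser₀ _), hc.eq, ← mul_assoc, mul_assoc _ (asym₂ N A) (List.prod _), hr',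
    mul_assoc _ (ser₀ _) (asym₂ _ _), ← hc.eq, ← mul_assoc, ← hE2, hc.eq] at h2
  rw [map_mul]
  show ser₀ _ * (asym₂ N A * C TT) = asym₂ N A * C TT * ser₀ _
  rw [← mul_assoc, h2]

/-- The mirror image of `row_fused`: arguments increasing by `h`, the antisymmetrizer on the right.
-/
theorem col_fused (hN : N ≠ 0) (hA : NilH n A) {c : ℂ} {t : Gen N → A} (hrel : relationSeries c t 2 = 0)
    (z₀ : PowerSeries Rh) (hz : ∀ i : Fin N, Filt 1 (z₀ + ((i : ℕ) : PowerSeries Rh) * C h))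
    (hE : prodT n some (TPlus t) (fun i => z₀ + ((i : ℕ) : PowerSeries Rh) * C h) * C (asym' N A) =
      C (asym' N A) * prodT n some (TPlus t) (fun i => z₀ + ((i : ℕ) : PowerSeries Rh) * C h) *
        C (asym' N A)) :
    Commute (ser₀ (T t))
      (C (prodT n some (TPlus t) (fun i => z₀ + ((i : ℕ) : PowerSeries Rh) * C h) * C (asym' N A))) := by
  set TT := prodT n some (TPlus t) (fun i => z₀ + ((i : ℕ) : PowerSeries Rh) * C h) with hTT
  have h1 := prod_reverse_mul_prod (t := ser₀ (T t))
    (T := fun i : Fin N => C (atS (some i) (sh n (z₀ + ((i : ℕ) : PowerSeries Rh) * C h) (TPlus t))))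
    (R := fun i => rbar₀ N A i ((C (h * C (c / 2)) - z₀) - ((i : ℕ) : PowerSeries Rh) * C h))
    (R' := fun i => rbar₀ N A i ((C (-(h * C (c / 2))) - z₀) - ((i : ℕ) : PowerSeries Rh) * C h))
    (fun i => by
      rw [sub_sub, sub_sub]
      exact transport_relation hA hrel (hz i) i)
    (fun i j hij => rbar₀_commute _ hij _) (fun i j hij => rbar₀_commute _ hij _)
    (List.finRange N) (List.nodup_finRange N)
  have hp : ((List.finRange N).map fun i : Fin N =>
      (C (atS (some i) (sh n (z₀ + ((i : ℕ) : PowerSeries Rh) * C h) (TPlus t))) :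
        PowerSeries (PowerSeries _))).prod = C TT := by
    rw [hTT, prodT, map_list_prod, List.map_map]; rfl
  rw [hp] at h1
  have hE2 : C TT * asym₂ N A = asym₂ N A * C TT * asym₂ N A := by
    rw [asym₂, ← map_mul, ← map_mul, ← map_mul, ← hE]
  have hr := prod_rbar₀_mul_asym₂ (A := A) hN (C (h * C (c / 2)) - z₀)
  have hr' := prod_rbar₀_mul_asym₂ (A := A) hN (C (-(h * C (c / 2))) - z₀)
  have hc := asym₂_commute (T t)
  have h2 := congrArg (· * asym₂ N A) h1
  simp only [mul_assoc] at h2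
  rw [hr', hE2, ← hc.eq, mul_assoc (asym₂ N A) (C TT) (asym₂ N A), ← mul_assoc (ser₀ _) (asym₂ N A),
    ← hc.eq, mul_assoc (asym₂ N A) (ser₀ _), ← mul_assoc _ (asym₂ N A), hr, ← mul_assoc (asym₂ N A),
    hc.eq, mul_assoc, ← mul_assoc (asym₂ N A) (C TT), ← hE2] at h2
  rw [map_mul]
  show ser₀ _ * (C TT * asym₂ N A) = C TT * asym₂ N A * ser₀ _
  rw [h2, mul_assoc, hc.eq]

end Transport

end TwistedYangian

namespace TwistedYangian

open PowerSeries (C X coeff mk constantCoeff)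

/-! ### From adjacent transpositions to the antisymmetrizer; products of `T⁺` over all factors. -/

section Fused

variable {N : ℕ} {A : Type*} [Ring A] [Algebra Rh A] {n : ℕ}

/-- `T_0` and `Y` live on disjoint tensor factors, so their commutation can be read off entry by
entry. -/
theorem entry_commute_of_ser₀ {F : PowerSeries (Matrix (Fin N) (Fin N) A)}
    {Y : PowerSeries (Matrix (IdxN N) (IdxN N) A)}
    (hY : Commute (ser₀ F)
      (C (PowerSeries.map (tensHom some (Option.some_injective (Fin N))).toRingHom Y)))
    (m k : ℕ) (a b : Fin N) (I K : IdxN N) : Commute (coeff m F a b) (coeff k Y I K) := by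
  have h1 := congrArg (fun W => coeff k (coeff m W)) hY.eq
  simp only [ser₀, PowerSeries.coeff_mul_C, PowerSeries.coeff_C_mul, PowerSeries.coeff_mk,
    PowerSeries.coeff_map] at h1
  have hd : Disjoint (Set.range fun _ : Unit => (none : Option (Fin N))) (Set.range some) := by
    simp
  have h2 := congrFun (congrFun h1 (fun o => o.elim a I)) (fun o => o.elim b K)
  have h3 := tens_mul_tens_apply (Function.injective_of_subsingleton _) hd
    ((coeff m F).submatrix (fun I => I ()) (fun I => I ())) (coeff k Y)
    (fun o => o.elim a I) (fun o => o.elim b K)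
  have h4 := tens_mul_tens_apply (Option.some_injective _) hd.symm (coeff k Y)
    ((coeff m F).submatrix (fun I : Unit → Fin N => I ()) (fun I => I ()))
    (fun o => o.elim a I) (fun o => o.elim b K)
  rw [if_pos (by rintro (_ | l) h5 h6 <;> simp at h5 h6)] at h3 h4
  exact h3.symm.trans (h2.trans h4)

theorem map_tens_atS (i : Fin N) (F : PowerSeries (Matrix (Fin N) (Fin N) A)) :
    PowerSeries.map (tensHom some (Option.some_injective (Fin N))).toRingHom (atS i F) =
      atS (some i) F := by
  ext1 k
  rw [PowerSeries.coeff_map, atS, atS, PowerSeries.coeff_map, PowerSeries.coeff_map]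
  exact tens_at₁ (Option.some_injective _) _ _

theorem map_tens_prodT (F : PowerSeries (Matrix (Fin N) (Fin N) A)) (z : Fin N → PowerSeries Rh) :
    PowerSeries.map (tensHom some (Option.some_injective (Fin N))).toRingHom (prodT n id F z) =
      prodT n some F z := by
  rw [prodT, map_list_prod, List.map_map, prodT]
  congr 1
  exact List.map_congr_left fun i _ => map_tens_atS _ _

theorem map_tens_C_asym :
    PowerSeries.map (tensHom some (Option.some_injective (Fin N))).toRingHom (C (asym N A)) =
      C (asym' N A) := PowerSeries.map_C _ _

/-- Each adjacent transposition acts on `A X` from the right by `-1`; since these generate the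
symmetric group, every permutation acts by its sign, and averaging reproduces `A X`. -/
theorem asym_mul_of_anti {X : PowerSeries (Matrix (IdxN N) (IdxN N) A)}
    (hX : ∀ i j : Fin N, (j : ℕ) = i + 1 → Anti (cperm i j) X) :
    C (asym N A) * X = C (asym N A) * X * C (asym N A) := by
  have h2 : ∀ x : PowerSeries (Matrix (IdxN N) (IdxN N) A), x + x = 0 → x = 0 :=
    eq_zero_of_add_self
  ext1 k
  rw [PowerSeries.coeff_mul_C, PowerSeries.coeff_C_mul, mul_asym_of_sign]
  -- The generation statement concerns permutations of `N + 1` points; the trivial group of the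
  -- empty set is treated apart.
  rcases Nat.eq_zero_or_pos N with rfl | hN
  · intro σ
    rw [Subsingleton.elim σ 1, permMat_one, mul_one, Equiv.Perm.sign_one, Units.val_one, one_smul]
  obtain ⟨N, rfl⟩ := Nat.exists_eq_succ_of_ne_zero hN.ne'
  intro σ
  have hσ : σ ∈ Submonoid.closure (Set.range fun i : Fin N ↦ Equiv.swap i.castSucc i.succ) := by
    rw [Equiv.Perm.mclosure_swap_castSucc_succ]; trivial
  induction hσ using Submonoid.closure_induction with
  | mem σ hσ =>
    obtain ⟨i, rfl⟩ := hσ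
    have hE : C (asym N.succ A) * cperm i.castSucc i.succ = -C (asym N.succ A) := by
      rw [cperm, ← map_mul, asym_mul_permMat, Equiv.Perm.sign_swap (Fin.castSucc_lt_succ).ne, ← map_neg]
      simp
    have h3 := congrArg (coeff k) ((hX i.castSucc i.succ (by simp)).mul_eq_neg h2 hE)
    rw [cperm, PowerSeries.coeff_mul_C, PowerSeries.coeff_C_mul, map_neg, PowerSeries.coeff_C_mul] at h3
    rw [h3, Equiv.Perm.sign_swap (Fin.castSucc_lt_succ).ne]
    simp
  | one => rw [permMat_one, mul_one, Equiv.Perm.sign_one, Units.val_one, one_smul]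
  | mul σ τ _ _ h3 h4 =>
    rw [← permMat_mul, ← mul_assoc, h3, smul_mul_assoc, h4, smul_smul, map_mul, Units.val_mul]

theorem cperm_mul_self (i j : Fin N) :
    (cperm i j : PowerSeries (Matrix (IdxN N) (IdxN N) A)) * cperm i j = 1 := by
  rw [cperm, ← map_mul, permMat_mul, Equiv.swap_mul_self, permMat_one, map_one]

theorem cperm_commute_atS {i j a : Fin N} (hi : a ≠ i) (hj : a ≠ j)
    (F : PowerSeries (Matrix (Fin N) (Fin N) A)) : Commute (cperm i j) (atS a F) := by
  refine PowerSeries.ext fun k => ?_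
  rw [cperm, PowerSeries.coeff_C_mul, PowerSeries.coeff_mul_C, atS, PowerSeries.coeff_map]
  refine (permMat_mul_at₁ _ _ _).trans ?_
  rw [Equiv.swap_apply_of_ne_of_ne hi hj]
  rfl

theorem finRange_split {i j : Fin N} (hij : (j : ℕ) = i + 1) :
    ∃ l₁ l₂ : List (Fin N), List.finRange N = l₁ ++ i :: j :: l₂ := by
  refine ⟨(List.finRange N).take i, (List.finRange N).drop (i + 2), ?_⟩
  conv_lhs => rw [← List.take_append_drop i (List.finRange N)]
  congr 1
  rw [List.drop_eq_getElem_cons (by simp), List.drop_eq_getElem_cons (by simp [← hij])]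
  congr 1
  · simp
  · congr 1
    ext
    simp [hij]

theorem anti_of_split {B : Type*} [Ring B] {P : B} (h2 : ∀ x : B, x + x = 0 → x = 0) (hP : P * P = 1)
    {i j : Fin N} (hij : (j : ℕ) = i + 1) {f : Fin N → B} (hf : Anti P (f i * f j))
    (hc : ∀ a, a ≠ i → a ≠ j → Commute P (f a)) : Anti P ((List.finRange N).map f).prod := by
  obtain ⟨l₁, l₂, hl⟩ := finRange_split hij
  have hn := hl ▸ List.nodup_finRange N
  have hi : i ∉ l₁ ∧ i ∉ l₂ ∧ j ∉ l₁ ∧ j ∉ l₂ := by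
    rw [List.nodup_append'] at hn
    obtain ⟨-, h3, h4⟩ := hn
    have h5 := List.nodup_cons.1 h3
    have h6 := List.nodup_cons.1 h5.2
    exact ⟨fun h => h4 h (by simp), fun h => h5.1 (by simp [h]), fun h => h4 h (by simp), h6.1⟩
  have hcl : ∀ l : List (Fin N), i ∉ l → j ∉ l → Anti P (l.map f).prod := fun l h3 h4 =>
    Anti.of_commute hP (commute_list_prod fun b hb =>
      hc b (fun e => h3 (e ▸ hb)) (fun e => h4 (e ▸ hb)))
  rw [hl, List.map_append, List.prod_append, List.map_cons, List.map_cons, List.prod_cons,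
    List.prod_cons, ← mul_assoc (f i)]
  exact (hcl l₁ hi.1 hi.2.2.1).mul h2 (hf.mul h2 (hcl l₂ hi.2.1 hi.2.2.2))

variable {c : ℂ} {t : Gen N → A}

theorem anti_prodT (hA : NilH n A) (hrel : relationSeries c t 1 = 0) {z₀ : PowerSeries Rh}
    (hz : ∀ i : Fin N, Filt 1 (z₀ - ((i : ℕ) : PowerSeries Rh) * C h)) {i j : Fin N}
    (hij : (j : ℕ) = i + 1) :
    Anti (cperm i j) (prodT n id (TPlus t) fun i => z₀ - ((i : ℕ) : PowerSeries Rh) * C h) := by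
  refine anti_of_split eq_zero_of_add_self (cperm_mul_self i j) hij ?_
    fun a hi hj => cperm_commute_atS hi hj _
  refine anti_TPlus hA hrel (hz i) (hz j) ?_ ?_
  · rw [hij]; push_cast; ring
  · rintro rfl; omega

/-- The product `∏ᵢ T_i(z_i)ᵗ`. -/
def prodTt (n : ℕ) (F : PowerSeries (Matrix (Fin N) (Fin N) A))
    (z : Fin N → PowerSeries Rh) : PowerSeries (Matrix (IdxN N) (IdxN N) A) :=
  ((List.finRange N).map fun i => atS i (transpSer (sh n (z i) F))).prod

theorem anti_prodTt (hA : NilH n A) (hrel : relationSeries c t 1 = 0) {z₀ : PowerSeries Rh}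
    (hz : ∀ i : Fin N, Filt 1 (z₀ + ((i : ℕ) : PowerSeries Rh) * C h)) {i j : Fin N}
    (hij : (j : ℕ) = i + 1) :
    Anti (cperm i j) (prodTt n (TPlus t) fun i => z₀ + ((i : ℕ) : PowerSeries Rh) * C h) := by
  refine anti_of_split eq_zero_of_add_self (cperm_mul_self i j) hij ?_
    fun a hi hj => cperm_commute_atS hi hj _
  refine anti_transpose_TPlus hA hrel (hz i) (hz j) ?_ ?_
  · rw [hij]; push_cast; ring
  · rintro rfl; omega

end Fused

end TwistedYangian

namespace TwistedYangian

open PowerSeries (C X coeff mk constantCoeff)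

/-! ### Transposes of products over distinct tensor factors. -/

section Transposition

variable {N : ℕ} {A : Type*} [Ring A] [Algebra Rh A] {n : ℕ} {m : Type*} [Fintype m] [DecidableEq m]

/-- A series of matrices as a matrix of series. -/
def toMat : PowerSeries (Matrix m m A) →+* Matrix m m (PowerSeries A) where
  toFun F := Matrix.of fun I K => mk fun k => coeff k F I K
  map_one' := by
    ext I K k
    simp only [Matrix.of_apply, PowerSeries.coeff_mk, PowerSeries.coeff_one, Matrix.one_apply]
    split_ifs <;> simp_all [PowerSeries.coeff_one, Matrix.one_apply]
  map_mul' F G := by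
    ext I K k
    simp only [Matrix.of_apply, PowerSeries.coeff_mk, PowerSeries.coeff_mul, Matrix.mul_apply,
      Matrix.sum_apply, map_sum]
    exact Finset.sum_comm
  map_zero' := by ext I K k; simp
  map_add' F G := by ext I K k; simp

theorem coeff_toMat (F : PowerSeries (Matrix m m A)) (k : ℕ) (I K : m) :
    coeff k (toMat F I K) = coeff k F I K := by
  show coeff k (mk fun k => coeff k F I K) = _
  rw [PowerSeries.coeff_mk]

theorem at₁_mul_apply {ι : Type*} [Fintype ι] [DecidableEq ι] (i : ι)
    (X : Matrix (Fin N) (Fin N) A) (Y : Matrix (ι → Fin N) (ι → Fin N) A) (I K : ι → Fin N) :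
    (at₁ i X * Y) I K = ∑ a, X (I i) a * Y (Function.update I i a) K := by
  rw [at₁_def, tens_mul_apply (Function.injective_of_subsingleton _)]
  refine Fintype.sum_equiv (Equiv.funUnique Unit (Fin N)) _ _ fun M => ?_
  congr 2
  funext l
  by_cases hl : l = i
  · subst hl
    rw [Function.update_self]
    exact Function.Injective.extend_apply (Function.injective_of_subsingleton _) M I ()
  · rw [Function.update_of_ne hl, Function.extend_apply']
    rintro ⟨_, e⟩
    exact hl e.symm

/-- On distinct factors an entry of the product is the product of the entries in the order of the
list. Hence transposing the whole matrix transposes each factor without reversing their order,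
although the entries do not commute. -/
theorem prod_at₁_apply {ι : Type*} [Fintype ι] [DecidableEq ι] (X : ι → Matrix (Fin N) (Fin N) A) :
    ∀ (l : List ι), l.Nodup → ∀ I K : ι → Fin N, (l.map fun i => at₁ i (X i)).prod I K =
      if ∀ j, j ∉ l → I j = K j then (l.map fun i => X i (I i) (K i)).prod else 0
  | [], _, I, K => by
    simp [Matrix.one_apply, funext_iff]
  | i :: l, hn, I, K => by
    have hn' := List.nodup_cons.1 hn
    rw [List.map_cons, List.prod_cons, at₁_mul_apply]
    simp only [prod_at₁_apply X l hn'.2]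
    rw [Finset.sum_eq_single (K i)]
    · rw [mul_ite, mul_zero]
      refine if_congr ⟨fun H j hj => ?_, fun H j hj => ?_⟩ ?_ rfl
      · rw [List.mem_cons, not_or] at hj
        have := H j hj.2
        rwa [Function.update_of_ne hj.1] at this
      · by_cases hji : j = i
        · subst hji; rw [Function.update_self]
        · rw [Function.update_of_ne hji]
          exact H j (by simp [hj, hji])
      · rw [List.map_cons, List.prod_cons]
        congr 2
        refine List.map_congr_left fun j hj => ?_
        rw [Function.update_of_ne fun e : j = i => hn'.1 (e ▸ hj)]
    · intro a _ ha
      rw [if_neg, mul_zero]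
      intro H
      have := H i hn'.1
      rw [Function.update_self] at this
      exact ha this
    · simp

theorem transpose_prod_at₁ {ι : Type*} [Fintype ι] [DecidableEq ι] (X : ι → Matrix (Fin N) (Fin N) A)
    {l : List ι} (hl : l.Nodup) :
    (l.map fun i => at₁ i (X i)).prod.transpose = (l.map fun i => at₁ i (X i).transpose).prod := by
  ext I K
  rw [Matrix.transpose_apply, prod_at₁_apply X l hl, prod_at₁_apply (fun i => (X i).transpose) l hl]
  exact if_congr (by simp only [eq_comm]) rfl rfl

theorem toMat_atS {ι : Type*} [Fintype ι] [DecidableEq ι] (i : ι)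
    (F : PowerSeries (Matrix (Fin N) (Fin N) A)) :
    toMat (atS i F) = at₁ i (toMat F) := by
  ext I K k
  rw [coeff_toMat, atS, PowerSeries.coeff_map, at₁_apply]
  refine (at₁_apply i _ I K).trans ?_
  split_ifs
  · rw [coeff_toMat]
  · rw [map_zero]

theorem coeff_prodTt (F : PowerSeries (Matrix (Fin N) (Fin N) A)) (z : Fin N → PowerSeries Rh)
    (k : ℕ) : coeff k (prodTt n F z) = (coeff k (prodT n id F z)).transpose := by
  have h1 : toMat (prodTt n F z) = (toMat (prodT n id F z)).transpose := by
    rw [prodTt, prodT, map_list_prod, map_list_prod, List.map_map, List.map_map]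
    simp only [Function.comp_def, id, toMat_atS]
    rw [transpose_prod_at₁ (fun i => toMat (sh n (z i) F)) (List.nodup_finRange N)]
    congr 1
    refine List.map_congr_left fun i _ => ?_
    congr 1
    ext a b k
    rw [coeff_toMat, coeff_transpSer, Matrix.transpose_apply, Matrix.transpose_apply, coeff_toMat]
  ext I K
  rw [← coeff_toMat, h1, Matrix.transpose_apply, Matrix.transpose_apply, coeff_toMat]

theorem antisym_symm (I K : IdxN N) : antisym N I K = antisym N K I := by
  rw [antisym, Matrix.of_apply, Matrix.of_apply]
  congr 1
  refine Fintype.sum_equiv (Equiv.inv _) _ _ fun σ => ?_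
  rw [Equiv.inv_apply, Equiv.Perm.sign_inv]
  refine if_congr ⟨fun e => ?_, fun e => ?_⟩ rfl rfl
  · subst e; funext; simp
  · subst e; funext; simp

theorem transpose_asym_mul (Y : Matrix (IdxN N) (IdxN N) A) :
    (asym N A * Y).transpose = Y.transpose * asym N A := by
  ext I K
  rw [Matrix.transpose_apply, Matrix.mul_apply, Matrix.mul_apply]
  refine Finset.sum_congr rfl fun M _ => ?_
  rw [Matrix.transpose_apply, asym, Matrix.of_apply, Matrix.of_apply, antisym_symm, Algebra.commutes]

theorem transpose_mul_asym (Y : Matrix (IdxN N) (IdxN N) A) :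
    (Y * asym N A).transpose = asym N A * Y.transpose := by
  rw [← Matrix.transpose_transpose (asym N A * Y.transpose), transpose_asym_mul,
    Matrix.transpose_transpose]

variable {c : ℂ} {t : Gen N → A}

/-- The entries of the coefficients of `A^{(N)} T⁺₁(z₁) ⋯ T⁺_N(z_N)` commute with `T(v)`. -/
theorem commute_asym_prodT (hN : N ≠ 0) (hA : NilH n A) (h1 : relationSeries c t 1 = 0)
    (h2 : relationSeries c t 2 = 0) (z₀ : PowerSeries Rh)
    (hz : ∀ i : Fin N, Filt 1 (z₀ - ((i : ℕ) : PowerSeries Rh) * C h))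
    (m k : ℕ) (a b : Fin N) (I K : IdxN N) :
    Commute (coeff m (T t) a b)
      (coeff k (C (asym N A) * prodT n id (TPlus t)
        fun i => z₀ - ((i : ℕ) : PowerSeries Rh) * C h) I K) := by
  refine entry_commute_of_ser₀ ?_ m k a b I K
  have hE := congrArg (PowerSeries.map (tensHom some (Option.some_injective (Fin N))).toRingHom)
    (asym_mul_of_anti fun i j => anti_prodT hA h1 hz (i := i) (j := j))
  rw [map_mul, map_mul, map_mul, map_tens_C_asym, map_tens_prodT] at hE
  rw [map_mul, map_tens_C_asym, map_tens_prodT]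
  exact row_fused hN hA h2 z₀ hz hE

/-- The entries of the coefficients of `A^{(N)} T⁺₁(z₁)ᵗ ⋯ T⁺_N(z_N)ᵗ` commute with `T(v)`. -/
theorem commute_asym_prodTt (hN : N ≠ 0) (hA : NilH n A) (h1 : relationSeries c t 1 = 0)
    (h2 : relationSeries c t 2 = 0) (z₀ : PowerSeries Rh)
    (hz : ∀ i : Fin N, Filt 1 (z₀ + ((i : ℕ) : PowerSeries Rh) * C h))
    (m k : ℕ) (a b : Fin N) (I K : IdxN N) :
    Commute (coeff m (T t) a b)
      (coeff k (C (asym N A) * prodTt n (TPlus t)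
        fun i => z₀ + ((i : ℕ) : PowerSeries Rh) * C h) I K) := by
  -- The antisymmetrizer is symmetric, so these entries are those of `∏ T⁺_i · A` with row and
  -- column exchanged, to which `col_fused` applies.
  have e1 : coeff k (C (asym N A) * prodTt n (TPlus t)
        fun i => z₀ + ((i : ℕ) : PowerSeries Rh) * C h) I K =
      coeff k ((prodT n id (TPlus t) fun i => z₀ + ((i : ℕ) : PowerSeries Rh) * C h) *
        C (asym N A)) K I := by
    rw [PowerSeries.coeff_C_mul, PowerSeries.coeff_mul_C, coeff_prodTt, ← transpose_mul_asym]
    rfl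
  rw [e1]
  refine entry_commute_of_ser₀ ?_ m k a b K I
  have hE0 : (prodT n id (TPlus t) fun i => z₀ + ((i : ℕ) : PowerSeries Rh) * C h) *
        C (asym N A) = C (asym N A) *
      (prodT n id (TPlus t) fun i => z₀ + ((i : ℕ) : PowerSeries Rh) * C h) *
        C (asym N A) := by
    have h3 := asym_mul_of_anti fun i j => anti_prodTt hA h1 hz (i := i) (j := j)
    ext1 k
    have h4 := congrArg (fun F => (coeff k F).transpose) h3
    simp only [PowerSeries.coeff_C_mul, PowerSeries.coeff_mul_C, coeff_prodTt, transpose_asym_mul,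
      transpose_mul_asym, Matrix.transpose_transpose] at h4
    simp only [PowerSeries.coeff_C_mul, PowerSeries.coeff_mul_C]
    rw [h4, mul_assoc]
  have hE := congrArg (PowerSeries.map (tensHom some (Option.some_injective (Fin N))).toRingHom) hE0
  rw [map_mul, map_mul, map_mul, map_tens_C_asym, map_tens_prodT] at hE
  rw [map_mul, map_tens_C_asym, map_tens_prodT]
  exact col_fused hN hA h2 z₀ hz hE

end Transposition

end TwistedYangian

namespace TwistedYangian

open PowerSeries (C X coeff mk constantCoeff)

/-! ### The scalar part -/

section QAt

variable {N : ℕ} {D : Type*} [Ring D] [Algebra Rh D]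

/-- The matrix `Q_{ij}`. -/
def qAt (D : Type*) [Ring D] [Algebra Rh D] (i j : Fin N) : Matrix (IdxN N) (IdxN N) D :=
  if hij : i ≠ j then at₂ i j hij (qop N D) else 0

theorem qAt_of_ne {i j : Fin N} (hij : i ≠ j) : qAt D i j = at₂ i j hij (qop N D) := dif_pos hij

theorem qAt_self (i : Fin N) : qAt D i i = 0 := dif_neg fun h => h rfl

theorem qAt_symm (i j : Fin N) : qAt D i j = qAt D j i := by
  by_cases hij : i = j
  · rw [hij]
  · rw [qAt_of_ne hij, qAt_of_ne (Ne.symm hij), at₂_qop_symm]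

theorem permMat_mul_qAt (σ : Equiv.Perm (Fin N)) (i j : Fin N) :
    permMat D σ * qAt D i j = qAt D (σ i) (σ j) * permMat D σ := by
  by_cases hij : i = j
  · rw [hij, qAt_self, qAt_self, mul_zero, zero_mul]
  · rw [qAt_of_ne hij, permMat_mul_at₂, qAt_of_ne]

theorem permMat_mul_qAt_self {i j : Fin N} :
    permMat D (Equiv.swap i j) * qAt D i j = qAt D i j := by
  by_cases hij : i = j
  · rw [hij, qAt_self, mul_zero]
  · rw [qAt_of_ne hij, ← at₂_perm hij, ← map_mul, perm_mul_qop]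

theorem qAt_mul_permMat_self {i j : Fin N} :
    qAt D i j * permMat D (Equiv.swap i j) = qAt D i j := by
  by_cases hij : i = j
  · rw [hij, qAt_self, zero_mul]
  · rw [qAt_of_ne hij, ← at₂_perm hij, ← map_mul, qop_mul_perm]

theorem qAt_mul_qAt {k i j : Fin N} (hi : k ≠ i) (hj : k ≠ j) (hij : i ≠ j) :
    qAt D k i * qAt D k j = qAt D k i * permMat D (Equiv.swap i j) := by
  rw [qAt_of_ne hi, qAt_of_ne hj, at₂_qop_mul_at₂_qop hi hj hij, at₂_perm]

theorem qop_entry (a b : Idx2 N) : qop N D a b = 0 ∨ qop N D a b = 1 := by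
  rw [qop_apply]; split_ifs <;> simp

theorem qop_entry_commute (a b : Idx2 N) (x : D) : Commute (qop N D a b) x := by
  rcases qop_entry (D := D) a b with h1 | h1 <;> rw [h1]
  · exact Commute.zero_left _
  · exact Commute.one_left _

theorem qAt_commute_at₁ {i j k : Fin N} (hi : k ≠ i) (hj : k ≠ j) (X : Matrix (Fin N) (Fin N) D) :
    Commute (qAt D i j) (at₁ k X) := by
  by_cases hij : i = j
  · rw [hij, qAt_self]; exact Commute.zero_left _
  · rw [qAt_of_ne hij]
    exact at₂_commute_at₁ hij hi hj fun a b c d => qop_entry_commute _ _ _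

theorem qAt_commute_qAt {i j k l : Fin N} (h1 : k ≠ i) (h2 : k ≠ j) (h3 : l ≠ i) (h4 : l ≠ j) :
    Commute (qAt D i j) (qAt D k l) := by
  by_cases hij : i = j
  · rw [hij, qAt_self]; exact Commute.zero_left _
  by_cases hkl : k = l
  · rw [hkl, qAt_self]; exact Commute.zero_right _
  rw [qAt_of_ne hij, qAt_of_ne hkl]
  exact at₂_commute_at₂ hij hkl h1 h2 h3 h4 fun a b c d => qop_entry_commute _ _ _

theorem at₁_mul_qAt {i j : Fin N} (hij : i ≠ j) (X : Matrix (Fin N) (Fin N) D) :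
    at₁ i X * qAt D i j = at₁ j X.transpose * qAt D i j := by
  rw [qAt_of_ne hij, ← at₂_emb₁ hij, ← at₂_emb₂ hij, ← map_mul, ← map_mul, emb₁_mul_qop]

theorem qAt_mul_at₁ {i j : Fin N} (hij : i ≠ j) (X : Matrix (Fin N) (Fin N) D) :
    qAt D i j * at₁ i X = qAt D i j * at₁ j X.transpose := by
  rw [qAt_of_ne hij, at₂_qop_mul_at₁]

end QAt

theorem scal_algebraMap_commute {B : Type*} [Ring B] [Algebra Rh B] (z : PowerSeries Rh)
    (F : PowerSeries B) : Commute (scal B z) F := scal_commute z F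

theorem rho_C (α β : ℂ) : rho α (C β : Rh) = PowerSeries.map C (rho α β) := by
  ext1 m
  rw [PowerSeries.coeff_map]
  rcases m with _ | m
  · simp [rho]
  · simp [rho]

/-! ### The scalar block `K` and its compatibility with the antisymmetrizer. -/

section Scalar

variable {N : ℕ}

/-- `R̄ᵗ_{ij}(-2u + β)` for `h = 1`. -/
def rbarT (i j : Fin N) (β : ℂ) : PowerSeries (Matrix (IdxN N) (IdxN N) Rh) :=
  scal _ (gam N 1 (-2) (C β)) * (1 - scal _ (rho (-2) (C β)) * C (qAt Rh i j))

/-- The constant matrix `G_i`. -/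
def gAt (G : Matrix (Fin N) (Fin N) ℂ) (i : Fin N) : PowerSeries (Matrix (IdxN N) (IdxN N) Rh) :=
  C (at₁ i (G.map C))

theorem commute_rbarT {i j : Fin N} {β : ℂ} {F : PowerSeries (Matrix (IdxN N) (IdxN N) Rh)}
    (hF : Commute (C (qAt Rh i j)) F) : Commute (rbarT i j β) F :=
  (scal_algebraMap_commute _ _).mul_left
    ((Commute.one_left _).sub_left ((scal_algebraMap_commute _ _).mul_left hF))

/-- With `b = c + bc` and `Q₁ Q₂ = Q₁ P` the product is `1 - c (Q₁ + Q₂) - bc Q₁ (1 - P)`: the first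
two terms commute with `P`, and the last is killed by `1 + P`. -/
theorem one_sub_mul_one_sub {B : Type*} [Ring B] {P b c Q₁ Q₂ : B} (hb : ∀ x, b * x = x * b)
    (hc : ∀ x, c * x = x * c) (hP : P * P = 1) (h1 : P * Q₁ = Q₂ * P) (h12 : Q₁ * Q₂ = Q₁ * P)
    (hbc : b = c + b * c) : Anti P ((1 - b * Q₁) * (1 - c * Q₂)) := by
  have h2 : P * Q₂ = Q₁ * P := by
    have := congrArg (fun x => P * x * P) h1
    simp only [← mul_assoc, hP, one_mul] at this
    rw [mul_assoc (P * Q₂), hP, mul_one] at this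
    exact this.symm
  have e1 : (1 - b * Q₁) * (1 - c * Q₂) = 1 - b * Q₁ - c * Q₂ + b * c * (Q₁ * P) := by
    rw [← h12]
    have e0 : ∀ x y : B, (1 - x) * (1 - y) = 1 - x - y + x * y := fun x y => by noncomm_ring
    rw [e0, mul_assoc b Q₁, ← mul_assoc Q₁, ← hc Q₁, mul_assoc b c, mul_assoc c]
  have e2 : P * (b * Q₁) = b * (Q₂ * P) := by rw [← mul_assoc, ← hb, mul_assoc, h1]
  have e3 : P * (c * Q₂) = c * (Q₁ * P) := by rw [← mul_assoc, ← hc, mul_assoc, h2]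
  have e4 : P * (b * c * (Q₁ * P)) = b * c * Q₂ := by
    have : P * (b * c) = b * c * P := by rw [← mul_assoc, ← hb, mul_assoc, ← hc, mul_assoc]
    rw [← mul_assoc P, this, mul_assoc, ← mul_assoc P Q₁, h1, mul_assoc Q₂, hP, mul_one]
  rw [Anti, e1, sub_mul (1 : B) P, one_mul, mul_add P, mul_sub P, mul_sub P, mul_one P, e2, e3, e4]
  have e5 : ∀ x : B, b * x = c * x + b * c * x := fun x => by rw [← add_mul, ← hbc]
  rw [e5 Q₁, e5 (Q₂ * P)]
  have hPP : ∀ x : B, x * P * P = x := fun x => by rw [mul_assoc, hP, mul_one]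
  simp only [mul_add, add_mul, sub_mul, mul_one, one_mul, ← mul_assoc, hP, hPP]
  abel

variable (G : Matrix (Fin N) (Fin N) ℂ)

theorem anti_rbarT_mul {k i j : Fin N} (hi : k ≠ i) (hj : k ≠ j) (hij : i ≠ j) (β : ℂ) :
    Anti (cperm i j) (rbarT k i β * rbarT k j (β + 1)) := by
  have h2 : ∀ x : PowerSeries (Matrix (IdxN N) (IdxN N) Rh), x + x = 0 → x = 0 :=
    eq_zero_of_add_self
  have hP := cperm_mul_self (A := Rh) i j
  have e1 : rbarT k i β * rbarT k j (β + 1) =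
      (scal _ (gam N 1 (-2) (C β)) * scal _ (gam N 1 (-2) (C (β + 1)))) *
      ((1 - scal _ (rho (-2) (C β)) * C (qAt Rh k i)) *
        (1 - scal _ (rho (-2) (C (β + 1))) * C (qAt Rh k j))) := by
    rw [rbarT, rbarT, mul_assoc, ← mul_assoc _ (scal _ (gam N 1 (-2) (C (β + 1)))), ← scal_commute]
    simp only [mul_assoc]
  rw [e1, ← map_mul]
  refine Anti.mul h2 (Anti.of_commute hP (scal_algebraMap_commute _ _).symm) ?_
  refine one_sub_mul_one_sub (scal_commute _) (scal_commute _) hP ?_ ?_ ?_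
  · rw [cperm, ← map_mul, permMat_mul_qAt, Equiv.swap_apply_left, Equiv.swap_apply_of_ne_of_ne hi hj, map_mul]
  · rw [cperm, ← map_mul, ← map_mul, qAt_mul_qAt hi hj hij]
  · rw [← map_mul, ← map_add]
    congr 1
    rw [rho_C, rho_C, ← map_mul, ← map_add, ← rho_neg_two_shift]

theorem mul_central_mul_one_sub {B : Type*} [Ring B] {γ r : B} (hγ : ∀ x, γ * x = x * γ)
    (hr : ∀ x, r * x = x * r) (a q b : B) :
    a * (γ * (1 - r * q)) * b = γ * (a * b - r * (a * q * b)) := by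
  rw [← mul_assoc a, ← hγ a, mul_assoc, mul_assoc, sub_mul, one_mul, mul_sub,
    mul_assoc r, ← mul_assoc a r, ← hr a]
  simp only [mul_assoc]

/-- The constant matrix `G` solves the reflection equation, so `P` even commutes with this product:
`P` exchanges `G_i` and `G_j`, and is absorbed by `Q` on either side. -/
theorem anti_gAt_mul (hG : G.transpose = G ∨ G.transpose = -G) {i j : Fin N} (hij : i ≠ j) (β : ℂ) :
    Anti (cperm i j) (gAt G i * rbarT i j β * gAt G j) := by
  refine Anti.of_commute (cperm_mul_self (A := Rh) i j) ?_
  have hP : ∀ k, permMat Rh (Equiv.swap i j) * at₁ k (G.map C) = at₁ (Equiv.swap i j k) (G.map C) * permMat Rh (Equiv.swap i j) :=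
    fun k => permMat_mul_at₁ _ _ _
  have hcomm : at₁ i (G.map C) * at₁ j (G.map C) = at₁ j (G.map C) * at₁ i (G.map C : Matrix _ _ Rh) :=
    (at₁_commute_at₁ hij fun _ _ _ _ => Commute.all _ _).eq
  have hQ : at₁ i (G.map C) * qAt Rh i j * at₁ i (G.map C) =
      at₁ j (G.map C) * qAt Rh i j * at₁ j (G.map C : Matrix _ _ Rh) := by
    rw [at₁_mul_qAt hij, mul_assoc, qAt_mul_at₁ hij, ← mul_assoc]
    -- Moving `G` across `Q` transposes it once on each side, so the sign in `Gᵗ = ±G` occurs twice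
    -- and cancels.
    rcases hG with hG | hG
    · rw [← Matrix.transpose_map, hG]
    · rw [← Matrix.transpose_map, hG]
      have : (-G).map (C : ℂ →+* Rh) = -(G.map C) := by ext; simp
      rw [this, map_neg]
      noncomm_ring
  have h1 : Commute (permMat Rh (Equiv.swap i j)) (at₁ i (G.map C) * at₁ j (G.map C)) := by
    show _ * _ = _ * _
    rw [← mul_assoc, hP, mul_assoc, hP, Equiv.swap_apply_left, Equiv.swap_apply_right, ← mul_assoc, hcomm]
  have h2 : Commute (permMat Rh (Equiv.swap i j)) (at₁ i (G.map C) * qAt Rh i j * at₁ j (G.map C)) := by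
    show _ * _ = _ * _
    have hj := hP i
    rw [Equiv.swap_apply_left] at hj
    calc _ = permMat Rh (Equiv.swap i j) * at₁ i (G.map C) * (qAt Rh i j * at₁ j (G.map C)) := by
          simp only [mul_assoc]
      _ = at₁ j (G.map C) * (permMat Rh (Equiv.swap i j) * qAt Rh i j) * at₁ j (G.map C) := by
          rw [hj]; simp only [mul_assoc]
      _ = at₁ i (G.map C) * (qAt Rh i j * permMat Rh (Equiv.swap i j)) * at₁ i (G.map C) := by
          rw [permMat_mul_qAt_self, qAt_mul_permMat_self, hQ]
      _ = at₁ i (G.map C) * qAt Rh i j * (permMat Rh (Equiv.swap i j) * at₁ i (G.map C)) := by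
          simp only [mul_assoc]
      _ = _ := by rw [hj]; simp only [mul_assoc]
  have e1 : gAt G i * rbarT i j β * gAt G j = scal _ (gam N 1 (-2) (C β)) *
      (C (at₁ i (G.map C) * at₁ j (G.map C)) -
        scal _ (rho (-2) (C β)) * C (at₁ i (G.map C) * qAt Rh i j * at₁ j (G.map C))) := by
    rw [gAt, gAt, rbarT, map_mul C, map_mul C, map_mul C]
    exact mul_central_mul_one_sub (scal_commute _) (scal_commute _) _ _ _
  rw [e1]
  exact (scal_algebraMap_commute _ _).symm.mul_right ((h1.map C).sub_right
    ((scal_algebraMap_commute _ _).symm.mul_right (h2.map C)))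

/-- The scalar factor `K` of `S⁺_{[N]}`, and of `S_{[N]}` on the vacuum vector. -/
def scalarPart (δ : ℂ) : PowerSeries (Matrix (IdxN N) (IdxN N) Rh) :=
  ordProd (gAt G) (fun i j => rbarT i j (((i : ℕ) : ℂ) + (j : ℕ) + δ)) (List.finRange N)

/-- The parameters `i + j + δ` grow by `1` when either index does, so neighbouring factors in a row
or a column are related as in `anti_rbarT_mul`. -/
theorem anti_scalarPart (hG : G.transpose = G ∨ G.transpose = -G) (δ : ℂ) {i j : Fin N}
    (hij : (j : ℕ) = i + 1) : Anti (cperm i j) (scalarPart G δ) := by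
  obtain ⟨l₁, l₂, hl⟩ := finRange_split hij
  have hne : i ≠ j := by rintro rfl; omega
  have hP := cperm_mul_self (A := Rh) i j
  rw [scalarPart, hl]
  refine Anti.ordProd eq_zero_of_add_self hP ?_ ?_ ?_ ?_ ?_ ?_ ?_ l₂ l₁ (hl ▸ List.nodup_finRange N)
  · intro a hi hj
    refine Commute.map (?_ : Commute (permMat Rh (Equiv.swap i j)) (at₁ a (G.map C))) C
    exact (permMat_mul_at₁ _ _ _).trans (by rw [Equiv.swap_apply_of_ne_of_ne hi hj])
  · intro a b hab hai haj hbi hbj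
    refine (commute_rbarT ?_).symm
    refine Commute.map (?_ : Commute (qAt Rh a b) (permMat Rh (Equiv.swap i j))) C
    refine Commute.symm ((permMat_mul_qAt _ _ _).trans ?_)
    rw [Equiv.swap_apply_of_ne_of_ne hai haj, Equiv.swap_apply_of_ne_of_ne hbi hbj]
  · exact anti_gAt_mul G hG hne _
  · intro a hi hj
    have := anti_rbarT_mul hi hj hne (((a : ℕ) : ℂ) + (i : ℕ) + δ)
    rw [hij]
    push_cast
    rw [show (((a : ℕ) : ℂ) + ((i : ℕ) + 1) + δ) = ((a : ℕ) : ℂ) + (i : ℕ) + δ + 1 by ring]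
    exact this
  · intro a hi hj
    have := anti_rbarT_mul hi hj hne (((i : ℕ) : ℂ) + (a : ℕ) + δ)
    rw [hij]
    push_cast
    rw [show (((i : ℕ) + 1 : ℂ) + (a : ℕ) + δ) = ((i : ℕ) : ℂ) + (a : ℕ) + δ + 1 by ring]
    -- `Q_{ij}` is symmetric in its indices, so the factors sharing their second index reduce to the
    -- case of a shared first one.
    rw [rbarT, rbarT, qAt_symm i, qAt_symm j]
    exact this
  · intro a hi hj
    refine (commute_rbarT ?_).symm
    exact (qAt_commute_at₁ (D := Rh) hne.symm (Ne.symm hj) _).map C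
  · intro a b hab hai haj hbi hbj
    refine commute_rbarT (commute_rbarT ?_).symm
    exact (qAt_commute_qAt (D := Rh) hne.symm (Ne.symm haj) hbi (Ne.symm hab)).symm.map C

theorem asym_mul_scalarPart (hG : G.transpose = G ∨ G.transpose = -G) (δ : ℂ) :
    C (asym N Rh) * scalarPart G δ = C (asym N Rh) * scalarPart G δ * C (asym N Rh) :=
  asym_mul_of_anti fun _ _ hij => anti_scalarPart G hG δ hij

end Scalar

end TwistedYangian

namespace TwistedYangian

open PowerSeries (C X coeff mk constantCoeff)

/-! ### Laurent series over `h`-nilpotent algebras -/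

/-- The value of a power series at a nilpotent element commuting with the coefficients. -/
def nilEval {R L : Type*} [Ring R] [Ring L] (n : ℕ) (φ : R →+* L) (s : L)
    (hc : ∀ r, Commute (φ r) s) (hs : s ^ n = 0) (hn : n ≠ 0) : PowerSeries R →+* L where
  toFun F := ∑ m ∈ Finset.range n, φ (coeff m F) * s ^ m
  map_zero' := by simp
  map_one' := by
    -- For `n = 0` the sum is empty; this is where `n ≠ 0` enters.
    rw [Finset.sum_eq_single 0]
    · simp
    · intro m _ hm
      rw [PowerSeries.coeff_one, if_neg hm, map_zero, zero_mul]
    · simp [hn]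
  map_add' F G := by simp [add_mul, Finset.sum_add_distrib]
  map_mul' F G := by
    simp only [PowerSeries.coeff_mul _ F G, Finset.Nat.sum_antidiagonal_eq_sum_range_succ
      (fun p q => coeff p F * coeff q G), map_sum, Finset.sum_mul]
    have : ∀ m, ∀ p ∈ Finset.range (m + 1), φ (coeff p F * coeff (m - p) G) * s ^ m =
        (fun p q => φ (coeff p F * coeff q G) * s ^ (p + q)) p (m - p) := by
      intro m p hp
      have : p + (m - p) = m := by simp at hp; omega
      simp only [this]
    rw [Finset.sum_congr rfl fun m _ => Finset.sum_congr rfl (this m),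
      Finset.sum_range_diag_flip n fun p q => φ (coeff p F * coeff q G) * s ^ (p + q)]
    refine Finset.sum_congr rfl fun p _ => ?_
    rw [Finset.sum_subset (s₂ := Finset.range n)
      (fun q => by simp only [Finset.mem_range]; omega), Finset.mul_sum]
    · refine Finset.sum_congr rfl fun q _ => ?_
      rw [map_mul, pow_add, mul_assoc, ← mul_assoc _ (s ^ p), ((hc _).pow_right p).eq]
      simp only [mul_assoc]
    · intro q _ hq
      have : n ≤ p + q := by simp at hq; omega
      rw [← Nat.add_sub_cancel' this, pow_add, hs, zero_mul, mul_zero]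

section Laurent

variable {N : ℕ} {A : Type*} [Ring A] [Algebra Rh A] {n : ℕ}

/-- Laurent series in `u` with coefficients in `(End ℂᴺ)^{⊗N} ⊗ A`. -/
abbrev Lau (N : ℕ) (A : Type*) [Ring A] [Algebra Rh A] : Type _ :=
  HahnSeries ℤ (Matrix (IdxN N) (IdxN N) A)

/-- A power series in `u` as a Laurent series. -/
def up : PowerSeries (Matrix (IdxN N) (IdxN N) A) →+* Lau N A := HahnSeries.ofPowerSeries ℤ _

/-- The inclusion of the scalar matrices. -/
def scalarHom (N : ℕ) (A : Type*) [Ring A] [Algebra Rh A] :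
    Matrix (IdxN N) (IdxN N) Rh →+* Lau N A :=
  HahnSeries.C.comp (algebraMap Rh A).mapMatrix

theorem single_commute {c : Matrix (IdxN N) (IdxN N) A} (hc : ∀ x, Commute c x) (a : ℤ) (Y : Lau N A) :
    Commute (HahnSeries.single a c) Y := by
  refine HahnSeries.ext (funext fun k => ?_)
  rw [HahnSeries.coeff_single_mul, HahnSeries.coeff_mul_single, (hc _).eq]

/-- The element `h u⁻¹`. -/
def hInv (N : ℕ) (A : Type*) [Ring A] [Algebra Rh A] : Lau N A :=
  HahnSeries.single (-1) (h • 1)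

theorem smul_one_commute {B : Type*} [Ring B] [Algebra Rh B] (r : Rh) (x : B) :
    Commute (r • (1 : B)) x := by
  rw [← Algebra.algebraMap_eq_smul_one]; exact Algebra.commutes _ _

theorem hInv_commute (Y : Lau N A) : Commute (hInv N A) Y :=
  single_commute (fun _ => smul_one_commute _ _) _ _

theorem hInv_pow (k : ℕ) : hInv N A ^ k = HahnSeries.single (-(k : ℤ)) (h ^ k • 1) := by
  rw [hInv, HahnSeries.single_pow, smul_pow, one_pow]
  congr 1
  simp

theorem hInv_pow_eq_zero (hA : NilH n A) : hInv N A ^ n = 0 := by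
  rw [hInv_pow, hA.matrix _ 1, HahnSeries.single_eq_zero]

/-- The substitution of `h u⁻¹`. -/
def lam (hA : NilH n A) (hn : n ≠ 0) : PowerSeries (Matrix (IdxN N) (IdxN N) Rh) →+* Lau N A :=
  nilEval n (scalarHom N A) (hInv N A) (fun _ => (hInv_commute _).symm) (hInv_pow_eq_zero hA) hn

variable (hA : NilH n A) (hn : n ≠ 0)

theorem lam_C (Y : Matrix (IdxN N) (IdxN N) Rh) :
    lam hA hn (C Y) = up (C (Y.map (algebraMap Rh A))) := by
  rw [up, HahnSeries.ofPowerSeries_C]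
  show ∑ m ∈ Finset.range n, _ = _
  rw [Finset.sum_eq_single 0]
  · rw [PowerSeries.coeff_C, if_pos rfl, pow_zero, mul_one]; rfl
  · intro m _ hm
    rw [PowerSeries.coeff_C, if_neg hm, map_zero, zero_mul]
  · simp [hn]

theorem coeff_lam (F : PowerSeries (Matrix (IdxN N) (IdxN N) Rh)) (k : ℤ) :
    (lam hA hn F).coeff k = if k ≤ 0 then
      h ^ (-k).toNat • (coeff (-k).toNat F).map (algebraMap Rh A) else 0 := by
  have e1 : (lam hA hn F).coeff k = ∑ m ∈ Finset.range n,
      if k = -(m : ℤ) then h ^ m • (coeff m F).map (algebraMap Rh A) else 0 := by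
    show (∑ m ∈ Finset.range n, _ : Lau N A).coeff k = _
    rw [HahnSeries.coeff_sum]
    refine Finset.sum_congr rfl fun m _ => ?_
    rw [hInv_pow]
    show (HahnSeries.single 0 _ * _ : Lau N A).coeff k = _
    rw [HahnSeries.coeff_single_zero_mul, HahnSeries.coeff_single, mul_ite, mul_zero, mul_smul_comm, mul_one]
    split_ifs <;> rfl
  rw [e1]
  split_ifs with hk
  · obtain ⟨m, rfl⟩ : ∃ m : ℕ, k = -(m : ℤ) := ⟨(-k).toNat, by omega⟩
    rw [neg_neg, Int.toNat_natCast]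
    by_cases hm : m < n
    · rw [Finset.sum_eq_single m]
      · rw [if_pos rfl]
      · intro b _ hb
        rw [if_neg]; omega
      · simp [hm]
    · rw [Finset.sum_eq_zero, (hA.matrix _).smul_eq_zero (k := m) (by omega) dvd_rfl]
      intro b hb
      rw [if_neg]; simp at hb; omega
  · refine Finset.sum_eq_zero fun m _ => ?_
    rw [if_neg]; omega

theorem coeff_up (F : PowerSeries (Matrix (IdxN N) (IdxN N) A)) (k : ℤ) :
    (up F).coeff k = if 0 ≤ k then coeff k.toNat F else 0 := by
  split_ifs with hk
  · obtain ⟨m, rfl⟩ := Int.eq_ofNat_of_zero_le hk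
    exact HahnSeries.ofPowerSeries_apply_coeff F m
  · rw [up, HahnSeries.ofPowerSeries_apply]
    refine HahnSeries.embDomain_of_notMem_range ?_
    rintro ⟨m, rfl⟩
    simp at hk

/-- Every entry of every coefficient commutes with `x`. -/
def EntCommute (x : A) (Y : Lau N A) : Prop := ∀ k I K, Commute x (Y.coeff k I K)

theorem EntCommute.mul {x : A} {Y Z : Lau N A} (hY : EntCommute x Y) (hZ : EntCommute x Z) :
    EntCommute x (Y * Z) := by
  intro k I K
  rw [HahnSeries.coeff_mul, Matrix.sum_apply]
  refine Commute.sum_right _ _ _ fun ij _ => ?_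
  rw [Matrix.mul_apply]
  exact Commute.sum_right _ _ _ fun M _ => (hY _ _ _).mul_right (hZ _ _ _)

theorem entCommute_lam (x : A) (F : PowerSeries (Matrix (IdxN N) (IdxN N) Rh)) :
    EntCommute x (lam hA hn F) := by
  intro k I K
  rw [coeff_lam]
  split_ifs
  · rw [Matrix.smul_apply, Matrix.map_apply]
    exact (Algebra.commute_algebraMap_right _ _).smul_right _
  · exact Commute.zero_right _

theorem entCommute_up {x : A} {F : PowerSeries (Matrix (IdxN N) (IdxN N) A)}
    (hF : ∀ k I K, Commute x (coeff k F I K)) : EntCommute x (up F) := by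
  intro k I K
  rw [coeff_up]
  split_ifs
  · exact hF _ _ _
  · exact Commute.zero_right _

/-- The scalar series at `h u⁻¹`. -/
def lamS : PowerSeries Rh →+* Lau N A := (lam hA hn).comp (scal _)

theorem lamS_commute (f : PowerSeries Rh) (Y : Lau N A) : Commute (lamS hA hn f) Y := by
  refine Commute.sum_left _ _ _ fun m _ => Commute.mul_left ?_ ((hInv_commute Y).pow_left m)
  refine single_commute (fun x => ?_) 0 Y
  rw [scal, PowerSeries.coeff_map]
  have : (algebraMap Rh A).mapMatrix (algebraMap Rh (Matrix (IdxN N) (IdxN N) Rh) (coeff m f)) =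
      algebraMap Rh (Matrix (IdxN N) (IdxN N) A) (coeff m f) := by
    ext I K
    simp only [RingHom.mapMatrix_apply, Matrix.map_apply, Matrix.algebraMap_matrix_apply]
    split_ifs <;> simp
  rw [this]
  exact Algebra.commutes _ _

theorem lamS_X : lamS hA hn X = (hInv N A) := by
  have h2 : ∀ m, m ≠ 1 → scalarHom N A (coeff m (scal _ X)) * hInv N A ^ m = 0 := by
    intro m hm
    rw [scal, PowerSeries.map_X, PowerSeries.coeff_X, if_neg hm, map_zero, zero_mul]
  have h1 : scalarHom N A (coeff 1 (scal _ X)) * hInv N A ^ 1 = hInv N A := by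
    rw [scal, PowerSeries.map_X, PowerSeries.coeff_one_X, map_one, one_mul, pow_one]
  show ∑ m ∈ Finset.range n, scalarHom N A (coeff m (scal _ X)) * hInv N A ^ m = _
  -- For `n = 1` the linear term is cut off, but then `h u⁻¹` is itself zero.
  by_cases h3 : 1 < n
  · rw [Finset.sum_eq_single 1 (fun m _ hm => h2 m hm) (by simp [h3]), h1]
  · have h4 := hInv_pow_eq_zero (N := N) hA
    rw [show n = 1 by omega, pow_one] at h4
    rw [Finset.sum_eq_zero, h4]
    intro m hm
    exact h2 m (by simp at hm; omega)

theorem lamS_C (r : Rh) : lamS hA hn (C r) = up (scal _ (C r) : PowerSeries (Matrix (IdxN N) (IdxN N) A)) := by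
  rw [lamS, RingHom.comp_apply, scal, PowerSeries.map_C, lam_C, scal, PowerSeries.map_C]
  congr 2
  ext I K
  simp only [Matrix.map_apply, Matrix.algebraMap_matrix_apply]
  split_ifs <;> simp

theorem up_X_mul_hInv : (up (scal _ X) : Lau N A) * hInv N A = up (scal _ (C h)) := by
  rw [scal, PowerSeries.map_X, PowerSeries.map_C, up, HahnSeries.ofPowerSeries_X,
    HahnSeries.ofPowerSeries_C, hInv, HahnSeries.single_mul_single, one_mul,
    Algebra.algebraMap_eq_smul_one]
  rfl

/-- The element `u⁻¹`. -/
def uInv (N : ℕ) (A : Type*) [Ring A] [Algebra Rh A] : Lau N A := HahnSeries.single (-1) 1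

theorem uInv_mul_up : uInv N A * up (scal _ X) = 1 := by
  rw [scal, PowerSeries.map_X, up, HahnSeries.ofPowerSeries_X, uInv, HahnSeries.single_mul_single,
    one_mul]
  rfl

theorem uInv_commute (Y : Lau N A) : Commute (uInv N A) Y :=
  single_commute (fun _ => Commute.one_left _) _ _

theorem uInv_mul_up_C : uInv N A * up (scal _ (C h)) = hInv N A := by
  rw [← up_X_mul_hInv, ← mul_assoc, uInv_mul_up, one_mul]

end Laurent

end TwistedYangian

namespace TwistedYangian

open PowerSeries (C X coeff mk constantCoeff)

/-! ### The factorization of `S⁺_{[N]}` as a Laurent series. -/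

section Laurent

variable {N : ℕ} {A : Type*} [Ring A] [Algebra Rh A] {n : ℕ}

theorem map_at₁ (i : Fin N) (X : Matrix (Fin N) (Fin N) Rh) :
    (at₁ i X).map (algebraMap Rh A) = at₁ i (X.map (algebraMap Rh A)) := by
  ext I K
  rw [Matrix.map_apply, at₁_apply, at₁_apply]
  split_ifs <;> simp

theorem map_qAt (i j : Fin N) : (qAt Rh i j).map (algebraMap Rh A) = qAt A i j := by
  by_cases hij : i = j
  · rw [hij, qAt_self, qAt_self]; ext; simp
  · ext I K
    rw [qAt_of_ne hij, qAt_of_ne hij, Matrix.map_apply, at₂_apply, at₂_apply, qop_apply, qop_apply]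
    split_ifs <;> simp

theorem map_asym : (asym N Rh).map (algebraMap Rh A) = asym N A := by
  ext I K
  rfl

/-- The element `u - i h`. -/
def pos (i : Fin N) : PowerSeries Rh := X - ((i : ℕ) : PowerSeries Rh) * C h

/-- The element `-u + i h`. -/
def npos (i : Fin N) : PowerSeries Rh := -X + ((i : ℕ) : PowerSeries Rh) * C h

theorem filt_pos (i : Fin N) : Filt 1 (pos i) := filt_one <| by
  simp [pos]

theorem filt_npos (i : Fin N) : Filt 1 (npos i) := filt_one <| by
  simp [npos]

variable (hA : NilH n A) (hn : n ≠ 0) (t : Gen N → A)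

/-- `T⁺_i(u_i)`. -/
def upT (n : ℕ) (t : Gen N → A) (i : Fin N) : Lau N A := up (atS i (sh n (pos i) (TPlus t)))

/-- `T⁺_i(-u_i)ᵗ`. -/
def upTt (n : ℕ) (t : Gen N → A) (i : Fin N) : Lau N A :=
  up (atS i (transpSer (sh n (npos i) (TPlus t))))

variable {t}

/-- `-2u + hβ` is invertible among Laurent series because `u` is and `h` is nilpotent. The factor
`h` is split off so that the relation carrying `-u_a - u_b` can be divided by it honestly. -/
theorem exists_lamS_rho (β : ℂ) : ∃ y : Lau N A, (∀ x, Commute y x) ∧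
    lamS hA hn (rho (-2) (C β)) = up (scal _ (C h)) * y ∧ y * up (scal _ (C (-2) * X + C (h * C β))) = 1 := by
  have hα : (-2 : ℂ) ≠ 0 := by norm_num
  obtain ⟨e, he⟩ := (isUnit_denom hα (C β : Rh)).exists_left_inv
  have hrho : rho (-2) (C β) = X * e := by
    have h1 := rho_eq (-2) hα (C β : Rh)
    have h2 := congrArg (e * ·) h1
    simp only [← mul_assoc, he, one_mul] at h2
    rw [h2, mul_comm]
  -- `e` inverts `-2 + βX`, so `u⁻¹ e(h u⁻¹)` inverts `-2u + hβ`.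
  refine ⟨uInv N A * lamS hA hn e, fun x => (uInv_commute x).mul_left (lamS_commute hA hn e x), ?_, ?_⟩
  · rw [hrho, map_mul, lamS_X, ← mul_assoc, ← (uInv_commute _).eq, uInv_mul_up_C]
  · have h1 : (up (scal _ (C (-2) * X + C (h * C β))) : Lau N A) =
        up (scal _ X) * lamS hA hn (C (-2) + C (C β) * X) := by
      have cX : ∀ z, (up (scal _ X) * up (scal _ z) : Lau N A) = up (scal _ z) * up (scal _ X) := by
        intro z
        rw [← map_mul up, scal_commute, map_mul]
      rw [map_add (lamS hA hn), map_mul (lamS hA hn), lamS_X, lamS_C, lamS_C, mul_add, ← mul_assoc, cX, cX,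
        mul_assoc (up (scal _ (C (C β)))), up_X_mul_hInv, map_add, map_add, map_mul (scal _), map_mul up,
        mul_comm h, map_mul C, map_mul (scal _), map_mul up]
    have h2 : algebraMap ℂ Rh (-2) = -2 := by rw [map_neg, map_ofNat]
    rw [h2] at he
    rw [h1, mul_assoc, ← mul_assoc (lamS hA hn e), (lamS_commute hA hn e _).eq, mul_assoc, ← mul_assoc,
      uInv_mul_up, one_mul, ← map_mul, he, map_one]

theorem lam_gAt (G : Matrix (Fin N) (Fin N) ℂ) (i : Fin N) :
    lam hA hn (gAt G i) = up (C (at₁ i ((G.map C).map (algebraMap Rh A)))) := by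
  rw [gAt, lam_C, map_at₁]

theorem lam_rbarT (i j : Fin N) (β : ℂ) : lam hA hn (rbarT i j β) =
    lamS hA hn (gam N 1 (-2) (C β)) * (1 - lamS hA hn (rho (-2) (C β)) * up (C (qAt A i j))) := by
  rw [rbarT, map_mul, map_sub, map_one, map_mul, lam_C, map_qAt]
  rfl

theorem up_smul (r : Rh) (F : PowerSeries (Matrix (IdxN N) (IdxN N) A)) :
    up (r • F) = up (scal _ (C r)) * up F := by
  rw [← map_mul, scal, PowerSeries.map_C]
  congr 1
  ext1 k
  rw [PowerSeries.coeff_smul, PowerSeries.coeff_C_mul, Algebra.smul_def]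

/-- The constant matrix `G_i`. -/
def upG (A : Type*) [Ring A] [Algebra Rh A] (G : Matrix (Fin N) (Fin N) ℂ) (i : Fin N) : Lau N A :=
  up (C (at₁ i ((G.map C).map (algebraMap Rh A))))

theorem map_entry_commute (G : Matrix (Fin N) (Fin N) ℂ) (a b : Fin N) (x : A) :
    Commute (((G.map C).map (algebraMap Rh A)) a b) x := Algebra.commutes _ _

theorem commute_C_atS {Y : Matrix (IdxN N) (IdxN N) A} {i : Fin N}
    (hY : ∀ X : Matrix (Fin N) (Fin N) A, Commute Y (at₁ i X)) (F : PowerSeries (Matrix (Fin N) (Fin N) A)) :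
    Commute (up (C Y)) (up (atS i F)) := by
  refine Commute.map (PowerSeries.ext fun k => ?_ : Commute (C Y) (atS i F)) up
  rw [PowerSeries.coeff_C_mul, PowerSeries.coeff_mul_C, atS, PowerSeries.coeff_map]
  exact hY _

theorem commute_lam_rbarT {i j : Fin N} {β : ℂ} {Y : Lau N A}
    (hY : Commute (up (C (qAt A i j))) Y) : Commute (lam hA hn (rbarT i j β)) Y := by
  rw [lam_rbarT]
  exact (lamS_commute _ _ _ _).mul_left
    ((Commute.one_left _).sub_left ((lamS_commute _ _ _ _).mul_left hY))

/-- Dividing `transpose_commutator` by `-u_a - u_b` gives the exchange relation for `1 - h (-u_a -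
u_b)⁻¹ Q`; the factor `g` is central and plays no part. -/
theorem upTt_mul_lam_mul_upT {c : ℂ} (hrel : relationSeries c t 1 = 0) {a b : Fin N} (hab : a ≠ b) :
    upTt n t a * lam hA hn (rbarT a b (((a : ℕ) : ℂ) + (b : ℕ) + 0)) * upT n t b =
      upT n t b * lam hA hn (rbarT a b (((a : ℕ) : ℂ) + (b : ℕ) + 0)) * upTt n t a := by
  set β : ℂ := ((a : ℕ) : ℂ) + (b : ℕ) + 0 with hβ
  obtain ⟨y, hy, hρ, hinv⟩ := exists_lamS_rho (N := N) hA hn β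
  have h1 := congrArg up (transpose_commutator hA hrel (filt_npos a) (filt_pos b) hab)
  have h2 : npos a - pos b = (C (-2) * X + C (h * C β) : PowerSeries Rh) := by
    rw [npos, pos, hβ, mul_comm h]
    have e1 : (C (C (((a : ℕ) : ℂ) + (b : ℕ) + 0) * h) : PowerSeries Rh) =
        (((a : ℕ) : PowerSeries Rh) + ((b : ℕ) : PowerSeries Rh)) * C h := by
      rw [add_zero, map_add, map_natCast, map_natCast, map_mul, map_add, map_natCast, map_natCast]
    rw [e1, map_neg, map_ofNat]
    ring
  rw [h2, map_mul, up_smul, map_sub, map_sub] at h1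
  simp only [map_mul up] at h1
  rw [← qAt_of_ne hab] at h1
  have h3 : y * _ = y * _ := congrArg (y * ·) h1
  rw [← mul_assoc y, ← mul_assoc y, hinv, one_mul] at h3
  change upTt n t a * upT n t b - upT n t b * upTt n t a = y * up (scal _ (C h)) * (upTt n t a * up (C (qAt A a b)) * upT n t b -
    upT n t b * up (C (qAt A a b)) * upTt n t a) at h3
  rw [(hy _).eq, ← hρ, mul_sub, sub_eq_sub_iff_sub_eq_sub] at h3
  rw [lam_rbarT, mul_central_mul_one_sub (fun x => (lamS_commute hA hn _ x).eq)
    (fun x => (lamS_commute hA hn _ x).eq), mul_central_mul_one_sub (fun x => (lamS_commute hA hn _ x).eq)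
    (fun x => (lamS_commute hA hn _ x).eq), h3]

variable (G : Matrix (Fin N) (Fin N) ℂ)

/-- `S⁺_{[N]}` as a Laurent series. -/
def lauS (hA : NilH n A) (hn : n ≠ 0) (t : Gen N → A) (G : Matrix (Fin N) (Fin N) ℂ) : Lau N A :=
  ordProd (fun i => upT n t i * upG A G i * upTt n t i)
    (fun i j => lam hA hn (rbarT i j (((i : ℕ) : ℂ) + (j : ℕ) + 0))) (List.finRange N)

theorem map_ordProd {ι B B' : Type*} [Ring B] [Ring B'] (f : B →+* B') (Y : ι → B) (R : ι → ι → B) :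
    ∀ l : List ι, f (ordProd Y R l) = ordProd (fun i => f (Y i)) (fun i j => f (R i j)) l
  | [] => map_one f
  | a :: l => by
    rw [ordProd, ordProd, map_mul, map_mul, map_ordProd f Y R l, map_list_prod, List.map_map]
    rfl

/-- `ordProd_mul_mul` with the exchange relation above; matrices on different factors commute as
soon as one of them has scalar entries, and what stays in the middle is the scalar block. -/
theorem lauS_eq {c : ℂ} (hrel : relationSeries c t 1 = 0) : lauS hA hn t G =
    up (prodT n id (TPlus t) pos) * lam hA hn (scalarPart G 0) * up (prodTt n (TPlus t) npos) := by
  rw [lauS, ordProd_mul_mul (T := upT n t) (G := upG A G) (T' := upTt n t) (R := fun i j =>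
    lam hA hn (rbarT i j (((i : ℕ) : ℂ) + (j : ℕ) + 0))) (fun a b hab => upTt_mul_lam_mul_upT hA hn hrel hab)]
  · congr 2
    · rw [prodT, map_list_prod, List.map_map]; rfl
    · rw [scalarPart, map_ordProd]
      simp only [lam_gAt]
      rfl
    · rw [prodTt, map_list_prod, List.map_map]; rfl
  · intro a b c hab hca hcb
    exact commute_lam_rbarT hA hn (commute_C_atS (fun X => qAt_commute_at₁ hca hcb X) _)
  · intro a b hab
    exact commute_C_atS (fun X => at₁_commute_at₁ hab fun _ _ _ _ => map_entry_commute G _ _ _) _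
  · intro a b hab
    exact (commute_C_atS (fun X => at₁_commute_at₁ hab.symm fun _ _ _ _ => map_entry_commute G _ _ _) _).symm
  · intro a b c hab hca hcb
    exact (commute_lam_rbarT hA hn (commute_C_atS (fun X => qAt_commute_at₁ hca hcb X) _)).symm
  · exact List.nodup_finRange N

/-- The entries of the coefficients of `A^{(N)} S⁺_{[N]} F`, for a scalar series `F`, commute with the
coefficients of `T(v)`. -/
theorem entCommute_lauS (hN : N ≠ 0) {c : ℂ} (h1 : relationSeries c t 1 = 0) (h2 : relationSeries c t 2 = 0)
    (hG : G.transpose = G ∨ G.transpose = -G) (F : PowerSeries (Matrix (IdxN N) (IdxN N) Rh))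
    (m : ℕ) (a b : Fin N) :
    EntCommute (coeff m (T t) a b) (up (C (asym N A)) * lauS hA hn t G * lam hA hn F) := by
  have e1 := congrArg up (asym_mul_of_anti fun i j hij => anti_prodT hA h1 filt_pos (i := i) (j := j) hij)
  have e2 := congrArg up (asym_mul_of_anti fun i j hij => anti_prodTt hA h1 filt_npos (i := i) (j := j) hij)
  have e3 := congrArg (lam hA hn) (asym_mul_scalarPart G hG 0)
  simp only [map_mul, lam_C, map_asym] at e1 e2 e3
  change up (C (asym N A)) * up (prodT n id (TPlus t) pos) = up (C (asym N A)) * up (prodT n id (TPlus t) pos) * up (C (asym N A)) at e1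
  have c1 : EntCommute (coeff m (T t) a b) (up (C (asym N A)) * up (prodT n id (TPlus t) pos)) := by
    rw [← map_mul]
    exact entCommute_up fun k I K => commute_asym_prodT hN hA h1 h2 _ filt_pos m k a b I K
  have c2 : EntCommute (coeff m (T t) a b) (up (C (asym N A)) * up (prodTt n (TPlus t) npos)) := by
    rw [← map_mul]
    exact entCommute_up fun k I K => commute_asym_prodTt hN hA h1 h2 _ filt_npos m k a b I K
  have c3 : EntCommute (coeff m (T t) a b) (up (C (asym N A)) * lam hA hn (scalarPart G 0)) := by
    rw [← map_asym, ← lam_C hA hn, ← map_mul]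
    exact entCommute_lam hA hn _ _
  -- By `e1` and `e3` the antisymmetrizer is copied from one block to the next, so that each block
  -- has one on its left.
  have key : up (C (asym N A)) * lauS hA hn t G * lam hA hn F =
      (up (C (asym N A)) * up (prodT n id (TPlus t) pos)) *
        (up (C (asym N A)) * lam hA hn (scalarPart G 0)) *
        (up (C (asym N A)) * up (prodTt n (TPlus t) npos)) * lam hA hn F := by
    conv_lhs => rw [lauS_eq hA hn G h1, ← mul_assoc, ← mul_assoc, e1,
      mul_assoc _ _ (lam hA hn (scalarPart G 0)), e3]
    simp only [mul_assoc]
  rw [key]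
  exact ((c1.mul c3).mul c2).mul (entCommute_lam hA hn _ _)

end Laurent

end TwistedYangian

namespace TwistedYangian

open PowerSeries (C X coeff mk constantCoeff)

/-! ### The vacuum module modulo `hⁿ` -/

section Quotients

variable {N : ℕ} {c : ℂ}

/-- The quotient of `DY / vacIdeal` by `hⁿ`. -/
abbrev VacQ (N : ℕ) (c : ℂ) (n : ℕ) : Type :=
  (DY N c ⧸ vacIdeal N c) ⧸ (hIdeal ^ n • (⊤ : Submodule Rh (DY N c ⧸ vacIdeal N c)))

/-- The projection of the vacuum module modulo `hⁿ`. -/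
def ev (n : ℕ) : Vac N c →ₗ[Rh] VacQ N c n := AdicCompletion.eval hIdeal (DY N c ⧸ vacIdeal N c) n

theorem ext_ev {v w : Vac N c} (hvw : ∀ n, ev n v = ev n w) : v = w := AdicCompletion.ext hvw

instance : Subsingleton (VacQ N c 0) := by
  rw [Submodule.Quotient.subsingleton_iff, pow_zero, Ideal.one_eq_top, Submodule.top_smul]

theorem ext_ev' {v w : Vac N c} (hvw : ∀ n, n ≠ 0 → ev n v = ev n w) : v = w :=
  ext_ev fun n => by
    rcases eq_or_ne n 0 with rfl | hn
    · exact Subsingleton.elim _ _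
    · exact hvw n hn

/-- Finite generation of `(h)` enters here: it makes the kernels of the projections the submodules
defining the `h`-adic topology. -/
theorem ker_ev (n : ℕ) : LinearMap.ker (ev (N := N) (c := c) n) = hIdeal ^ n • ⊤ :=
  (AdicCompletion.pow_smul_top_eq_ker_eval ⟨{h}, by simp [hIdeal]⟩).symm

theorem smul_vacQ (n : ℕ) (w : VacQ N c n) : (h ^ n : Rh) • w = 0 := by
  obtain ⟨w, rfl⟩ := Submodule.Quotient.mk_surjective _ w
  rw [← Submodule.Quotient.mk_smul, Submodule.Quotient.mk_eq_zero]
  exact Submodule.smul_mem_smul (Ideal.pow_mem_pow (Ideal.mem_span_singleton_self h) n) Submodule.mem_top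

theorem nhds_vac (a : Vac N c) :
    (nhds a).HasBasis (fun _ : ℕ => True) fun n => {x | ev n x = ev n a} := by
  refine ⟨fun U => ?_⟩
  let _ : TopologicalSpace Rh := hIdeal.adicTopology
  have := (AddGroupFilterBasis.nhds_hasBasis
    (hIdeal.ringFilterBasis.moduleFilterBasis (hIdeal.adic_module_basis (Vac N c))).toAddGroupFilterBasis a).mem_iff (t := U)
  refine Iff.trans this ?_
  constructor
  · rintro ⟨V, ⟨n, rfl⟩, hV⟩
    refine ⟨n, trivial, fun x hx => hV ⟨x - a, ?_, by simp⟩⟩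
    show x - a ∈ hIdeal ^ n • (⊤ : Submodule Rh (Vac N c))
    rw [← ker_ev, LinearMap.mem_ker, map_sub, sub_eq_zero]
    exact hx
  · rintro ⟨n, -, hn⟩
    refine ⟨_, ⟨n, rfl⟩, ?_⟩
    rintro _ ⟨x, hx, rfl⟩
    refine hn ?_
    replace hx : x ∈ hIdeal ^ n • (⊤ : Submodule Rh (Vac N c)) := hx
    rw [← ker_ev, LinearMap.mem_ker] at hx
    show ev n (a + x) = _
    rw [map_add, hx, add_zero]

theorem tendsto_vac {ι : Type*} {l : Filter ι} {f : ι → Vac N c} {a : Vac N c} :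
    Filter.Tendsto f l (nhds a) ↔ ∀ n, ∀ᶠ i in l, ev n (f i) = ev n a := by
  rw [(nhds_vac a).tendsto_right_iff]
  simp

theorem hasSum_ev {ι : Type*} {f : ι → Vac N c} {a : Vac N c} (hf : HasSum f a) (n : ℕ) :
    ∃ s₀ : Finset ι, ∀ s, s₀ ⊆ s → ev n (∑ i ∈ s, f i) = ev n a :=
  (Filter.eventually_atTop.1 (tendsto_vac.1 hf n))

instance : T2Space (Vac N c) := by
  rw [t2_iff_nhds]
  intro x y hxy
  refine ext_ev fun n => ?_
  have h1 := (nhds_vac x).mem_of_mem (i := n) trivial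
  have h2 := (nhds_vac y).mem_of_mem (i := n) trivial
  have := hxy
  obtain ⟨z, hz1, hz2⟩ := Filter.nonempty_of_mem (Filter.inter_mem (Filter.mem_inf_of_left h1) (Filter.mem_inf_of_right h2))
  exact (hz1.symm.trans hz2 :)

/-- If only finitely many terms survive modulo each `hⁿ`, the finite sums form a compatible family,
that is, an element of the completion. All convergence claims are reduced to this. -/
theorem tsum_ev {ι : Type*} {f : ι → Vac N c} (hf : ∀ n, n ≠ 0 → (Function.support fun i => ev n (f i)).Finite) :
    Summable f ∧ ∀ n, ∀ s : Finset ι, (∀ i ∉ s, ev n (f i) = 0) → ev n (∑' i, f i) = ∑ i ∈ s, ev n (f i) := by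
  have hf' : ∀ n, (Function.support fun i => ev n (f i)).Finite := fun n => by
    rcases eq_or_ne n 0 with rfl | hn
    · convert Set.finite_empty
      rw [Function.support_eq_empty_iff]
      exact Subsingleton.elim _ _
    · exact hf n hn
  let a : Vac N c := (⟨fun n => ∑ᶠ i, ev n (f i), fun {m n} hmn => by
    rw [← LinearMap.toAddMonoidHom_coe, AddMonoidHom.map_finsum _ (hf' n)]
    exact finsum_congr fun i => AdicCompletion.transitionMap_comp_eval_apply hIdeal _ hmn (f i)⟩ :
      AdicCompletion hIdeal (DY N c ⧸ vacIdeal N c))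
  have ha : ∀ n, ev n a = ∑ᶠ i, ev n (f i) := fun n => rfl
  have hsum : HasSum f a := by
    refine tendsto_vac.2 fun n => Filter.eventually_atTop.2 ⟨(hf' n).toFinset, fun s hs => ?_⟩
    rw [ha, map_sum, finsum_eq_sum_of_support_subset]
    intro i hi
    exact hs ((hf' n).mem_toFinset.2 hi)
  refine ⟨hsum.summable, fun n s hs => ?_⟩
  rw [hsum.tsum_eq, ha, finsum_eq_sum_of_support_subset]
  intro i hi
  by_contra h1
  exact hi (hs i h1)

/-- The action of the double Yangian modulo `hⁿ`. -/
def actQ (N : ℕ) (c : ℂ) (n : ℕ) : DY N c →ₐ[Rh] Module.End Rh (VacQ N c n) where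
  toFun x := Submodule.mapQ _ _ (Algebra.lsmul Rh Rh (DY N c ⧸ vacIdeal N c) x) (by
    rw [← Submodule.map_le_iff_le_comap, Submodule.map_smul'']
    exact Submodule.smul_mono le_rfl le_top)
  map_one' := by
    refine LinearMap.ext fun w => ?_
    obtain ⟨w, rfl⟩ := Submodule.Quotient.mk_surjective _ w
    rw [Submodule.mapQ_apply, map_one]; rfl
  map_mul' x y := by
    refine LinearMap.ext fun w => ?_
    obtain ⟨w, rfl⟩ := Submodule.Quotient.mk_surjective _ w
    rw [Submodule.mapQ_apply, map_mul]; rfl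
  map_zero' := by
    refine LinearMap.ext fun w => ?_
    obtain ⟨w, rfl⟩ := Submodule.Quotient.mk_surjective _ w
    rw [Submodule.mapQ_apply, map_zero]; rfl
  map_add' x y := by
    refine LinearMap.ext fun w => ?_
    obtain ⟨w, rfl⟩ := Submodule.Quotient.mk_surjective _ w
    rw [Submodule.mapQ_apply, map_add]; rfl
  commutes' r := by
    refine LinearMap.ext fun w => ?_
    obtain ⟨w, rfl⟩ := Submodule.Quotient.mk_surjective _ w
    rw [Submodule.mapQ_apply, AlgHom.commutes]; rfl

theorem ev_act (n : ℕ) (x : DY N c) (w : Vac N c) : ev n (act x w) = actQ N c n x (ev n w) := rfl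

theorem nilH_end (n : ℕ) : NilH n (Module.End Rh (VacQ N c n)) := fun x => by
  refine LinearMap.ext fun w => ?_
  exact smul_vacQ n (x w)

theorem act_mul (x y : DY N c) (w : Vac N c) : act (x * y) w = act x (act y w) :=
  ext_ev fun n => by rw [ev_act, ev_act, ev_act, map_mul]; rfl

theorem act_algebraMap (r : Rh) (w : Vac N c) : act (algebraMap Rh (DY N c) r) w = r • w :=
  ext_ev fun n => by rw [ev_act, AlgHom.commutes, map_smul]; rfl

theorem act_add (x y : DY N c) (w : Vac N c) : act (x + y) w = act x w + act y w :=
  ext_ev fun n => by rw [ev_act, map_add, map_add, ev_act, ev_act]; rfl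

theorem act_smul (r : Rh) (x : DY N c) (w : Vac N c) : act (r • x) w = r • act x w :=
  ext_ev fun n => by rw [ev_act, map_smul, map_smul, ev_act]; rfl

theorem act_one (w : Vac N c) : act 1 w = w :=
  ext_ev fun n => by rw [ev_act, map_one]; rfl

/-- The action as a homomorphism of algebras. -/
def actHom (N : ℕ) (c : ℂ) : DY N c →ₐ[Rh] Module.End Rh (Vac N c) where
  toFun := act
  map_one' := LinearMap.ext act_one
  map_mul' x y := LinearMap.ext (act_mul x y)
  map_zero' := LinearMap.ext fun w => ext_ev fun n => by rw [ev_act, map_zero]; exact (map_zero (ev n)).symm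
  map_add' x y := LinearMap.ext (act_add x y)
  commutes' r := LinearMap.ext (act_algebraMap r)

theorem act_pos_vac (i j : Fin N) (r : ℕ) : act (gen N c (.pos i j r)) (vac N c) = 0 := by
  refine ext_ev fun n => ?_
  rw [map_zero]
  show Submodule.Quotient.mk (gen N c (.pos i j r) • Submodule.Quotient.mk 1) = _
  rw [← Submodule.Quotient.mk_smul, smul_eq_mul, mul_one, (Submodule.Quotient.mk_eq_zero (vacIdeal N c)).2
    (Ideal.subset_span ⟨i, j, r, rfl⟩), Submodule.Quotient.mk_zero]

end Quotients

/-! ### Transfer of the defining relations along homomorphisms. -/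

section Relations

variable {N : ℕ} {D D' : Type*} [Ring D] [Algebra Rh D] [Ring D'] [Algebra Rh D'] (f : D →ₐ[Rh] D')

/-- The change of coefficients in series in two variables. -/
def mapSer2 : Ser2 N D →+* Ser2 N D' := PowerSeries.map (PowerSeries.map f.toRingHom.mapMatrix)

theorem coeff_mapSer2 (F : Ser2 N D) (a b : ℕ) :
    coeff b (coeff a (mapSer2 f F)) = (coeff b (coeff a F)).map f := by
  rw [mapSer2, PowerSeries.coeff_map, PowerSeries.coeff_map]; rfl

theorem mapSer2_smul (r : Rh) (F : Ser2 N D) : mapSer2 f (r • F) = r • mapSer2 f F := by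
  refine PowerSeries.ext fun a => PowerSeries.ext fun b => ?_
  ext I J
  simp [coeff_mapSer2]

theorem mapSer2_perm : mapSer2 f (permSer : Ser2 N D) = permSer := by
  rw [permSer, permSer, mapSer2, PowerSeries.map_C, PowerSeries.map_C]
  congr 2
  ext I J
  simp only [perm, RingHom.mapMatrix_apply, Matrix.map_apply, Matrix.of_apply]
  split_ifs <;> simp

theorem mapSer2_first (F : PowerSeries (Matrix (Fin N) (Fin N) D)) :
    mapSer2 f (first F) = first (PowerSeries.map f.toRingHom.mapMatrix F) := by
  refine PowerSeries.ext fun a => ?_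
  rw [mapSer2, PowerSeries.coeff_map, first, first, PowerSeries.coeff_mk, PowerSeries.coeff_mk,
    PowerSeries.map_C, PowerSeries.coeff_map]
  congr 1
  ext I J
  simp only [emb₁, RingHom.mapMatrix_apply, Matrix.map_apply, Matrix.of_apply]
  split_ifs <;> simp

theorem mapSer2_second (F : PowerSeries (Matrix (Fin N) (Fin N) D)) :
    mapSer2 f (second F) = second (PowerSeries.map f.toRingHom.mapMatrix F) := by
  rw [mapSer2, second, second, PowerSeries.map_C]
  congr 1
  refine PowerSeries.ext fun a => ?_
  rw [PowerSeries.coeff_map, PowerSeries.coeff_mk, PowerSeries.coeff_mk, PowerSeries.coeff_map]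
  ext I J
  simp only [emb₂, RingHom.mapMatrix_apply, Matrix.map_apply, Matrix.of_apply]
  split_ifs <;> simp

theorem mapSer2_Rbar (κ : Rh) : mapSer2 f (RbarSer κ : Ser2 N D) = RbarSer κ := by
  refine PowerSeries.ext fun a => PowerSeries.ext fun b => ?_
  rw [coeff_mapSer2, RbarSer, RbarSer, PowerSeries.coeff_mk, PowerSeries.coeff_mk, PowerSeries.coeff_mk,
    PowerSeries.coeff_mk]
  ext I J
  simp

theorem map_T (t : Gen N → D) : PowerSeries.map f.toRingHom.mapMatrix (T t) = T (fun x => f (t x)) := by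
  refine PowerSeries.ext fun m => ?_
  rw [PowerSeries.coeff_map, T, T, map_add, map_add, map_add]
  erw [PowerSeries.coeff_smul, PowerSeries.coeff_smul]
  congr 1
  · rw [PowerSeries.coeff_one, PowerSeries.coeff_one]; split_ifs <;> simp
  · rcases m with _ | m <;> ext i j <;> simp [tau]

theorem map_TPlus (t : Gen N → D) :
    PowerSeries.map f.toRingHom.mapMatrix (TPlus t) = TPlus (fun x => f (t x)) := by
  refine PowerSeries.ext fun m => ?_
  rw [PowerSeries.coeff_map, TPlus, TPlus, map_sub, map_sub, map_sub]
  erw [PowerSeries.coeff_smul, PowerSeries.coeff_smul]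
  congr 1
  · rw [PowerSeries.coeff_one, PowerSeries.coeff_one]; split_ifs <;> simp
  · ext i j; simp [tauPlus]

theorem mapSer2_relationSeries (c : ℂ) (t : Gen N → D) (s : Fin 3) :
    mapSer2 f (relationSeries c t s) = relationSeries c (fun x => f (t x)) s := by
  have hx : mapSer2 f (xvar : Ser2 N D) = xvar := PowerSeries.map_X _
  have hy : mapSer2 f (yvar : Ser2 N D) = yvar := by
    rw [yvar, yvar, mapSer2, PowerSeries.map_C, PowerSeries.map_X]
  fin_cases s <;>
  simp only [relationSeries, map_sub, map_mul, mapSer2_smul, mapSer2_first, mapSer2_second, mapSer2_perm,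
    mapSer2_Rbar, map_T, map_TPlus, hx, hy]

/-- The projection onto the double Yangian. -/
def toDY (N : ℕ) (c : ℂ) : Free N →ₐ[Rh] DY N c := RingQuot.mkAlgHom Rh (Rel N c)

theorem relationSeries_gen (c : ℂ) (s : Fin 3) : relationSeries c (gen N c) s = 0 := by
  have h1 := mapSer2_relationSeries (toDY N c) c (FreeAlgebra.ι Rh : Gen N → Free N) s
  refine h1.symm.trans (PowerSeries.ext fun a => PowerSeries.ext fun b => ?_)
  rw [coeff_mapSer2]
  ext I J
  rw [Matrix.map_apply, map_zero, map_zero, Matrix.zero_apply]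
  refine (RingQuot.mkAlgHom_rel Rh (?_ : Rel N c _ 0)).trans (map_zero (toDY N c))
  -- The undivided coefficients are the instances `k = 0` of the relations.
  exact ⟨rfl, s, 0, a, b, I, J, by rw [pow_zero, one_smul]⟩

theorem relationSeries_image {c : ℂ} (g : DY N c →ₐ[Rh] D) (s : Fin 3) :
    relationSeries c (fun x => g (gen N c x)) s = 0 := by
  rw [← mapSer2_relationSeries, relationSeries_gen, map_zero]

end Relations

end TwistedYangian

namespace TwistedYangian

open PowerSeries (C X coeff mk constantCoeff)

/-! ### Operator series as Laurent series modulo `hⁿ` -/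

section Laurent

variable {N : ℕ} {c : ℂ} {n : ℕ}

/-- The operator series `F` is given by the Laurent series `f` modulo `hⁿ`. -/
def RepOp (n : ℕ) (F : OpSer N c) (f : Lau N (Module.End Rh (VacQ N c n))) : Prop :=
  ∀ k I K w, ev n (F k I K w) = f.coeff k I K (ev n w)

/-- The series `X` is given by the Laurent series `Y`, applied to `e_{K₀} ⊗ v`, modulo `hⁿ`. -/
def RepVec (n : ℕ) (X : VecSer N c) (Y : Lau N (Module.End Rh (VacQ N c n))) (K₀ : IdxN N)
    (v : VacQ N c n) : Prop :=
  ∀ k I, ev n (X k I) = Y.coeff k I K₀ v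

theorem ev_applyTerm {F : OpSer N c} {f : Lau N (Module.End Rh (VacQ N c n))} (hF : RepOp n F f)
    {X : VecSer N c} {Y : Lau N (Module.End Rh (VacQ N c n))} {K₀ : IdxN N} {v : VacQ N c n}
    (hX : RepVec n X Y K₀ v) (k m : ℤ) (I : IdxN N) :
    ev n (applyTerm F X k I m) = (f.coeff m * Y.coeff (k - m)) I K₀ v := by
  rw [applyTerm, map_sum, Matrix.mul_apply, LinearMap.sum_apply]
  refine Finset.sum_congr rfl fun K _ => ?_
  rw [hF, hX]; rfl

theorem ev_applyTerm_eq_zero {F : OpSer N c} {f : Lau N (Module.End Rh (VacQ N c n))}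
    (hF : RepOp n F f)
    {X : VecSer N c} {Y : Lau N (Module.End Rh (VacQ N c n))} {K₀ : IdxN N} {v : VacQ N c n}
    (hX : RepVec n X Y K₀ v) (k : ℤ) (I : IdxN N) {m : ℤ} (hm : m ∉ (Finset.antidiagonal f.isPWO_support
      Y.isPWO_support k).image Prod.fst) : ev n (applyTerm F X k I m) = 0 := by
  rw [ev_applyTerm hF hX]
  by_contra h1
  refine hm (Finset.mem_image.2 ⟨(m, k - m), Finset.mem_antidiagonal.2 ⟨?_, ?_, by simp⟩, rfl⟩)
  · rw [HahnSeries.mem_support]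
    intro h2; rw [h2, zero_mul] at h1; exact h1 rfl
  · rw [HahnSeries.mem_support]
    intro h2
    replace h2 : Y.coeff (k - m) = 0 := h2
    rw [h2, mul_zero] at h1; exact h1 rfl

/-- Modulo `hⁿ` both series are Laurent, so only the finitely many pairs of exponents in their
supports with sum `k` contribute. -/
theorem summable_applyTerm {F : OpSer N c} (hF : ∀ n, n ≠ 0 → ∃ f, RepOp n F f) {X : VecSer N c}
    (hX : ∀ n, n ≠ 0 → ∃ Y K₀ v, RepVec n X Y K₀ v) (k : ℤ) (I : IdxN N) :
    Summable (applyTerm F X k I) ∧ ∀ n, ∀ s : Finset ℤ, (∀ i ∉ s, ev n (applyTerm F X k I i) = 0) →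
      ev n (∑' i, applyTerm F X k I i) = ∑ i ∈ s, ev n (applyTerm F X k I i) := by
  refine tsum_ev fun n hn => ?_
  obtain ⟨f, hf⟩ := hF n hn
  obtain ⟨Y, K₀, v, hY⟩ := hX n hn
  refine (Finset.finite_toSet ((Finset.antidiagonal f.isPWO_support
      Y.isPWO_support k).image Prod.fst)).subset fun m hm => ?_
  by_contra h1
  exact hm (ev_applyTerm_eq_zero hf hY k I h1)

theorem repVec_applyOp {F : OpSer N c} (hF : ∀ n, n ≠ 0 → ∃ f, RepOp n F f) {X : VecSer N c}
    (hX : ∀ n, n ≠ 0 → ∃ Y K₀ v, RepVec n X Y K₀ v) {f : Lau N (Module.End Rh (VacQ N c n))}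
    (hf : RepOp n F f) {Y : Lau N (Module.End Rh (VacQ N c n))} {K₀ : IdxN N} {v : VacQ N c n}
    (hY : RepVec n X Y K₀ v) : RepVec n (applyOp F X) (f * Y) K₀ v := by
  intro k I
  rw [applyOp, (summable_applyTerm hF hX k I).2 n _ fun m => ev_applyTerm_eq_zero hf hY k I,
    HahnSeries.coeff_mul, Finset.sum_image, Matrix.sum_apply, LinearMap.sum_apply]
  · refine Finset.sum_congr rfl fun ij hij => ?_
    rw [ev_applyTerm hf hY, ← (Finset.mem_antidiagonal.1 hij).2.2, add_sub_cancel_left]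
  · intro x hx y hy hxy
    have h1 := (Finset.mem_antidiagonal.1 hx).2.2
    have h2 := (Finset.mem_antidiagonal.1 hy).2.2
    exact Prod.ext hxy (by omega)

/-- Modulo every `hⁿ` the iterated infinite sums are a product of Laurent series. This yields
convergence and, since the latter product is associative, permits the factors to be regrouped
freely. -/
theorem applyList_spec {ι : Type*} (F : ι → OpSer N c) (f : ∀ n, n ≠ 0 → ι → Lau N (Module.End Rh (VacQ N c n)))
    {X : VecSer N c}
    {Y : ∀ n, n ≠ 0 → Lau N (Module.End Rh (VacQ N c n))} {K₀ : IdxN N} {v : ∀ n, VacQ N c n}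
    (hX : ∀ n hn, RepVec n X (Y n hn) K₀ (v n)) : ∀ l : List ι,
    (∀ i ∈ l, ∀ n hn, RepOp n (F i) (f n hn i)) → ApplyConverges (l.map F) X ∧
      ∀ n hn, RepVec n (applyList (l.map F) X) ((l.map (f n hn)).prod * Y n hn) K₀ (v n)
  | [], _ => ⟨trivial, fun n hn => by rw [List.map_nil, List.map_nil, List.prod_nil, one_mul]; exact hX n hn⟩
  | i :: l, hf' => by
    have ih := applyList_spec F f hX l fun j hj => hf' j (List.mem_cons_of_mem _ hj)
    have hf := hf' i List.mem_cons_self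
    have h1 : ∀ n, n ≠ 0 → ∃ g, RepOp n (F i) g := fun n hn => ⟨_, hf n hn⟩
    have h2 : ∀ n, n ≠ 0 → ∃ Y K₀ v, RepVec n (applyList (l.map F) X) Y K₀ v :=
      fun n hn => ⟨_, _, _, ih.2 n hn⟩
    refine ⟨⟨ih.1, fun k I => (summable_applyTerm h1 h2 k I).1⟩, fun n hn => ?_⟩
    rw [List.map_cons, List.map_cons, List.prod_cons, mul_assoc]
    exact repVec_applyOp h1 h2 (hf n hn) (ih.2 n hn)

theorem ordProd_eq {ι B : Type*} [LinearOrder ι] [Ring B] (Y : ι → B) (R : ι → ι → B) :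
    ∀ l : List ι, l.Pairwise (· < ·) → ordProd Y R l =
      (l.map fun i => Y i * ((l.filter fun j => decide (i < j)).map (R i)).prod).prod
  | [], _ => rfl
  | a :: l, hl => by
    obtain ⟨h1, h2⟩ := List.pairwise_cons.1 hl
    rw [ordProd, ordProd_eq Y R l h2, List.map_cons, List.prod_cons]
    congr 1
    · congr 3
      rw [List.filter_cons_of_neg (by simp), List.filter_eq_self.2 fun b hb => by simpa using h1 b hb]
    · congr 1
      refine List.map_congr_left fun i hi => ?_
      rw [List.filter_cons_of_neg (by simpa using (h1 i hi).le)]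

theorem prod_flatMap {ι B : Type*} [Monoid B] (f : ι → List B) :
    ∀ l : List ι, (l.flatMap f).prod = (l.map fun i => (f i).prod).prod
  | [] => rfl
  | a :: l => by
    rw [List.flatMap_cons, List.prod_append, prod_flatMap f l, List.map_cons, List.prod_cons]

theorem prod_flatMap_later {B : Type*} [Ring B] (Y : Fin N → B) (R : Fin N → Fin N → B) :
    ((List.finRange N).flatMap fun i => Y i :: (later i).map (R i)).prod =
      ordProd Y R (List.finRange N) := by
  rw [ordProd_eq Y R _ (List.pairwise_lt_finRange N), prod_flatMap]
  simp only [List.prod_cons, later]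

/-- The indices of the factors of `S⁺_{[N]}`. -/
def factorIdx (N : ℕ) : List (Fin N ⊕ Fin N × Fin N) :=
  (List.finRange N).flatMap fun i => Sum.inl i :: (later i).map fun j => Sum.inr (i, j)

theorem map_factorIdx {B : Type*} (f : Fin N ⊕ Fin N × Fin N → B) :
    (factorIdx N).map f = (List.finRange N).flatMap fun i =>
      f (Sum.inl i) :: (later i).map fun j => f (Sum.inr (i, j)) := by
  rw [factorIdx, List.map_flatMap]
  simp only [List.map_cons, List.map_map, Function.comp_def]

end Laurent

/-! ### The factors of `S⁺_{[N]}` modulo `hⁿ`. -/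

section Factors

variable {N : ℕ} {c : ℂ} {n : ℕ} (hn : n ≠ 0)

theorem repOp_ofInv {F : PowerSeries (Matrix (IdxN N) (IdxN N) (DY N c))}
    {f : PowerSeries (Matrix (IdxN N) (IdxN N) Rh)}
    (hF : ∀ m, coeff m F = h ^ m • (coeff m f).map (algebraMap Rh (DY N c))) :
    RepOp n (ofInv F) (lam (nilH_end n) hn f) := by
  intro k I K w
  rw [ofInv, coeff_lam]
  split_ifs
  · rw [hF, ev_act, Matrix.smul_apply, map_smul]
    rw [Matrix.map_apply, AlgHom.commutes]; rfl
  · exact map_zero _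

/-- `R̄(x)` depends only on `x/h`, so for a shift in `hℂ` the coefficient of `u⁻ᵐ` is `hᵐ` times its
value at `h = 1`. This homogeneity makes the series finite modulo `hⁿ`. -/
theorem coeff_RbarT {i j : Fin N} (hij : i ≠ j) (β : ℂ) (m : ℕ) :
    coeff m (RbarT c i j (h * C β)) = h ^ m • (coeff m (rbarT i j β)).map (algebraMap Rh (DY N c)) := by
  let g : ℕ → Matrix (Idx2 N) (Idx2 N) Rh := fun p => match p with
    | 0 => 1
    | p + 1 => algebraMap ℂ Rh (gCoeff N (p + 1)) • 1 - algebraMap ℂ Rh (gCoeff N p) • qop N Rh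
  have hg : ∀ p, transp₁ (Rbar N p) = h ^ p • g p := by
    intro p
    have h1 : ∀ a b : Idx2 N, (1 : Matrix (Idx2 N) (Idx2 N) Rh) (b.1, a.2) (a.1, b.2) =
        (1 : Matrix (Idx2 N) (Idx2 N) Rh) a b := by
      intro a b
      rw [Matrix.one_apply, Matrix.one_apply]
      refine if_congr ?_ rfl rfl
      rw [Prod.ext_iff, Prod.ext_iff]
      exact and_congr eq_comm Iff.rfl
    rcases p with _ | p
    · ext1 a b
      rw [pow_zero, one_smul]
      exact h1 a b
    · ext1 a b
      show (Rbar N (p + 1)) (b.1, a.2) (a.1, b.2) = _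
      simp only [Rbar, g, Matrix.smul_apply, Matrix.sub_apply, h1]
      rfl
  have h2 : expandInv (-2) (h * C β) (fun p => transp₁ (Rbar N p)) m =
      h ^ m • expandInv (-2) (C β : Rh) g m := by
    rw [expandInv, expandInv, Finset.smul_sum]
    refine Finset.sum_congr rfl fun p hp => ?_
    rw [hg, smul_smul, smul_smul]
    congr 1
    have : h ^ m = h ^ (m - p) * h ^ p := by
      rw [← pow_add]; congr 1; simp at hp; omega
    rw [this, mul_pow]
    ring
  have h3 : coeff m (rbarT i j β) = at₂ i j hij (expandInv (-2) (C β : Rh) g m) := by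
    rw [sum_rho_smul_Rbar (by norm_num) 1 (C β) g (qop N Rh) rfl (fun p => by rw [one_pow, one_smul]),
      map_sub, map_smul, map_smul, map_one, rbarT, mul_sub, mul_one, map_sub, ← mul_assoc, ← map_mul,
      PowerSeries.coeff_mul_C, scal, PowerSeries.coeff_map, PowerSeries.coeff_map, qAt_of_ne hij,
      Algebra.smul_def, mul_one, Algebra.smul_def, map_one, one_mul, mul_comm (gam _ _ _ _)]
  rw [RbarT, PowerSeries.coeff_mk, h2, h3, ← at₂_eq_embAt₂ hij]
  ext I K
  rw [Matrix.smul_apply, Matrix.map_apply, at₂_apply, at₂_apply]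
  split_ifs
  · rw [Matrix.map_apply, Matrix.smul_apply, smul_eq_mul, map_mul, Algebra.smul_def]
  · rw [map_zero, smul_zero]

theorem coeff_X_add_C_pow (a : Rh) (k p : ℕ) :
    coeff k ((X + C a : PowerSeries Rh) ^ p) = a ^ (p - k) * (p.choose k : ℕ) := by
  have : ((X + C a : PowerSeries Rh) ^ p) = (((Polynomial.X + Polynomial.C a) ^ p : Polynomial Rh) : PowerSeries Rh) := by
    simp
  rw [this, Polynomial.coeff_coe, Polynomial.coeff_X_add_C_pow]

theorem pos_eq (i : Fin N) : pos i = X + C (-(h * C ((i : ℕ) : ℂ))) := by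
  rw [pos, map_neg, map_mul, map_natCast, map_natCast, sub_eq_add_neg, mul_comm]

theorem dvd_shift_pow (i : Fin N) (l : ℕ) : h ^ l ∣ (-(h * C ((i : ℕ) : ℂ)) : Rh) ^ l := by
  rw [neg_pow, mul_pow]
  exact Dvd.dvd.mul_left (Dvd.intro _ rfl) _

/-- The images of the generators modulo `hⁿ`. -/
def genQ (N : ℕ) (c : ℂ) (n : ℕ) (x : Gen N) : Module.End Rh (VacQ N c n) := actQ N c n (gen N c x)

theorem relationSeries_genQ (s : Fin 3) : relationSeries c (genQ N c n) s = 0 :=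
  relationSeries_image (actQ N c n) s

theorem sh_transpSer_negArg {A : Type*} [Ring A] [Algebra Rh A] (i : Fin N) (F : PowerSeries (Matrix (Fin N) (Fin N) A)) :
    sh n (pos i) (transpSer (negArg F)) = transpSer (sh n (npos i) F) := by
  have hp : npos i = -pos i := by rw [npos, pos]; ring
  refine PowerSeries.ext fun k => ?_
  simp only [sh, transpSer, negArg, PowerSeries.coeff_mk, Matrix.transpose_sum, Matrix.transpose_smul, hp]
  refine Finset.sum_congr rfl fun p _ => ?_
  have : ((-1 : PowerSeries Rh) ^ p) = C ((-1) ^ p) := by rw [map_pow, map_neg, map_one]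
  rw [neg_pow (pos i), this, PowerSeries.coeff_C_mul, mul_comm, mul_smul]
  congr 1
  rcases neg_one_pow_eq_or ℤ p with h1 | h1 <;> rcases p.even_or_odd with h2 | h2 <;>
    simp_all

theorem map_SPlus {A : Type*} [Ring A] [Algebra Rh A] (f : DY N c →ₐ[Rh] A) (G : Matrix (Fin N) (Fin N) ℂ) :
    PowerSeries.map f.toRingHom.mapMatrix (SPlus c G) = TPlus (fun x => f (gen N c x)) *
      C ((G.map C).map (algebraMap Rh A)) * transpSer (negArg (TPlus fun x => f (gen N c x))) := by
  rw [SPlus, map_mul, map_mul, ← map_TPlus]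
  congr 1
  · congr 1
    rw [constSer, PowerSeries.map_C]
    congr 1
    ext a b
    simp
  · refine PowerSeries.ext fun k => ?_
    ext a b
    simp only [transpSer, negArg, PowerSeries.coeff_mk, PowerSeries.coeff_map, RingHom.mapMatrix_apply,
      Matrix.map_apply, Matrix.transpose_apply, Matrix.smul_apply, map_zsmul]

theorem upT_mul_upG_mul_upTt (G : Matrix (Fin N) (Fin N) ℂ) (i : Fin N) :
    upT n (genQ N c n) i * upG _ G i * upTt n (genQ N c n) i =
      up (atS i (sh n (pos i) (PowerSeries.map (actQ N c n).toRingHom.mapMatrix (SPlus c G)))) := by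
  rw [map_SPlus, sh_mul ((nilH_end n).matrix _) (filt_pos i), sh_mul ((nilH_end n).matrix _) (filt_pos i),
    sh_C ((nilH_end n).matrix _) (filt_pos i), sh_transpSer_negArg, map_mul, map_mul, map_mul, map_mul]
  congr 2
  rw [upG]
  congr 1
  exact (PowerSeries.map_C _ _).symm

theorem ev_shiftTerm (G : Matrix (Fin N) (Fin N) ℂ) (i : Fin N) (k : ℕ) (I K : IdxN N) (w : Vac N c) (l : ℕ) :
    ev n (shiftTerm c G i (-(h * C ((i : ℕ) : ℂ))) k I K w l) =
      (coeff k (pos i ^ (k + l)) • at₁ i (coeff (k + l)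
        (PowerSeries.map (actQ N c n).toRingHom.mapMatrix (SPlus c G)))) I K (ev n w) := by
  rw [shiftTerm, map_smul, ev_act, pos_eq, coeff_X_add_C_pow, Nat.add_sub_cancel_left, mul_comm,
    Matrix.smul_apply, LinearMap.smul_apply, PowerSeries.coeff_map, at₁_apply, embAt, Matrix.of_apply]
  congr 1
  · rw [Nat.choose_symm_add]
  · split_ifs
    · rfl
    · exact congrArg (fun f : Module.End Rh (VacQ N c n) => f (ev n w)) (map_zero _)

theorem ev_shiftTerm_eq_zero (G : Matrix (Fin N) (Fin N) ℂ) (i : Fin N) (k : ℕ) (I K : IdxN N) (w : Vac N c)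
    {l : ℕ} (hl : l ∉ Finset.range n) : ev n (shiftTerm c G i (-(h * C ((i : ℕ) : ℂ))) k I K w l) = 0 := by
  rw [shiftTerm, map_smul]
  obtain ⟨r, hr⟩ := (pow_dvd_pow h (by simpa using hl : n ≤ l)).trans (dvd_shift_pow i l)
  rw [hr, mul_left_comm, mul_smul, smul_vacQ]

theorem summable_shiftTerm (G : Matrix (Fin N) (Fin N) ℂ) (i : Fin N) (k : ℕ) (I K : IdxN N) (w : Vac N c) :
    Summable (shiftTerm c G i (-(h * C ((i : ℕ) : ℂ))) k I K w) ∧ ∀ n, ∀ s : Finset ℕ,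
      (∀ l ∉ s, ev n (shiftTerm c G i (-(h * C ((i : ℕ) : ℂ))) k I K w l) = 0) →
      ev n (∑' l, shiftTerm c G i (-(h * C ((i : ℕ) : ℂ))) k I K w l) =
        ∑ l ∈ s, ev n (shiftTerm c G i (-(h * C ((i : ℕ) : ℂ))) k I K w l) :=
  tsum_ev fun n _ => (Finset.finite_toSet (Finset.range n)).subset fun l hl => by
    by_contra h1
    exact hl (ev_shiftTerm_eq_zero G i k I K w h1)

theorem repOp_SPlusOp (G : Matrix (Fin N) (Fin N) ℂ) (i : Fin N) :
    RepOp n (SPlusOp c G i (-(h * C ((i : ℕ) : ℂ))))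
      (upT n (genQ N c n) i * upG _ G i * upTt n (genQ N c n) i) := by
  intro k I K w
  rw [SPlusOp, upT_mul_upG_mul_upTt, coeff_up]
  split_ifs
  -- In the range `p < k + n` defining the substitution, the terms with `p < k` have a vanishing
  -- binomial coefficient; the others are `p = k + l` with `l < n`.
  · rw [(summable_shiftTerm G i k.toNat I K w).2 n (Finset.range n) fun l => ev_shiftTerm_eq_zero G i _ I K w,
      atS, PowerSeries.coeff_map, sh, PowerSeries.coeff_mk, Finset.sum_range_add,
      Finset.sum_eq_zero (s := Finset.range k.toNat), zero_add]
    · rw [map_sum, Matrix.sum_apply, LinearMap.sum_apply]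
      refine Finset.sum_congr rfl fun l _ => ?_
      rw [ev_shiftTerm]
      congr 2
      exact congrFun (congrFun (map_smul (at₁ (D := Module.End Rh (VacQ N c n)) i) _ _).symm I) K
    · intro p hp
      rw [pos_eq, coeff_X_add_C_pow, Nat.choose_eq_zero_of_lt (by simpa using hp), Nat.cast_zero, mul_zero,
        zero_smul]
  · exact map_zero _

/-- The factors of `S⁺_{[N]}(u₋)`. -/
def factor (c : ℂ) (G : Matrix (Fin N) (Fin N) ℂ) : Fin N ⊕ Fin N × Fin N → OpSer N c
  | .inl i => SPlusOp c G i (-(h * C ((i : ℕ) : ℂ)))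
  | .inr (i, j) => ofInv (RbarT c i j (h * C (((i : ℕ) : ℂ) + (j : ℕ))))

theorem SPlusN_eq (c : ℂ) (G : Matrix (Fin N) (Fin N) ℂ) : SPlusN c G = (factorIdx N).map (factor c G) := by
  rw [map_factorIdx]; rfl

/-- The factors of `S⁺_{[N]}(u₋)` modulo `hⁿ`. -/
def factorQ (c : ℂ) (hn : n ≠ 0) (G : Matrix (Fin N) (Fin N) ℂ) :
    Fin N ⊕ Fin N × Fin N → Lau N (Module.End Rh (VacQ N c n))
  | .inl i => upT n (genQ N c n) i * upG _ G i * upTt n (genQ N c n) i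
  | .inr (i, j) => lam (nilH_end n) hn (rbarT i j (((i : ℕ) : ℂ) + (j : ℕ) + 0))

theorem prod_factorQ (c : ℂ) (G : Matrix (Fin N) (Fin N) ℂ) :
    ((factorIdx N).map (factorQ c hn G)).prod = lauS (nilH_end n) hn (genQ N c n) G := by
  rw [map_factorIdx]
  exact prod_flatMap_later _ fun i j => lam (nilH_end n) hn (rbarT i j (((i : ℕ) : ℂ) + (j : ℕ) + 0))

theorem repOp_factor (G : Matrix (Fin N) (Fin N) ℂ) : ∀ x ∈ factorIdx N, RepOp n (factor c G x) (factorQ c hn G x)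
  | .inl i, _ => repOp_SPlusOp G i
  | .inr (i, j), hx => by
    have hij : i ≠ j := by
      simp only [factorIdx, List.mem_flatMap, List.mem_cons, reduceCtorEq, false_or, List.mem_map, later,
        List.mem_filter, decide_eq_true_eq, Sum.inr.injEq, Prod.mk.injEq] at hx
      obtain ⟨a, -, b, ⟨-, hab⟩, rfl, rfl⟩ := hx
      exact hab.ne
    rw [factorQ, add_zero]
    exact repOp_ofInv hn (coeff_RbarT hij _)

end Factors

end TwistedYangian

namespace TwistedYangian

open PowerSeries (C X coeff mk constantCoeff)

/-! ### Series acting on a vector by scalars -/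

section ScalarAction

variable {N : ℕ} {c : ℂ} {κ : Type*} [Fintype κ] [DecidableEq κ] {w : Vac N c}

/-- The series `F(u)` acts on `w` as the scalar series `f(u / h)`. -/
def ActsAs (w : Vac N c) (F : PowerSeries (Matrix κ κ (DY N c))) (f : PowerSeries (Matrix κ κ Rh)) : Prop :=
  ∀ m I K, act (coeff m F I K) w = (h ^ m * coeff m f I K) • w

theorem act_mul_coeff (F F' : PowerSeries (Matrix κ κ (DY N c))) (m : ℕ) (I K : κ) (v : Vac N c) :
    act (coeff m (F * F') I K) v = ∑ ij ∈ Finset.HasAntidiagonal.antidiagonal m, ∑ M,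
      act (coeff ij.1 F I M) (act (coeff ij.2 F' M K) v) := by
  rw [PowerSeries.coeff_mul, Matrix.sum_apply]
  have h1 : ∀ x, act x v = actHom N c x v := fun _ => rfl
  rw [h1, map_sum, LinearMap.sum_apply]
  refine Finset.sum_congr rfl fun ij _ => ?_
  rw [Matrix.mul_apply, map_sum, LinearMap.sum_apply]
  exact Finset.sum_congr rfl fun M _ => act_mul _ _ _

theorem ActsAs.mul {F F' : PowerSeries (Matrix κ κ (DY N c))} {f f' : PowerSeries (Matrix κ κ Rh)}
    (hF : ActsAs w F f) (hF' : ActsAs w F' f') : ActsAs w (F * F') (f * f') := by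
  intro m I K
  rw [act_mul_coeff, PowerSeries.coeff_mul, Matrix.sum_apply, Finset.mul_sum, Finset.sum_smul]
  refine Finset.sum_congr rfl fun ij hij => ?_
  rw [Matrix.mul_apply, Finset.mul_sum, Finset.sum_smul]
  refine Finset.sum_congr rfl fun M _ => ?_
  rw [hF', map_smul, hF, smul_smul, ← Finset.HasAntidiagonal.mem_antidiagonal.1 hij, pow_add]
  congr 1
  ring

theorem actsAs_one : ActsAs w (1 : PowerSeries (Matrix κ κ (DY N c))) 1 := by
  intro m I K
  rw [PowerSeries.coeff_one, PowerSeries.coeff_one]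
  split_ifs with hm
  · rw [hm, pow_zero, one_mul, Matrix.one_apply, Matrix.one_apply]
    split_ifs
    · rw [act_one, one_smul]
    · rw [zero_smul, ← map_zero (algebraMap Rh _), act_algebraMap, zero_smul]
  · rw [Matrix.zero_apply, Matrix.zero_apply, mul_zero, zero_smul, ← map_zero (algebraMap Rh _), act_algebraMap,
      zero_smul]

theorem act_zero (v : Vac N c) : act (0 : DY N c) v = 0 := by
  rw [← map_zero (algebraMap Rh _), act_algebraMap, zero_smul]

theorem ActsAs.list_prod {ι : Type*} {F : ι → PowerSeries (Matrix κ κ (DY N c))}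
    {f : ι → PowerSeries (Matrix κ κ Rh)} : ∀ l : List ι, (∀ i ∈ l, ActsAs w (F i) (f i)) →
      ActsAs w (l.map F).prod (l.map f).prod
  | [], _ => actsAs_one
  | i :: l, hl => by
    rw [List.map_cons, List.map_cons, List.prod_cons, List.prod_cons]
    exact (hl i List.mem_cons_self).mul (ActsAs.list_prod l fun j hj => hl j (List.mem_cons_of_mem _ hj))

/-- The series acting on all vectors as `f(u / h)`. -/
def ofScalar (f : PowerSeries (Matrix κ κ Rh)) : PowerSeries (Matrix κ κ (DY N c)) :=
  mk fun m => h ^ m • (coeff m f).map (algebraMap Rh (DY N c))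

theorem actsAs_of_coeff {F : PowerSeries (Matrix κ κ (DY N c))} {f : PowerSeries (Matrix κ κ Rh)}
    (hF : ∀ m, coeff m F = h ^ m • (coeff m f).map (algebraMap Rh (DY N c))) : ActsAs w F f := by
  intro m I K
  rw [hF, Matrix.smul_apply, Matrix.map_apply, act_smul, act_algebraMap, smul_smul]

/-- In `F⁻¹ = g + F⁻¹ (1 - F g)`, with `g` regarded as a series of scalars, the right-hand factor of
the last term acts on `w` first and annihilates it. -/
theorem ActsAs.inverse {F : PowerSeries (Matrix κ κ (DY N c))} {f g : PowerSeries (Matrix κ κ Rh)}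
    (hF : ActsAs w F f) (hu : IsUnit F) (hfg : f * g = 1) : ActsAs w (Ring.inverse F) g := by
  have hg : ActsAs w (ofScalar g) g := actsAs_of_coeff fun m => PowerSeries.coeff_mk _ _
  have h1 : Ring.inverse F = ofScalar g + Ring.inverse F * (1 - F * ofScalar g) := by
    rw [mul_sub, mul_one, ← mul_assoc, Ring.inverse_mul_cancel _ hu, one_mul, add_sub_cancel]
  have h2 : ∀ (m : ℕ) (I K : κ), act (coeff m (1 - F * ofScalar g : PowerSeries (Matrix κ κ (DY N c))) I K) w = 0 := by
    intro m I K
    have e1 : act (coeff m (1 - F * ofScalar g : PowerSeries (Matrix κ κ (DY N c))) I K) w =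
        act (coeff m (1 : PowerSeries (Matrix κ κ (DY N c))) I K) w - act (coeff m (F * ofScalar g : PowerSeries (Matrix κ κ (DY N c))) I K) w := by
      have h1 : ∀ x, act x w = actHom N c x w := fun _ => rfl
      rw [map_sub, Matrix.sub_apply, h1, map_sub]; rfl
    rw [e1, actsAs_one m I K, hF.mul hg m I K, hfg, sub_self]
  intro m I K
  rw [h1, map_add, Matrix.add_apply, act_add, hg m I K, act_mul_coeff, Finset.sum_eq_zero, add_zero]
  intro ij _
  refine Finset.sum_eq_zero fun M _ => ?_
  rw [h2, map_zero]

end ScalarAction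

/-! ### The action of `S_{[N]}` on vectors fixed by `T(u)`, and its invertibility. -/

section SN

variable {N : ℕ} {c : ℂ} {w : Vac N c} (G : Matrix (Fin N) (Fin N) ℂ)

theorem actsAs_C_iff {κ : Type*} [Fintype κ] [DecidableEq κ] {F : PowerSeries (Matrix κ κ (DY N c))} {g : Matrix κ κ Rh} :
    ActsAs w F (C g) ↔ ∀ m I K, act (coeff m F I K) w = if m = 0 then g I K • w else 0 := by
  refine forall₃_congr fun m I K => ?_
  rw [PowerSeries.coeff_C]
  split_ifs with hm
  · rw [hm, pow_zero, one_mul]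
  · rw [Matrix.zero_apply, mul_zero, zero_smul]

theorem ActsAs.substInv {F : PowerSeries (Matrix (Fin N) (Fin N) (DY N c))} {g : Matrix (Fin N) (Fin N) Rh}
    (hF : ActsAs w F (C g)) (α : ℂ) (β : Rh) : ActsAs w (substInv α β F) (C g) := by
  rw [actsAs_C_iff] at hF ⊢
  intro m I K
  have h1 : ∀ x, act x w = actHom N c x w := fun _ => rfl
  rw [TwistedYangian.substInv, PowerSeries.coeff_mk, expandInv, Matrix.sum_apply, h1, map_sum, LinearMap.sum_apply,
    Finset.sum_eq_single 0]
  · rw [← h1, Matrix.smul_apply, act_smul, hF, if_pos rfl]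
    rcases m with _ | m
    · simp
    · simp [Ring.choose_zero_succ]
  · intro p _ hp
    rw [← h1, Matrix.smul_apply, act_smul, hF, if_neg hp, smul_zero]
  · simp

theorem ActsAs.transpSer {F : PowerSeries (Matrix (Fin N) (Fin N) (DY N c))} {g : Matrix (Fin N) (Fin N) Rh}
    (hF : ActsAs w F (C g)) : ActsAs w (transpSer F) (C g.transpose) := by
  rw [actsAs_C_iff] at hF ⊢
  intro m I K
  rw [TwistedYangian.transpSer, PowerSeries.coeff_mk, Matrix.transpose_apply, hF]
  rfl

theorem actsAs_constSer : ActsAs w (constSer G) (C (G.map C)) := by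
  rw [actsAs_C_iff]
  intro m I K
  rw [constSer, PowerSeries.coeff_C]
  split_ifs
  · rw [Matrix.map_apply, act_algebraMap]; rfl
  · rw [Matrix.zero_apply, act_zero]

variable {G}

/-- Applied to the vacuum it evaluates `S_{[N]}`; applied to the coefficients of `M(u)` it gives the
invariance. -/
theorem actsAs_S (hw : ActsAs w (T (gen N c)) 1) : ActsAs w (S c G) (C (G.map C)) := by
  rw [← map_one C] at hw
  have h1 := ((hw.substInv 1 (h * C c)).mul (actsAs_constSer G)).mul (hw.substInv (-1) 0).transpSer
  rwa [← map_mul, ← map_mul, one_mul, Matrix.transpose_one, mul_one] at h1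

theorem actsAs_embAt {F : PowerSeries (Matrix (Fin N) (Fin N) (DY N c))} {g : Matrix (Fin N) (Fin N) Rh}
    (hF : ActsAs w F (C g)) (i : Fin N) :
    ActsAs w (mk fun m => embAt i (coeff m F)) (C (at₁ i g)) := by
  rw [actsAs_C_iff] at hF ⊢
  intro m I K
  rw [PowerSeries.coeff_mk, embAt, Matrix.of_apply, at₁_eq_embAt, embAt, Matrix.of_apply]
  split_ifs with h1 h2 h2
  · rw [hF, if_pos h2]
  · rw [hF, if_neg h2]
  · rw [act_zero, zero_smul]
  · exact act_zero w

theorem scalarPart_eq (δ : ℂ) : scalarPart G δ = ((List.finRange N).map fun i =>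
    gAt G i * ((later i).map fun j => rbarT i j (((i : ℕ) : ℂ) + (j : ℕ) + δ)).prod).prod :=
  ordProd_eq _ _ _ (List.pairwise_lt_finRange N)

theorem ne_of_mem_later {i j : Fin N} (hj : j ∈ later i) : i ≠ j := by
  have := (List.mem_filter.1 hj).2
  exact (of_decide_eq_true this).ne

/-- Each `S_i` acts as the constant `G_i`, which no shift of the argument affects; only the
`R̄ᵗ_{ij}` retain the level, through `δ = -2c`. -/
theorem actsAs_SN (hw : ActsAs w (T (gen N c)) 1) : ActsAs w (SN c G) (scalarPart G (-2 * c)) := by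
  rw [scalarPart_eq, SN]
  refine ActsAs.list_prod _ fun i _ => ActsAs.mul (actsAs_embAt ((actsAs_S hw).substInv _ _) i)
    (ActsAs.list_prod _ fun j hj => actsAs_of_coeff fun m => ?_)
  rw [sub_eq_add_neg, ← neg_mul, coeff_RbarT (ne_of_mem_later hj)]

theorem actsAs_T_vac : ActsAs (vac N c) (T (gen N c)) 1 := by
  rw [← map_one C, actsAs_C_iff]
  intro m I K
  rw [T, map_add, PowerSeries.coeff_one, Matrix.add_apply, act_add]
  have h1 : act (coeff m (h • tau (gen N c)) I K) (vac N c) = 0 := by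
    have : coeff m (h • tau (gen N c)) I K = h • coeff m (tau (gen N c)) I K := rfl
    rw [this, act_smul]
    rcases m with _ | m
    · simp [tau, act_zero]
    · rw [tau, PowerSeries.coeff_mk]
      exact (congrArg (h • ·) (act_pos_vac I K m)).trans (smul_zero _)
  rw [h1, add_zero]
  split_ifs
  · rw [Matrix.one_apply, Matrix.one_apply]
    split_ifs
    · rw [act_one, one_smul]
    · rw [act_zero, zero_smul]
  · rw [Matrix.zero_apply, act_zero]

theorem isUnit_list_prod {B : Type*} [Monoid B] : ∀ l : List B, (∀ b ∈ l, IsUnit b) → IsUnit l.prod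
  | [], _ => isUnit_one
  | b :: l, hl => by
    rw [List.prod_cons]
    exact (hl b List.mem_cons_self).mul (isUnit_list_prod l fun x hx => hl x (List.mem_cons_of_mem _ hx))

theorem constantCoeff_scal {B : Type*} [Ring B] [Algebra Rh B] (f : PowerSeries Rh) :
    constantCoeff (scal B f) = algebraMap Rh B (constantCoeff f) := by
  rw [← PowerSeries.coeff_zero_eq_constantCoeff_apply, scal, PowerSeries.coeff_map,
    PowerSeries.coeff_zero_eq_constantCoeff_apply]

theorem constantCoeff_rbarT (i j : Fin N) (β : ℂ) : constantCoeff (rbarT i j β) = 1 := by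
  have h1 : constantCoeff (gam N 1 (-2) (C β : Rh)) = 1 := by
    rw [← PowerSeries.coeff_zero_eq_constantCoeff_apply, coeff_gam (by norm_num)]
    simp [gCoeff]
  rw [rbarT, map_mul, map_sub, map_one, map_mul, constantCoeff_scal, constantCoeff_scal, h1,
    constantCoeff_rho, map_one, map_zero, zero_mul, sub_zero, one_mul]

theorem isUnit_map {A : Type*} [Ring A] [Algebra Rh A] (hdet : IsUnit G.det) :
    IsUnit ((G.map C).map (algebraMap Rh A)) :=
  (((Matrix.isUnit_iff_isUnit_det G).2 hdet).map (C : ℂ →+* Rh).mapMatrix).map (algebraMap Rh A).mapMatrix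

theorem isUnit_scalarPart (hdet : IsUnit G.det) (δ : ℂ) : IsUnit (scalarPart G δ) := by
  rw [scalarPart_eq]
  refine isUnit_list_prod _ fun b hb => ?_
  obtain ⟨i, -, rfl⟩ := List.mem_map.1 hb
  refine IsUnit.mul ?_ (isUnit_list_prod _ fun b hb => ?_)
  · exact ((((Matrix.isUnit_iff_isUnit_det G).2 hdet).map (C : ℂ →+* Rh).mapMatrix).map
      (at₁ i)).map C
  · obtain ⟨j, -, rfl⟩ := List.mem_map.1 hb
    rw [PowerSeries.isUnit_iff_constantCoeff, constantCoeff_rbarT]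
    exact isUnit_one

theorem constantCoeff_substInv (α : ℂ) (β : Rh) (F : PowerSeries (Matrix (Fin N) (Fin N) (DY N c))) :
    constantCoeff (substInv α β F) = constantCoeff F := by
  rw [← PowerSeries.coeff_zero_eq_constantCoeff_apply, substInv, PowerSeries.coeff_mk, expandInv]
  simp

theorem constantCoeff_T : constantCoeff (T (gen N c)) = 1 := by
  have h1 : constantCoeff (h • tau (gen N c)) = 0 := by
    rw [← PowerSeries.coeff_zero_eq_constantCoeff_apply]
    show h • coeff 0 (tau (gen N c)) = 0
    rw [tau, PowerSeries.coeff_mk, smul_zero]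
  rw [T, map_add, map_one, h1, add_zero]

theorem constantCoeff_S : constantCoeff (S c G) = (G.map C).map (algebraMap Rh (DY N c)) := by
  have h1 : constantCoeff (transpSer (substInv (-1) 0 (T (gen N c)))) = 1 := by
    rw [← PowerSeries.coeff_zero_eq_constantCoeff_apply, transpSer, PowerSeries.coeff_mk,
      PowerSeries.coeff_zero_eq_constantCoeff_apply, constantCoeff_substInv, constantCoeff_T, Matrix.transpose_one]
  rw [S, map_mul, map_mul, h1, mul_one, constantCoeff_substInv, constantCoeff_T, one_mul, constSer,
    PowerSeries.constantCoeff_C]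
  rfl

/-- A power series is a unit if its constant term is one; the constant terms of the factors are
`G_i` and `1`. -/
theorem isUnit_SN (hdet : IsUnit G.det) : IsUnit (SN c G) := by
  refine isUnit_list_prod _ fun b hb => ?_
  obtain ⟨i, -, rfl⟩ := List.mem_map.1 hb
  refine IsUnit.mul ?_ (isUnit_list_prod _ fun b hb => ?_)
  · rw [PowerSeries.isUnit_iff_constantCoeff, ← PowerSeries.coeff_zero_eq_constantCoeff_apply,
      PowerSeries.coeff_mk, PowerSeries.coeff_zero_eq_constantCoeff_apply, constantCoeff_substInv, constantCoeff_S, ← at₁_eq_embAt]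
    exact (isUnit_map hdet).map (at₁ i)
  · obtain ⟨j, hj, rfl⟩ := List.mem_map.1 hb
    rw [PowerSeries.isUnit_iff_constantCoeff, ← PowerSeries.coeff_zero_eq_constantCoeff_apply,
      coeff_RbarT (ne_of_mem_later hj), pow_zero, one_smul, PowerSeries.coeff_zero_eq_constantCoeff_apply,
      constantCoeff_rbarT]
    exact isUnit_one.map (algebraMap Rh (DY N c)).mapMatrix

end SN

end TwistedYangian

namespace TwistedYangian

open PowerSeries (C X coeff mk constantCoeff)

/-! ### The module `M_c` -/

section Module

variable {N : ℕ} {c : ℂ} {G : Matrix (Fin N) (Fin N) ℂ}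

theorem vac_mem_Mc : vac N c ∈ Mc c G := by
  refine Submodule.mem_iInf _ |>.2 fun n => Submodule.mem_sup_left ⟨0, ?_⟩
  rw [pow_zero, one_smul]
  exact Submodule.subset_span ⟨1, one_mem _, (act_one _).symm⟩

theorem act_mem_MPrime {x : DY N c} (hx : x ∈ Ac c G) {v : Vac N c} (hv : v ∈ MPrime c G) :
    act x v ∈ MPrime c G := by
  refine Submodule.span_induction (p := fun v _ => act x v ∈ MPrime c G) ?_ ?_ ?_ ?_ hv
  · rintro _ ⟨y, hy, rfl⟩
    exact Submodule.subset_span ⟨x * y, mul_mem hx hy, (act_mul _ _ _).symm⟩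
  · rw [map_zero]; exact zero_mem _
  · intro v w _ _ hv hw
    rw [map_add]; exact add_mem hv hw
  · intro r v _ hv
    rw [map_smul]; exact Submodule.smul_mem _ _ hv

/-- The action preserves both summands in each term of the intersection: multiples of `hⁿ`, and
vectors some `hᵐ`-multiple of which lies in the module generated by the vacuum. -/
theorem act_mem_Mc {x : DY N c} (hx : x ∈ Ac c G) {v : Vac N c} (hv : v ∈ Mc c G) :
    act x v ∈ Mc c G := by
  refine (Submodule.mem_iInf _).2 fun n => ?_
  obtain ⟨a, ⟨m, ha⟩, b, hb, rfl⟩ := Submodule.mem_sup.1 ((Submodule.mem_iInf _).1 hv n)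
  rw [map_add]
  refine add_mem (Submodule.mem_sup_left ⟨m, ?_⟩) (Submodule.mem_sup_right ?_)
  · rw [← map_smul]; exact act_mem_MPrime hx ha
  · rw [← ker_ev, LinearMap.mem_ker] at hb ⊢
    rw [ev_act, hb, map_zero]

theorem tsum_mem_Mc {ι : Type*} {f : ι → Vac N c} (hf : ∀ i, f i ∈ Mc c G) : ∑' i, f i ∈ Mc c G := by
  by_cases hs : Summable f
  · refine (Submodule.mem_iInf _).2 fun n => ?_
    obtain ⟨s, hs⟩ := hasSum_ev hs.hasSum n
    rw [← add_sub_cancel (∑ i ∈ s, f i) (∑' i, f i)]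
    refine add_mem (sum_mem fun i _ => (Submodule.mem_iInf _).1 (hf i) n) (Submodule.mem_sup_right ?_)
    rw [← ker_ev, LinearMap.mem_ker, map_sub, hs s subset_rfl, sub_self]
  -- A divergent sum has the default value `0`, which lies in every submodule, so membership can be
  -- proved without convergence.
  · rw [tsum_eq_zero_of_not_summable hs]; exact zero_mem _

theorem coeff_SPlus_mem (m : ℕ) (i j : Fin N) : coeff m (SPlus c G) i j ∈ Ac c G := by
  rw [SPlus_eq, map_sub, Matrix.sub_apply]
  refine sub_mem ?_ ?_
  · rw [constSer, PowerSeries.coeff_C]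
    split_ifs
    · exact Subalgebra.algebraMap_mem _ _
    · exact zero_mem _
  · have h1 : coeff m (sigmaPlus c G) i j ∈ Ac c G := Algebra.subset_adjoin ⟨i, j, m, Or.inr rfl⟩
    exact Subalgebra.smul_mem _ h1 h

theorem coeff_RbarT_mem (i j : Fin N) (b : Rh) (m : ℕ) (I K : IdxN N) : coeff m (RbarT c i j b) I K ∈ Ac c G := by
  rw [RbarT, PowerSeries.coeff_mk, embAt₂, Matrix.of_apply]
  split_ifs
  · exact Subalgebra.algebraMap_mem _ _
  · exact zero_mem _

theorem factor_mem_Mc (x : Fin N ⊕ Fin N × Fin N) (k : ℤ) (I K : IdxN N) {w : Vac N c} (hw : w ∈ Mc c G) :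
    factor c G x k I K w ∈ Mc c G := by
  rcases x with i | ⟨i, j⟩
  · rw [factor, SPlusOp]
    split_ifs
    · refine tsum_mem_Mc fun l => Submodule.smul_mem _ _ (act_mem_Mc ?_ hw)
      rw [embAt, Matrix.of_apply]
      split_ifs
      · exact coeff_SPlus_mem _ _ _
      · exact zero_mem _
    · exact zero_mem _
  · rw [factor, ofInv]
    split_ifs
    · exact act_mem_Mc (coeff_RbarT_mem _ _ _ _ _ _) hw
    · exact zero_mem _

theorem applyList_mem_Mc {X : VecSer N c} (hX : ∀ k I, X k I ∈ Mc c G) :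
    ∀ (l : List (Fin N ⊕ Fin N × Fin N)) k I, applyList (l.map (factor c G)) X k I ∈ Mc c G
  | [], k, I => hX k I
  | x :: l, k, I =>
    tsum_mem_Mc fun m => sum_mem fun K _ => factor_mem_Mc x m I K (applyList_mem_Mc hX l (k - m) K)

end Module

/-! ### The coefficients of `M(u)` -/

section Main

variable {N : ℕ} {c : ℂ} {G : Matrix (Fin N) (Fin N) ℂ}

theorem startSer_vac (hdet : IsUnit G.det) (K : IdxN N) (k : ℤ) (I : IdxN N) :
    startSer c G (vac N c) K k I = if k ≤ 0 then
      (h ^ (-k).toNat * coeff (-k).toNat (Ring.inverse (scalarPart G (-2 * c))) I K) • vac N c else 0 := by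
  rw [startSer, ofInv]
  split_ifs
  · exact (actsAs_SN actsAs_T_vac).inverse (isUnit_SN hdet)
      (Ring.mul_inverse_cancel _ (isUnit_scalarPart hdet _)) _ _ _
  · rfl

theorem repVec_startSer (hdet : IsUnit G.det) (n : ℕ) (hn : n ≠ 0) (K : IdxN N) :
    RepVec n (startSer c G (vac N c) K)
      (lam (nilH_end n) hn (Ring.inverse (scalarPart G (-2 * c)))) K (ev n (vac N c)) := by
  intro k I
  rw [startSer_vac hdet, coeff_lam]
  split_ifs
  · rw [map_smul, mul_smul, Matrix.smul_apply, LinearMap.smul_apply, Matrix.map_apply, Module.algebraMap_end_apply]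
  · exact map_zero _

theorem applyList_SPlusN (hdet : IsUnit G.det) (K : IdxN N) :
    ApplyConverges (SPlusN c G) (startSer c G (vac N c) K) ∧ ∀ n (hn : n ≠ 0),
      RepVec n (applyList (SPlusN c G) (startSer c G (vac N c) K))
        (lauS (nilH_end n) hn (genQ N c n) G *
          lam (nilH_end n) hn (Ring.inverse (scalarPart G (-2 * c)))) K (ev n (vac N c)) := by
  have h1 := applyList_spec (factor c G) (fun n hn => factorQ c hn G)
    (fun n hn => repVec_startSer hdet n hn K) (factorIdx N) fun x hx n hn => repOp_factor hn G x hx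
  rw [← SPlusN_eq] at h1
  exact ⟨h1.1, fun n hn => by rw [← prod_factorQ]; exact h1.2 n hn⟩

/-- Starting from `e_K` and reading off the component `K` gives the diagonal entries, so the trace
is taken of a genuine product of Laurent series. -/
theorem ev_M (hdet : IsUnit G.det) (n : ℕ) (hn : n ≠ 0) (k : ℤ) :
    ev n (M c G k) = ∑ K, (up (C (asym N _)) * lauS (nilH_end n) hn (genQ N c n) G *
      lam (nilH_end n) hn (Ring.inverse (scalarPart G (-2 * c)))).coeff k K K (ev n (vac N c)) := by
  rw [M, opA, map_sum]
  refine Finset.sum_congr rfl fun K _ => ?_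
  rw [map_sum, mul_assoc, up, HahnSeries.ofPowerSeries_C]
  erw [HahnSeries.coeff_single_zero_mul]
  rw [Matrix.mul_apply, LinearMap.sum_apply]
  refine Finset.sum_congr rfl fun I _ => ?_
  rw [map_smul, (applyList_SPlusN hdet K).2 n hn]
  rfl

/-- Modulo `hⁿ`, `M_k` is an operator commuting with the coefficients of `T(v)`, applied to the
vacuum; a coefficient annihilating the vacuum therefore annihilates `M_k`. -/
theorem actsAs_T_M (hN : N ≠ 0) (hdet : IsUnit G.det) (hG : G.transpose = G ∨ G.transpose = -G) (k : ℤ) :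
    ActsAs (M c G k) (T (gen N c)) 1 := by
  have key : ∀ m (a b : Fin N), act (coeff m (T (gen N c)) a b) (vac N c) = 0 →
      act (coeff m (T (gen N c)) a b) (M c G k) = 0 := by
    intro m a b h0
    refine ext_ev' fun n hn => ?_
    have h1 : actQ N c n (coeff m (T (gen N c)) a b) = coeff m (T (genQ N c n)) a b := by
      have := congrArg (fun F : PowerSeries (Matrix (Fin N) (Fin N) (Module.End Rh (VacQ N c n))) => coeff m F a b) (map_T (actQ N c n) (gen N c))
      simp only [PowerSeries.coeff_map] at this
      exact this
    have h2 : coeff m (T (genQ N c n)) a b (ev n (vac N c)) = 0 := by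
      rw [← h1, ← ev_act, h0, map_zero]
    rw [ev_act, h1, map_zero, ev_M hdet n hn, map_sum]
    refine Finset.sum_eq_zero fun K _ => ?_
    have h3 := entCommute_lauS (nilH_end n) hn G hN (relationSeries_genQ (c := c) 1) (relationSeries_genQ 2) hG
      (Ring.inverse (scalarPart G (-2 * c))) m a b k K K
    have h4 := congrArg (fun f : Module.End Rh (VacQ N c n) => f (ev n (vac N c))) h3.eq
    refine h4.trans ?_
    rw [Module.End.mul_apply, h2, map_zero]
  intro m a b
  -- The constant coefficient of `T` is the identity; the other coefficients annihilate the vacuum.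
  rcases m with _ | m
  · have h1 := actsAs_one (w := M c G k) 0 a b
    rwa [PowerSeries.coeff_zero_eq_constantCoeff_apply, map_one, ← constantCoeff_T,
      ← PowerSeries.coeff_zero_eq_constantCoeff_apply] at h1
  · have h1 : coeff (m + 1) (1 : PowerSeries (Matrix (Fin N) (Fin N) Rh)) a b = 0 := by
      rw [PowerSeries.coeff_one, if_neg m.succ_ne_zero, Matrix.zero_apply]
    have h2 := actsAs_T_vac (c := c) (m + 1) a b
    rw [h1, mul_zero, zero_smul] at h2 ⊢
    exact key _ _ _ h2

/-- The inverse of `S_{[N]}` only produces scalar multiples of the vacuum, and every later factor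
has entries in `A_c`, up to convergent sums. -/
theorem M_mem_Mc (hdet : IsUnit G.det) (k : ℤ) : M c G k ∈ Mc c G := by
  refine sum_mem fun K _ => sum_mem fun I _ => Submodule.smul_mem _ _ ?_
  rw [SPlusN_eq]
  refine applyList_mem_Mc (fun k I => ?_) _ _ _
  rw [startSer_vac hdet]
  split_ifs
  · exact Submodule.smul_mem _ _ vac_mem_Mc
  · exact zero_mem _

theorem M_mem_invariants (hN : N ≠ 0) (hdet : IsUnit G.det) (hG : G.transpose = G ∨ G.transpose = -G) (k : ℤ) :
    M c G k ∈ invariants c G :=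
  ⟨M_mem_Mc hdet k, fun i j m => actsAs_C_iff.1 (actsAs_S (actsAs_T_M hN hdet hG k)) m i j⟩

end Main

end TwistedYangian

end

theorem mainTheorem10 (N : ℕ) (hN : 2 ≤ N) (G : Matrix (Fin N) (Fin N) ℂ)
    (hdet : IsUnit G.det) (hsym : G.transpose = G ∨ G.transpose = -G)
    (c : ℂ) (hc : c ≠ -(N : ℂ) / 2) :
    TwistedYangian.AWellDefined c G (TwistedYangian.vac N c) ∧
      ∀ k : ℤ, TwistedYangian.M c G k ∈ TwistedYangian.invariants c G :=
  ⟨⟨TwistedYangian.isUnit_SN hdet, fun i k I K v => (TwistedYangian.summable_shiftTerm G i k I K v).1,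
    fun K => (TwistedYangian.applyList_SPlusN hdet K).1⟩,
    TwistedYangian.M_mem_invariants (by omega) hdet hsym⟩
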